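/- **Definitions.** All graphs are finite. A digraph $G=(V,E)$ with $V\neq\emptyset$ is *twinless strongly connected* if it has a strongly connected spanning subgraph without any pair of antiparallel edges $(u,v),(v,u)$, $u\ne v$. A *twinless strongly connected component* (TSCC) of $G$ is a maximal $C\subseteq V$ whose induced subgraph is twinless strongly connected. A *twinless articulation point* is a vertex whose removal increases the number of TSCCs. $G$ is *2-vertex-twinless-connected* if it is twinless strongly connected, has at least three vertices and has no twinless articulation point. A *2-twinless block* of $G$ is a maximal $B\subseteq V$ with $|B|\ge 2$ such that any two distinct $x,y\in B$ lie in the same TSCC of $G\setminus\{w\}$ for every $w\in V\setminus\{x,y\}$. A *block* of an undirected graph is a maximal connected subgraph without a cut vertex, identified with its vertex set. **Algorithm 1.** Input: a twinless strongly connected digraph $G=(V,E)$ with $V=\{0,\dots,n-1\}$, given by its adjacency matrix. 1. If $G$ is 2-vertex-twinless-connected, output $V$ and stop. 2. Otherwise let $S$ be the $n\times n$ matrix with all entries $1$, and determine the twinless articulation points of $G$. 3. For each twinless articulation point $z$: identify the TSCCs of $G\setminus\{z\}$; for each pair $(v,w)\in (V\setminus\{z\})^2$, if $v,w$ lie in different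 TSCCs of $G\setminus\{z\}$, set $S[v,w]\leftarrow 0$. 4. Set $E^b\leftarrow\emptyset$; for each $(v,w)\in V\times V$ with $S[v,w]=S[w,v]=1$, add $(v,w)$ to $E^b$. 5. Calculate the blocks of size at least $2$ of the undirected graph $G^b=(V,E^b)$ (loops ignored) and output them. **Machine model.** Programs are while-programs on a random access machine with unit costs, whose registers are arrays of natural numbers and whose arithmetic is successor, predecessor and comparison; one step is charged per elementary operation. Memory other than the input has arbitrary initial contents. Four tasks of the algorithm are delegated to subroutines: the test in step 1, the twinless articulation points of $G$, the TSCCs of $G\setminus\{z\}$ for a given $z$, and the blocks of size at least $2$ of an undirected graph on $n\ge1$ vertices. Call a choice of four subroutine programs *admissible* if each of them correctly solves its task, changes only its result registers and scratch registers, and runs in time $O(n^2)$ for the TSCCs of $G\setminus\{z\}$ and in time $O(n^3)$ for each of the other three. (On adjacency matrices, linear-time algorithms for these tasks run in time $O(n^2)$, within these bounds.) **Theorem.** Admissible subroutines exist. Moreover, for every admissible choice of subroutines, Algorithm 1 computes the 2-twinless blocks of twinless strongly connected digraphs in $O(n^3)$ time: there is a constant $K$ such that for every $n$, every twinless strongly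 connected digraph $G$ on $\{0,\dots,n-1\}$ and every initial memory that contains $G$, the algorithm halts after at most $K n^3$ steps and its output lists every 2-twinless block of $G$ exactly once and nothing else. -/

import Mathlib

namespace TwinlessBlocks

/-! ## Twinless connectivity of directed graphs -/

section Graphs

variable {V : Type*}

/-- The subgraph of `G` induced on the vertex set `U`. -/
def induced (G : Digraph V) (U : Set V) : Digraph U where
  Adj a b := G.Adj a b

/-- The graph `G \ {w}`. -/
def deleteVertex (G : Digraph V) (w : V) : Digraph ({w}ᶜ : Set V) :=
  induced G {w}ᶜ

/-- Every vertex reaches every vertex along directed edges. -/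
def IsStronglyConnected (G : Digraph V) : Prop :=
  ∀ u v : V, Relation.ReflTransGen G.Adj u v

/-- There is a strongly connected spanning subgraph without any pair of antiparallel edges.
The graph without vertices is not counted as connected. -/
def IsTwinlessStronglyConnected (G : Digraph V) : Prop :=
  Nonempty V ∧ ∃ H : Digraph V, H ≤ G ∧ IsStronglyConnected H ∧
    ∀ u v : V, u ≠ v → ¬ (H.Adj u v ∧ H.Adj v u)

/-- `C` is a twinless strongly connected component of `G`: an inclusion-maximal vertex set
inducing a twinless strongly connected subgraph. -/
def IsTSCC (G : Digraph V) (C : Set V) : Prop :=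
  Maximal (fun U : Set V => IsTwinlessStronglyConnected (induced G U)) C

/-- `x` and `y` lie in the same twinless strongly connected component of `G`. -/
def SameTSCC (G : Digraph V) (x y : V) : Prop :=
  ∃ C : Set V, IsTSCC G C ∧ x ∈ C ∧ y ∈ C

/-- Deleting `v` increases the number of twinless strongly connected components
(for finite graphs). -/
def IsTwinlessArticulationPoint (G : Digraph V) (v : V) : Prop :=
  {C : Set V | IsTSCC G C}.ncard <
    {C : Set ({v}ᶜ : Set V) | IsTSCC (deleteVertex G v) C}.ncard

/-- Twinless strongly connected, at least three vertices, no twinless articulation point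
(for finite graphs). -/
def IsTwoVertexTwinlessConnected (G : Digraph V) : Prop :=
  IsTwinlessStronglyConnected G ∧ 3 ≤ Nat.card V ∧ ∀ v, ¬ IsTwinlessArticulationPoint G v

/-- `B` is a 2-twinless block of `G`: an inclusion-maximal vertex set with at least two elements
such that any two distinct `x, y ∈ B` lie in the same twinless strongly connected component of
`G \ {w}`, for every vertex `w` other than `x` and `y`. -/
def IsTwoTwinlessBlock (G : Digraph V) (B : Set V) : Prop :=
  Maximal (fun U : Set V => U.Nontrivial ∧
    ∀ x ∈ U, ∀ y ∈ U, x ≠ y → ∀ (w : V) (hx : x ≠ w) (hy : y ≠ w),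
      SameTSCC (deleteVertex G w) ⟨x, hx⟩ ⟨y, hy⟩) B

/-- `B` is (the vertex set of) a block of the undirected graph `H`: a maximal connected subgraph
without a cut vertex. -/
def IsBlock (H : SimpleGraph V) (B : Set V) : Prop :=
  Maximal (fun U : Set V => (H.induce U).Connected ∧
    ∀ v ∈ U, (H.induce (U \ {v})).Preconnected) B

end Graphs

/-! ## Programs and their running time

A random access machine with unit costs. The memory consists of registers, each of them a
two-dimensional array of natural numbers (an array or a scalar is a two-dimensional array of which
only the entries `(i, 0)` or only the entry `(0, 0)` are used). The only arithmetic is successor,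
predecessor and comparison, so that no value can grow by more than one per step. -/

/-- Names of registers: those that the pseudocode mentions, and scratch registers. -/
inductive Reg where
  /-- the number of vertices -/
  | size
  /-- the adjacency matrix of the input graph -/
  | adj
  /-- answer to the test for 2-vertex-twinless-connectivity -/
  | flag
  /-- marks of the twinless articulation points -/
  | ap
  /-- labels of the twinless strongly connected components -/
  | comp
  /-- the matrix `S` -/
  | S
  /-- the adjacency matrix of the undirected graph with edge set `E^b` -/
  | Eb
  /-- the loop variable `z` -/
  | z
  /-- the loop variable `v` -/
  | v
  /-- the loop variable `w` -/
  | w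
  /-- the number of vertex sets in the output -/
  | outCount
  /-- the output: row `i` marks the elements of the `i`-th vertex set -/
  | out
  /-- scratch registers -/
  | tmp (k : ℕ)

/-- Contents of the memory. -/
abbrev Store := Reg → ℕ → ℕ → ℕ

open Classical in
/-- The memory `σ` after writing the value `a` into the entry `(i, j)` of the register `x`. -/
noncomputable def Store.write (σ : Store) (x : Reg) (i j a : ℕ) : Store :=
  fun y k l => if y = x ∧ k = i ∧ l = j then a else σ y k l

/-- Expressions. -/
inductive Expr where
  | lit (k : ℕ)
  | get (x : Reg) (i j : Expr)
  | succ (e : Expr)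
  | pred (e : Expr)
  | eq (e f : Expr)
  | lt (e f : Expr)
  | and (e f : Expr)
  | not (e : Expr)

/-- Value of an expression; the truth values are `1` and `0`, and every nonzero value counts
as true. -/
def Expr.eval (σ : Store) : Expr → ℕ
  | lit k => k
  | get x i j => σ x (i.eval σ) (j.eval σ)
  | succ e => e.eval σ + 1
  | pred e => e.eval σ - 1
  | eq e f => if e.eval σ = f.eval σ then 1 else 0
  | lt e f => if e.eval σ < f.eval σ then 1 else 0
  | and e f => if e.eval σ ≠ 0 ∧ f.eval σ ≠ 0 then 1 else 0
  | not e => if e.eval σ = 0 then 1 else 0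

/-- Number of steps for evaluating an expression: one for each operation in it. -/
def Expr.cost : Expr → ℕ
  | lit _ => 1
  | get _ i j => i.cost + j.cost + 1
  | succ e => e.cost + 1
  | pred e => e.cost + 1
  | eq e f => e.cost + f.cost + 1
  | lt e f => e.cost + f.cost + 1
  | and e f => e.cost + f.cost + 1
  | not e => e.cost + 1

/-- Programs. `set x i j e` is the assignment `x[i, j] ← e`. -/
inductive Cmd where
  | skip
  | set (x : Reg) (i j e : Expr)
  | seq (c d : Cmd)
  | ite (b : Expr) (c d : Cmd)
  | while (b : Expr) (c : Cmd)

/-- `Exec c σ t τ`: started in the memory `σ`, the program `c` halts after exactly `t` steps with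
the memory `τ`. -/
inductive Exec : Cmd → Store → ℕ → Store → Prop where
  | skip (σ : Store) : Exec .skip σ 1 σ
  | set (σ : Store) (x : Reg) (i j e : Expr) :
      Exec (.set x i j e) σ (i.cost + j.cost + e.cost + 1)
        (σ.write x (i.eval σ) (j.eval σ) (e.eval σ))
  | seq {c d : Cmd} {σ τ ρ : Store} {s t : ℕ} :
      Exec c σ s τ → Exec d τ t ρ → Exec (.seq c d) σ (s + t) ρ
  | ite_true {b : Expr} {c d : Cmd} {σ τ : Store} {t : ℕ} :
      b.eval σ ≠ 0 → Exec c σ t τ → Exec (.ite b c d) σ (b.cost + 1 + t) τ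
  | ite_false {b : Expr} {c d : Cmd} {σ τ : Store} {t : ℕ} :
      b.eval σ = 0 → Exec d σ t τ → Exec (.ite b c d) σ (b.cost + 1 + t) τ
  | while_true {b : Expr} {c : Cmd} {σ τ ρ : Store} {s t : ℕ} :
      b.eval σ ≠ 0 → Exec c σ s τ → Exec (.while b c) τ t ρ →
        Exec (.while b c) σ (b.cost + 1 + s + t) ρ
  | while_false {b : Expr} {c : Cmd} {σ : Store} :
      b.eval σ = 0 → Exec (.while b c) σ (b.cost + 1) σ

/-! ## The algorithm -/

/-- The scalar `x`. -/
def scalar (x : Reg) : Expr := .get x (.lit 0) (.lit 0)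

/-- The assignment `x ← e` to a scalar. -/
def assign (x : Reg) (e : Expr) : Cmd := .set x (.lit 0) (.lit 0) e

/-- `for x = 0, …, n - 1 do c`, where `n` is the number of vertices. -/
def forEach (x : Reg) (c : Cmd) : Cmd :=
  .seq (assign x (.lit 0))
    (.while (.lt (scalar x) (scalar .size)) (.seq c (assign x (.succ (scalar x)))))

/-- `if b then c`. -/
def when (b : Expr) (c : Cmd) : Cmd := .ite b c .skip

/-- The programs for those lines of the algorithm that refer to other algorithms. -/
structure Subroutines where
  /-- tests whether the graph is 2-vertex-twinless-connected -/
  test : Cmd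
  /-- determines the twinless articulation points -/
  articulationPoints : Cmd
  /-- identifies the twinless strongly connected components of `G \ {z}` -/
  components : Cmd
  /-- calculates and outputs the blocks with at least two vertices of an undirected graph -/
  blocks : Cmd

/-- Output the set of all vertices (as the only set). -/
def outputAll : Cmd :=
  .seq (forEach .v (.set .out (.lit 0) (scalar .v) (.lit 1)))
    (assign .outCount (.lit 1))

/-- Initialize the matrix `S` with ones. -/
def initS : Cmd :=
  forEach .v (forEach .w (.set .S (scalar .v) (scalar .w) (.lit 1)))

/-- For each pair `(v, w)` of vertices other than `z`: if `v` and `w` lie in different components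
of `G \ {z}` then `S[v, w] ← 0`. -/
def separatePairs : Cmd :=
  forEach .v (forEach .w
    (when (.and (.not (.eq (scalar .v) (scalar .z))) (.not (.eq (scalar .w) (scalar .z))))
      (when (.not (.eq (.get .comp (scalar .v) (.lit 0)) (.get .comp (scalar .w) (.lit 0))))
        (.set .S (scalar .v) (scalar .w) (.lit 0)))))

/-- `E^b ← ∅`. -/
def clearEb : Cmd :=
  forEach .v (forEach .w (.set .Eb (scalar .v) (scalar .w) (.lit 0)))

/-- For each pair `(v, w)` of vertices: if `S[v, w] = 1` and `S[w, v] = 1` then add `(v, w)`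
to `E^b`. -/
def buildEb : Cmd :=
  forEach .v (forEach .w
    (when (.and (.eq (.get .S (scalar .v) (scalar .w)) (.lit 1))
        (.eq (.get .S (scalar .w) (scalar .v)) (.lit 1)))
      (.set .Eb (scalar .v) (scalar .w) (.lit 1))))

/-- The algorithm for the 2-twinless blocks. -/
def algorithm (P : Subroutines) : Cmd :=
  .seq P.test
    (.ite (.eq (scalar .flag) (.lit 1))
      outputAll
      (.seq initS
        (.seq P.articulationPoints
          (.seq
            (forEach .z
              (when (.eq (.get .ap (scalar .z) (.lit 0)) (.lit 1))
                (.seq P.components separatePairs)))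
            (.seq clearEb (.seq buildEb P.blocks))))))

/-! ## Input, output and the tasks of the subroutines -/

/-- The memory `σ` holds `n` and the adjacency matrix of the graph `G` on `{0, …, n - 1}`
(nothing is said about the rest of the memory). -/
def HoldsDigraph {n : ℕ} (σ : Store) (G : Digraph (Fin n)) : Prop :=
  σ .size 0 0 = n ∧ ∀ a b : Fin n, σ .adj a b = 1 ↔ G.Adj a b

/-- The memory `σ` holds `n` and, in `Eb`, the adjacency matrix of the undirected graph `H` on
`{0, …, n - 1}`; the entries on the diagonal are irrelevant. -/
def HoldsGraph {n : ℕ} (σ : Store) (H : SimpleGraph (Fin n)) : Prop :=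
  σ .size 0 0 = n ∧ ∀ a b : Fin n, a ≠ b → (σ .Eb a b = 1 ↔ H.Adj a b)

/-- The output in the memory `σ` lists every vertex set in the family `F` exactly once, and
nothing else. -/
def Outputs {n : ℕ} (σ : Store) (F : Set (Set (Fin n))) : Prop :=
  Set.BijOn (fun i : ℕ => {a : Fin n | σ .out i a = 1}) (Set.Iio (σ .outCount 0 0)) F

/-- Started in the memory `σ`, the program `c` halts after at most `T` steps, with a memory that
satisfies `Q` and differs from `σ` only in scratch registers and the registers in `W`. -/
def Achieves (c : Cmd) (σ : Store) (T : ℕ) (W : Set Reg) (Q : Store → Prop) : Prop :=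
  ∃ (t : ℕ) (τ : Store), Exec c σ t τ ∧ t ≤ T ∧
    (∀ x : Reg, x ∉ W → (∀ k, x ≠ .tmp k) → τ x = σ x) ∧ Q τ

/-- `c` decides in time `O(n ^ 3)` whether the input is 2-vertex-twinless-connected. -/
def IsTest (c : Cmd) : Prop :=
  ∃ K : ℕ, ∀ (n : ℕ) (G : Digraph (Fin n)), IsTwinlessStronglyConnected G →
    ∀ σ : Store, HoldsDigraph σ G →
      Achieves c σ (K * n ^ 3) {.flag} fun τ =>
        (τ .flag 0 0 = 1 ↔ IsTwoVertexTwinlessConnected G)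

/-- `c` marks the twinless articulation points of the input in time `O(n ^ 3)`. -/
def FindsArticulationPoints (c : Cmd) : Prop :=
  ∃ K : ℕ, ∀ (n : ℕ) (G : Digraph (Fin n)), IsTwinlessStronglyConnected G →
    ∀ σ : Store, HoldsDigraph σ G →
      Achieves c σ (K * n ^ 3) {.ap} fun τ =>
        ∀ a : Fin n, τ .ap a 0 = 1 ↔ IsTwinlessArticulationPoint G a

/-- `c` labels the vertices of `G \ {z}` in time `O(n ^ 2)`, such that two vertices get the same
label if and only if they lie in the same twinless strongly connected component of `G \ {z}`. -/
def FindsComponents (c : Cmd) : Prop :=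
  ∃ K : ℕ, ∀ (n : ℕ) (G : Digraph (Fin n)), IsTwinlessStronglyConnected G →
    ∀ (z : Fin n) (σ : Store), HoldsDigraph σ G → σ .z 0 0 = z →
      Achieves c σ (K * n ^ 2) {.comp} fun τ =>
        ∀ (a b : Fin n) (ha : a ≠ z) (hb : b ≠ z),
          τ .comp a 0 = τ .comp b 0 ↔ SameTSCC (deleteVertex G z) ⟨a, ha⟩ ⟨b, hb⟩

/-- `c` outputs the blocks with at least two vertices of any undirected graph with `n ≥ 1` vertices
in time `O(n ^ 3)`. -/
def FindsBlocks (c : Cmd) : Prop :=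
  ∃ K : ℕ, ∀ (n : ℕ) (H : SimpleGraph (Fin n)), 0 < n →
    ∀ σ : Store, HoldsGraph σ H →
      Achieves c σ (K * n ^ 3) {.outCount, .out} fun τ =>
        Outputs τ {B | IsBlock H B ∧ B.Nontrivial}

/-- The subroutines solve their tasks, in time `O(n ^ 2)` for the components (which are computed
for up to `n` vertices `z`) and in time `O(n ^ 3)` for those that run only once. -/
def Subroutines.Admissible (P : Subroutines) : Prop :=
  IsTest P.test ∧ FindsArticulationPoints P.articulationPoints ∧
    FindsComponents P.components ∧ FindsBlocks P.blocks

end TwinlessBlocks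

/-!
The correctness of the algorithm rests on a description of twinless strongly connected components by
cuts. Call two vertices *linked* if no cut crossed by at most one edge separates them, where
directions are ignored and antiparallel edges count as one. Two vertices reach each other in a
subgraph without antiparallel edges if and only if they are linked in the graph of those edges that
lie on closed walks (`twinlessRelated_iff_linked`). For the nontrivial direction, antiparallel edges
are removed one pair after another: either one of the two edges can be left out without affecting
reachability, or the pair is a bridge of the underlying undirected graph, so that both edges can be
left out without affecting linked vertices (`exists_bridge_cut`, `exists_twinless_subgraph`). Being
linked is an equivalence relation, whence the components partition the vertices (`sameTSCC_iff`),
and the articulation points of a twinless strongly connected graph are the vertices `z` such that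
`G \ {z}` has two vertices in different components (`isTwinlessArticulationPoint_iff`).

A 2-twinless block is therefore a maximal clique, with at least two elements, of the graph
`blockGraph G` that joins two vertices if they lie in the same component of `G \ {w}` for all other
vertices `w`; the matrix `S` is its adjacency matrix off the diagonal, since only articulation
points separate pairs. The blocks with at least two vertices of any undirected graph are the
maximal cliques of the relation of being inseparable by a vertex (`isBlock_and_nontrivial_iff`). In
the auxiliary graph this relation is adjacency: along a walk that avoids `w`, all vertices lie in
the same component of `G \ {w}`. Hence its blocks are the 2-twinless blocks
(`isBlock_blockGraph_iff`). Since the components are computed in time `O(n ^ 2)` for at most `n`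
vertices, the loop over the articulation points takes time `O(n ^ 3)`, like everything else
(`exec_separationLoop`, `exec_algorithm`).

Admissible subroutines are written down explicitly. All of them are built from loops over the
vertices, so that the nesting depth of the loops bounds the running time (`LoopProgram.exec_toCmd`),
and from the path-based search for strongly connected components, which takes `O(n)` steps of `O(n)`
operations each. The search contracts the segments of a path whenever an edge leads back to the
path, and maintains the set of the heads of the edges that leave each segment. In its original form
it labels the strongly connected components (`PathState.Reached.lab_eq_iff_reach`). Applied to a
symmetric graph, with the reverse of each edge of the path deleted, it contracts the last two
segments only if the edge between them is not a bridge, and thus labels the classes of linked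
vertices (`PathState.Reached.linked_and_related`). Running one after the other yields the components
of `G \ {z}` in time `O(n ^ 2)` (`LoopProgram.lab_components`). Comparing labels for all `z` yields
the articulation points, and searching `H \ {z}` for all `z` yields the inseparable pairs of an
undirected graph `H`; each of its blocks is output when its two least vertices are met.
-/

namespace TwinlessBlocks

/-! ### Cuts with at most one edge -/

section Cuts

variable {V : Type*}

/-- The set `A` is joined to its complement by at most one edge, where directions are ignored and
antiparallel edges count as one. -/
def IsThinCut (E : V → V → Prop) (A : Set V) : Prop :=
  ∃ p q : V, ∀ x y, E x y → (x ∈ A ↔ y ∉ A) → (x = p ∧ y = q) ∨ (x = q ∧ y = p)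

/-- No cut with at most one edge separates `a` and `b`. -/
def Linked (E : V → V → Prop) (a b : V) : Prop :=
  ∀ A, IsThinCut E A → (a ∈ A ↔ b ∈ A)

/-- There is no pair of antiparallel edges. -/
def Twinless (H : V → V → Prop) : Prop :=
  ∀ u v : V, u ≠ v → ¬ (H u v ∧ H v u)

/-- Every edge lies on a closed walk. -/
def Cyclic (E : V → V → Prop) : Prop :=
  ∀ x y, E x y → Relation.ReflTransGen E y x

/-- The edges of `E` that lie on closed walks, that is, inside strongly connected components. -/
def core (E : V → V → Prop) (x y : V) : Prop :=
  E x y ∧ Relation.ReflTransGen E y x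

/-- `a` and `b` reach each other inside a subgraph without antiparallel edges. -/
def TwinlessRelated (E : V → V → Prop) (a b : V) : Prop :=
  ∃ H : V → V → Prop, (∀ x y, H x y → E x y) ∧ Twinless H ∧
    Relation.ReflTransGen H a b ∧ Relation.ReflTransGen H b a

theorem Linked.refl (E : V → V → Prop) (a : V) : Linked E a a := fun _ _ => Iff.rfl

theorem Linked.symm {E : V → V → Prop} {a b : V} (h : Linked E a b) : Linked E b a :=
  fun A hA => (h A hA).symm

theorem Linked.trans {E : V → V → Prop} {a b c : V} (h : Linked E a b) (h' : Linked E b c) :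
    Linked E a c :=
  fun A hA => (h A hA).trans (h' A hA)

theorem isThinCut_symmetrize {E : V → V → Prop} {A : Set V} :
    IsThinCut (fun x y => E x y ∨ E y x) A ↔ IsThinCut E A := by
  constructor
  · rintro ⟨p, q, h⟩
    exact ⟨p, q, fun x y hxy => h x y (Or.inl hxy)⟩
  · rintro ⟨p, q, h⟩
    refine ⟨p, q, fun x y hxy hA => ?_⟩
    rcases hxy with hxy | hxy
    · exact h x y hxy hA
    · have := h y x hxy (by tauto)
      tauto

theorem linked_symmetrize {E : V → V → Prop} {a b : V} :
    Linked (fun x y => E x y ∨ E y x) a b ↔ Linked E a b := by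
  simp only [Linked, isThinCut_symmetrize]

/-- A walk that leaves `A` uses an edge that leaves `A`. -/
theorem exists_edge_of_reach {H : V → V → Prop} {a b : V} {A : Set V}
    (h : Relation.ReflTransGen H a b) (ha : a ∈ A) (hb : b ∉ A) :
    ∃ x y, H x y ∧ x ∈ A ∧ y ∉ A ∧ Relation.ReflTransGen H a x ∧ Relation.ReflTransGen H y b := by
  induction h with
  | refl => exact absurd ha hb
  | @tail c d hac hcd ih =>
    by_cases hc : c ∈ A
    · exact ⟨c, d, hcd, hc, hb, hac, .refl⟩
    · obtain ⟨x, y, hxy, hx, hy, h1, h2⟩ := ih hc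
      exact ⟨x, y, hxy, hx, hy, h1, h2.tail hcd⟩

theorem reach_mono {E F : V → V → Prop} (hEF : ∀ x y, E x y → F x y) {a b : V}
    (h : Relation.ReflTransGen E a b) : Relation.ReflTransGen F a b :=
  Relation.ReflTransGen.mono (fun x y h => hEF x y h) a b h

theorem reach_closed {E : V → V → Prop} {A : Set V} (hA : ∀ x y, E x y → x ∈ A → y ∈ A)
    {a b : V} (h : Relation.ReflTransGen E a b) (ha : a ∈ A) : b ∈ A := by
  induction h with
  | refl => exact ha
  | tail _ hcd ih => exact hA _ _ hcd ih

theorem TwinlessRelated.linked {E : V → V → Prop} {a b : V} (h : TwinlessRelated E a b) :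
    Linked (core E) a b := by
  obtain ⟨H, hHE, hH, hab, hba⟩ := h
  have key : ∀ A : Set V, IsThinCut (core E) A → ∀ c d, Relation.ReflTransGen H c d →
      Relation.ReflTransGen H d c → c ∈ A → d ∈ A := by
    rintro A ⟨p, q, hpq⟩ c d hcd hdc hc
    by_contra hd
    obtain ⟨x, y, hxy, hx, hy, h1, h2⟩ := exists_edge_of_reach hcd hc hd
    obtain ⟨x', y', hxy', hx', hy', h1', h2'⟩ :=
      exists_edge_of_reach (A := Aᶜ) hdc hd (by simpa using hc)
    have e1 : core E x y := ⟨hHE _ _ hxy, reach_mono hHE ((h2.trans hdc).trans h1)⟩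
    have e2 : core E x' y' := ⟨hHE _ _ hxy', reach_mono hHE ((h2'.trans hcd).trans h1')⟩
    simp only [Set.mem_compl_iff, not_not] at hx' hy'
    have f1 := hpq x y e1 (by tauto)
    have f2 := hpq x' y' e2 (by tauto)
    have hne : x ≠ y := fun e => hy (e ▸ hx)
    rcases f1 with ⟨rfl, rfl⟩ | ⟨rfl, rfl⟩ <;> rcases f2 with ⟨rfl, rfl⟩ | ⟨rfl, rfl⟩ <;>
      first | exact hx' hx | exact hH _ _ hne ⟨hxy, hxy'⟩
  exact fun A hA => ⟨key A hA a b hab hba, key A hA b a hba hab⟩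

theorem TwinlessRelated.mono {E F : V → V → Prop} (hEF : ∀ x y, E x y → F x y) {a b : V}
    (h : TwinlessRelated E a b) : TwinlessRelated F a b := by
  obtain ⟨H, hHE, h⟩ := h
  exact ⟨H, fun x y hxy => hEF _ _ (hHE x y hxy), h⟩

/-- Twinless relatedness only involves edges that lie on closed walks. -/
theorem TwinlessRelated.core {E : V → V → Prop} {a b : V} (h : TwinlessRelated E a b) :
    TwinlessRelated (core E) a b := by
  obtain ⟨H, hHE, hH, hab, hba⟩ := h
  refine ⟨fun x y => H x y ∧ Relation.ReflTransGen H y x,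
    fun x y hxy => ⟨hHE _ _ hxy.1, reach_mono hHE hxy.2⟩,
    fun u v huv h => hH u v huv ⟨h.1.1, h.2.1⟩, ?_, ?_⟩
  · have : ∀ c, Relation.ReflTransGen H a c → Relation.ReflTransGen H c a →
        Relation.ReflTransGen (fun x y => H x y ∧ Relation.ReflTransGen H y x) a c := by
      intro c hac
      induction hac with
      | refl => exact fun _ => .refl
      | tail hac hcd ih =>
        exact fun hda => (ih (.head hcd hda)).tail ⟨hcd, hda.trans hac⟩
    exact this b hab hba
  · have : ∀ c, Relation.ReflTransGen H b c → Relation.ReflTransGen H c b →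
        Relation.ReflTransGen (fun x y => H x y ∧ Relation.ReflTransGen H y x) b c := by
      intro c hac
      induction hac with
      | refl => exact fun _ => .refl
      | tail hac hcd ih =>
        exact fun hda => (ih (.head hcd hda)).tail ⟨hcd, hda.trans hac⟩
    exact this a hba hab

theorem cyclic_core (E : V → V → Prop) : Cyclic (core E) := by
  rintro x y ⟨hxy, hyx⟩
  have : ∀ c, Relation.ReflTransGen E y c → Relation.ReflTransGen E c x →
      Relation.ReflTransGen (core E) y c := by
    intro c hyc
    induction hyc with
    | refl => exact fun _ => .refl
    | tail hyc hcd ih =>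
      exact fun hdx => (ih (.head hcd hdx)).tail ⟨hcd, (hdx.tail hxy).trans hyc⟩
  exact this x hyx .refl

/-- Removing an edge whose start still reaches its end does not affect reachability. -/
theorem Cyclic.remove {E : V → V → Prop} (hE : Cyclic E) {u v : V}
    (h : Relation.ReflTransGen (fun x y => E x y ∧ ¬ (x = u ∧ y = v)) u v) :
    Cyclic fun x y => E x y ∧ ¬ (x = u ∧ y = v) := by
  rintro x y ⟨hxy, -⟩
  refine Relation.ReflTransGen.lift' id (fun a b hab => ?_) _ _ (hE x y hxy)
  by_cases hu : a = u ∧ b = v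
  · obtain ⟨rfl, rfl⟩ := hu
    exact h
  · exact .single ⟨hab, hu⟩

theorem Linked.remove {E : V → V → Prop} {u v a b : V} (huv : u ≠ v) (hvu : E v u)
    (h : Linked E a b) : Linked (fun x y => E x y ∧ ¬ (x = u ∧ y = v)) a b := by
  rintro A ⟨p, q, hpq⟩
  refine h A ⟨p, q, fun x y hxy hA => ?_⟩
  by_cases hu : x = u ∧ y = v
  · obtain ⟨rfl, rfl⟩ := hu
    have := hpq y x ⟨hvu, fun h => huv h.2⟩ (by tauto)
    tauto
  · exact hpq x y ⟨hxy, hu⟩ hA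

/-- If neither of two antiparallel edges `(u, v)`, `(v, u)` can be left out without losing the
connection between `u` and `v`, then they form a bridge of the underlying undirected graph:
the vertices that `u` reaches without `(u, v)` and those that `v` reaches without `(v, u)` are
disjoint, and no further edges join the two sets. -/
theorem exists_bridge_cut {E : V → V → Prop} (hE : Cyclic E) {u v : V} (huv : E u v) (hvu : E v u)
    (h1 : ¬ Relation.ReflTransGen (fun x y => E x y ∧ ¬ (x = u ∧ y = v)) u v)
    (h2 : ¬ Relation.ReflTransGen (fun x y => E x y ∧ ¬ (x = v ∧ y = u)) v u) :
    ∃ A : Set V, u ∈ A ∧ v ∉ A ∧ ∀ x y, E x y → (x ∈ A ↔ y ∉ A) →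
      (x = u ∧ y = v) ∨ (x = v ∧ y = u) := by
  set A : Set V := {x | Relation.ReflTransGen (fun x y => E x y ∧ ¬ (x = u ∧ y = v)) u x} with hA
  set B : Set V := {x | Relation.ReflTransGen (fun x y => E x y ∧ ¬ (x = v ∧ y = u)) v x} with hB
  have uA : u ∈ A := .refl
  have vB : v ∈ B := .refl
  have outA : ∀ x y, E x y → x ∈ A → y ∈ A ∨ (x = u ∧ y = v) := by
    intro x y hxy hx
    by_cases hu : x = u ∧ y = v
    · exact Or.inr hu
    · exact Or.inl (Relation.ReflTransGen.tail hx ⟨hxy, hu⟩)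
  have outB : ∀ x y, E x y → x ∈ B → y ∈ B ∨ (x = v ∧ y = u) := by
    intro x y hxy hx
    by_cases hu : x = v ∧ y = u
    · exact Or.inr hu
    · exact Or.inl (Relation.ReflTransGen.tail hx ⟨hxy, hu⟩)
  have back : ∀ x y, Relation.ReflTransGen E x y → Relation.ReflTransGen E y x := by
    intro x y hxy
    induction hxy with
    | refl => exact .refl
    | tail _ hcd ih => exact (hE _ _ hcd).trans ih
  have disj : ∀ x, x ∈ A → x ∉ B := by
    intro x hxA hxB
    have hxu : Relation.ReflTransGen E x u :=
      back _ _ (reach_mono (fun _ _ h => h.1) hxA)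
    have hcl : ∀ x y, E x y → x ∈ A ∩ B → y ∈ A ∩ B := by
      rintro x y hxy ⟨hx, hx'⟩
      constructor
      · rcases outA x y hxy hx with h | ⟨rfl, rfl⟩
        · exact h
        · exact absurd hx' h2
      · rcases outB x y hxy hx' with h | ⟨rfl, rfl⟩
        · exact h
        · exact absurd hx h1
    exact h2 (reach_closed hcl hxu ⟨hxA, hxB⟩).2
  have union : ∀ x y, E x y → x ∈ A ∪ B → y ∈ A ∪ B := by
    rintro x y hxy (hx | hx)
    · rcases outA x y hxy hx with h | ⟨rfl, rfl⟩
      exacts [Or.inl h, Or.inr vB]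
    · rcases outB x y hxy hx with h | ⟨rfl, rfl⟩
      exacts [Or.inr h, Or.inl uA]
  refine ⟨A, uA, h1, fun x y hxy hA => ?_⟩
  by_cases hx : x ∈ A
  · rcases outA x y hxy hx with h | h
    · exact absurd h (hA.1 hx)
    · exact Or.inl h
  · have hy : y ∈ A := by tauto
    have hxAB : x ∈ A ∪ B := reach_closed union (hE x y hxy) (Or.inl hy)
    rcases hxAB with h | h
    · exact absurd h hx
    · rcases outB x y hxy h with h | h
      · exact absurd h (disj y hy)
      · exact Or.inr h

/-- If a retraction `f` maps every edge of `E` to a loop or fixes it as an edge of `E'`, then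
reachability between fixed points of `f` survives in `E'`. -/
theorem reach_of_retraction {E E' : V → V → Prop} (f : V → V)
    (hf : ∀ x y, E x y → f x = f y ∨ (E' x y ∧ f x = x ∧ f y = y)) {a b : V}
    (h : Relation.ReflTransGen E a b) (ha : f a = a) (hb : f b = b) :
    Relation.ReflTransGen E' a b := by
  have := Relation.ReflTransGen.lift' (p := E') f (fun x y hxy => ?_) _ _ h
  · simpa only [Function.onFun, ha, hb] using this
  · rcases hf x y hxy with h | ⟨h, hx, hy⟩
    · simp only [Function.onFun, h]; exact .refl
    · simp only [Function.onFun, hx, hy]; exact .single h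

theorem linked_of_retraction {E E' : V → V → Prop} (f : V → V)
    (hf : ∀ x y, E x y → f x = f y ∨ (E' x y ∧ f x = x ∧ f y = y)) {a b : V}
    (h : Linked E a b) (ha : f a = a) (hb : f b = b) : Linked E' a b := by
  rintro A ⟨p, q, hpq⟩
  have := h {t | f t ∈ A} ⟨p, q, fun x y hxy hA => ?_⟩
  · simpa only [Set.mem_ofPred_eq, ha, hb] using this
  · simp only [Set.mem_ofPred_eq] at hA
    rcases hf x y hxy with h | ⟨h, hx, hy⟩
    · rw [h] at hA; tauto
    · rw [hx, hy] at hA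
      exact hpq x y h hA

/-- A digraph in which every edge lies on a closed walk has a subgraph without antiparallel edges
in which any two linked vertices still reach each other. Of two antiparallel edges, one can be
left out, or both form a bridge and can be left out together. -/
theorem exists_twinless_subgraph [Finite V] (E : V → V → Prop) (hE : Cyclic E) :
    ∃ H : V → V → Prop, (∀ x y, H x y → E x y) ∧ Twinless H ∧
      ∀ a b, Linked E a b → Relation.ReflTransGen H a b := by
  induction hm : {p : V × V | E p.1 p.2}.ncard using Nat.strong_induction_on generalizing E with
  | _ m ih =>
  have step : ∀ E' : V → V → Prop, (∀ x y, E' x y → E x y) → (∃ x y, E x y ∧ ¬ E' x y) →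
      Cyclic E' → (∀ a b, Linked E a b → Linked E' a b) →
      ∃ H : V → V → Prop, (∀ x y, H x y → E x y) ∧ Twinless H ∧
        ∀ a b, Linked E a b → Relation.ReflTransGen H a b := by
    rintro E' hle ⟨x, y, hxy, hxy'⟩ hcyc hl
    have hlt : {p : V × V | E' p.1 p.2}.ncard < m := by
      rw [← hm]
      refine Set.ncard_lt_ncard ⟨fun p hp => hle _ _ hp, fun h => hxy' (h (a := (x, y)) hxy)⟩
        (Set.toFinite _)
    obtain ⟨H, h1, h2, h3⟩ := ih _ hlt E' hcyc rfl
    exact ⟨H, fun x y h => hle _ _ (h1 x y h), h2, fun a b h => h3 a b (hl a b h)⟩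
  by_cases htw : Twinless E
  · refine ⟨E, fun _ _ h => h, htw, fun a b hab => ?_⟩
    -- the vertices that `a` reaches are not joined to the others at all
    have hthin : IsThinCut E {x | Relation.ReflTransGen E a x} := by
      refine ⟨a, a, fun x y hxy hA => ?_⟩
      simp only [Set.mem_ofPred_eq] at hA
      by_cases hx : Relation.ReflTransGen E a x
      · exact absurd (hx.tail hxy) (hA.1 hx)
      · exact absurd ((not_not.1 (mt hA.2 hx)).trans (hE x y hxy)) hx
    exact (hab _ hthin).1 .refl
  · simp only [Twinless, not_forall, not_not] at htw
    obtain ⟨u, v, hne, huv, hvu⟩ := htw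
    by_cases h1 : Relation.ReflTransGen (fun x y => E x y ∧ ¬ (x = u ∧ y = v)) u v
    · exact step _ (fun _ _ h => h.1) ⟨u, v, huv, fun h => h.2 ⟨rfl, rfl⟩⟩ (hE.remove h1)
        fun a b h => h.remove hne hvu
    by_cases h2 : Relation.ReflTransGen (fun x y => E x y ∧ ¬ (x = v ∧ y = u)) v u
    · exact step _ (fun _ _ h => h.1) ⟨v, u, hvu, fun h => h.2 ⟨rfl, rfl⟩⟩ (hE.remove h2)
        fun a b h => h.remove hne.symm huv
    obtain ⟨A, uA, vA, hA⟩ := exists_bridge_cut hE huv hvu h1 h2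
    classical
    let f : V → V := fun t => if t ∈ A then t else u
    let g : V → V := fun t => if t ∈ A then v else t
    let E' : V → V → Prop := fun x y => E x y ∧ ¬ ((x = u ∧ y = v) ∨ (x = v ∧ y = u))
    have hE' : ∀ x y, E' x y → (x ∈ A ↔ y ∈ A) := by
      intro x y h
      by_contra hc
      exact h.2 (hA x y h.1 (by tauto))
    have hf : ∀ x y, E x y → f x = f y ∨ (E' x y ∧ f x = x ∧ f y = y) := by
      intro x y hxy
      by_cases hp : (x = u ∧ y = v) ∨ (x = v ∧ y = u)
      · left
        rcases hp with ⟨rfl, rfl⟩ | ⟨rfl, rfl⟩ <;> simp [f, vA]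
      · have h' : E' x y := ⟨hxy, hp⟩
        by_cases hx : x ∈ A
        · exact Or.inr ⟨h', by simp [f, hx], by simp [f, (hE' x y h').1 hx]⟩
        · exact Or.inl (by simp [f, hx, mt (hE' x y h').2 hx])
    have hg : ∀ x y, E x y → g x = g y ∨ (E' x y ∧ g x = x ∧ g y = y) := by
      intro x y hxy
      by_cases hp : (x = u ∧ y = v) ∨ (x = v ∧ y = u)
      · left
        rcases hp with ⟨rfl, rfl⟩ | ⟨rfl, rfl⟩ <;> simp [g, uA]
      · have h' : E' x y := ⟨hxy, hp⟩
        by_cases hx : x ∈ A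
        · exact Or.inl (by simp [g, hx, (hE' x y h').1 hx])
        · exact Or.inr ⟨h', by simp [g, hx], by simp [g, mt (hE' x y h').2 hx]⟩
    refine step E' (fun _ _ h => h.1) ⟨u, v, huv, fun h => h.2 (Or.inl ⟨rfl, rfl⟩)⟩ ?_ ?_
    · intro x y hxy
      by_cases hx : x ∈ A
      · exact reach_of_retraction f hf (hE x y hxy.1) (by simp [f, (hE' x y hxy).1 hx])
          (by simp [f, hx])
      · exact reach_of_retraction g hg (hE x y hxy.1) (by simp [g, mt (hE' x y hxy).2 hx])
          (by simp [g, hx])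
    · intro a b hab
      have hAab : a ∈ A ↔ b ∈ A := hab A ⟨u, v, hA⟩
      by_cases ha : a ∈ A
      · exact linked_of_retraction f hf hab (by simp [f, ha]) (by simp [f, hAab.1 ha])
      · exact linked_of_retraction g hg hab (by simp [g, ha]) (by simp [g, mt hAab.2 ha])

/-- The twinless strongly connected components are the classes of vertices that no cut with at most one
edge separates, where only edges inside of strongly connected components count. -/
theorem twinlessRelated_iff_linked [Finite V] {E : V → V → Prop} {a b : V} :
    TwinlessRelated E a b ↔ Linked (core E) a b := by
  refine ⟨TwinlessRelated.linked, fun h => ?_⟩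
  obtain ⟨H, h1, h2, h3⟩ := exists_twinless_subgraph (core E) (cyclic_core E)
  exact ⟨H, fun x y hxy => (h1 x y hxy).1, h2, h3 a b h, h3 b a h.symm⟩

end Cuts

/-! ### Twinless strongly connected components -/

section Components

variable {V : Type*}

theorem linked_of_mem {G : Digraph V} {C : Set V}
    (hC : IsTwinlessStronglyConnected (induced G C)) {a b : V} (ha : a ∈ C) (hb : b ∈ C) :
    Linked (core G.Adj) a b := by
  obtain ⟨-, H, hHG, hs, ht⟩ := hC
  apply TwinlessRelated.linked
  refine ⟨Relation.Map H.Adj Subtype.val Subtype.val, ?_, ?_, ?_, ?_⟩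
  · rintro _ _ ⟨x, y, hxy, rfl, rfl⟩
    exact hHG hxy
  · rintro _ _ huv ⟨⟨x, y, hxy, rfl, rfl⟩, ⟨y', x', hyx, e1, e2⟩⟩
    obtain rfl := Subtype.ext e1
    obtain rfl := Subtype.ext e2
    exact ht _ _ (fun e => huv (congrArg _ e)) ⟨hxy, hyx⟩
  · exact (hs ⟨a, ha⟩ ⟨b, hb⟩).lift Subtype.val fun x y h => ⟨x, y, h, rfl, rfl⟩
  · exact (hs ⟨b, hb⟩ ⟨a, ha⟩).lift Subtype.val fun x y h => ⟨x, y, h, rfl, rfl⟩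

theorem IsTSCC.nonempty {G : Digraph V} {C : Set V} (hC : IsTSCC G C) : C.Nonempty :=
  Set.nonempty_coe_sort.1 hC.1.1

variable [Finite V]

theorem isTwinlessStronglyConnected_linked (G : Digraph V) (a : V) :
    IsTwinlessStronglyConnected (induced G {x | Linked (core G.Adj) a x}) := by
  obtain ⟨H, h1, h2, h3⟩ := exists_twinless_subgraph (core G.Adj) (cyclic_core G.Adj)
  refine ⟨⟨a, .refl _ a⟩, ⟨fun x y => H x y⟩, fun x y h => (h1 _ _ h).1, ?_,
    fun u v huv => h2 u v (fun e => huv (Subtype.ext e))⟩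
  rintro ⟨x, hx⟩ ⟨y, hy⟩
  have hyx : Relation.ReflTransGen H y x := h3 _ _ (hy.symm.trans hx)
  -- a walk of `H` between linked vertices does not leave their class
  have : ∀ c, Relation.ReflTransGen H x c → ∀ hc : Linked (core G.Adj) a c,
      Relation.ReflTransGen (fun u v : {x | Linked (core G.Adj) a x} => H u v) ⟨x, hx⟩ ⟨c, hc⟩ := by
    intro c hxc
    induction hxc with
    | refl => exact fun _ => .refl
    | @tail c d hxc hcd ih =>
      intro hd
      have hc : Linked (core G.Adj) a c := by
        refine hx.trans (TwinlessRelated.linked ⟨H, fun x y h => (h1 x y h).1, h2, hxc, ?_⟩)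
        exact .head hcd (h3 _ _ (hd.symm.trans hx))
      exact (ih hc).tail hcd
  exact this y (h3 _ _ (hx.symm.trans hy)) hy

theorem IsTSCC.eq_linked {G : Digraph V} {C : Set V} (hC : IsTSCC G C) {a : V} (ha : a ∈ C) :
    C = {x | Linked (core G.Adj) a x} :=
  hC.eq_of_subset (isTwinlessStronglyConnected_linked G a) fun _ hx => linked_of_mem hC.1 ha hx

theorem isTSCC_linked (G : Digraph V) (a : V) : IsTSCC G {x | Linked (core G.Adj) a x} :=
  ⟨isTwinlessStronglyConnected_linked G a,
    fun _ hU hle _ hx => linked_of_mem hU (hle (.refl _ a)) hx⟩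

theorem sameTSCC_iff {G : Digraph V} {a b : V} : SameTSCC G a b ↔ Linked (core G.Adj) a b :=
  ⟨fun ⟨_, hC, ha, hb⟩ => linked_of_mem hC.1 ha hb,
    fun h => ⟨_, isTSCC_linked G a, .refl _ a, h⟩⟩

/-- In a twinless strongly connected graph, the twinless articulation points are the vertices whose
deletion separates two others. -/
theorem isTwinlessArticulationPoint_iff {G : Digraph V} (hG : IsTwinlessStronglyConnected G)
    (z : V) : IsTwinlessArticulationPoint G z ↔
      ∃ (a b : V) (ha : a ≠ z) (hb : b ≠ z), ¬ SameTSCC (deleteVertex G z) ⟨a, ha⟩ ⟨b, hb⟩ := by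
  have huniv : IsTwinlessStronglyConnected (induced G Set.univ) := by
    obtain ⟨⟨a⟩, H, h1, h2, h3⟩ := hG
    refine ⟨⟨a, trivial⟩, ⟨fun x y => H.Adj x y⟩, fun x y h => h1 h, fun x y => ?_,
      fun u v huv => h3 u v (fun e => huv (Subtype.ext e))⟩
    exact (h2 x y).lift (fun t => (⟨t, trivial⟩ : (Set.univ : Set V))) fun _ _ h => h
  have hone : {C : Set V | IsTSCC G C} = {Set.univ} := by
    ext C
    constructor
    · intro hC
      exact IsTSCC.eq_linked hC hC.nonempty.some_mem ▸
        Set.eq_univ_of_forall fun x => linked_of_mem huniv trivial trivial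
    · rintro rfl
      exact ⟨huniv, fun _ _ _ => Set.subset_univ _⟩
  rw [IsTwinlessArticulationPoint, hone, Set.ncard_singleton, Set.one_lt_ncard]
  constructor
  · rintro ⟨C, hC, C', hC', hne⟩
    refine ⟨hC.nonempty.some, hC'.nonempty.some, hC.nonempty.some.2, hC'.nonempty.some.2,
      fun h => hne ?_⟩
    obtain ⟨D, hD, h1, h2⟩ := h
    rw [hC.eq_linked hC.nonempty.some_mem, hC'.eq_linked hC'.nonempty.some_mem]
    rw [← hD.eq_linked h1, ← hD.eq_linked h2]
  · rintro ⟨a, b, ha, hb, h⟩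
    refine ⟨_, isTSCC_linked _ ⟨a, ha⟩, _, isTSCC_linked _ ⟨b, hb⟩, fun e => h ?_⟩
    rw [sameTSCC_iff]
    have : (⟨b, hb⟩ : ({z}ᶜ : Set V)) ∈ {x | Linked (core (deleteVertex G z).Adj) ⟨b, hb⟩ x} :=
      .refl _ _
    rwa [← e] at this

/-- The components of `G \ {z}`, described without passing to a subtype. -/
theorem sameTSCC_deleteVertex_iff {G : Digraph V} {z a b : V} (ha : a ≠ z) (hb : b ≠ z) :
    SameTSCC (deleteVertex G z) ⟨a, ha⟩ ⟨b, hb⟩ ↔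
      Linked (core fun x y => G.Adj x y ∧ x ≠ z ∧ y ≠ z) a b := by
  rw [sameTSCC_iff, ← twinlessRelated_iff_linked, ← twinlessRelated_iff_linked]
  constructor
  · rintro ⟨H, h1, h2, hab, hba⟩
    refine ⟨Relation.Map H Subtype.val Subtype.val, ?_, ?_, ?_, ?_⟩
    · rintro _ _ ⟨x, y, hxy, rfl, rfl⟩
      exact ⟨h1 _ _ hxy, x.2, y.2⟩
    · rintro _ _ huv ⟨⟨x, y, hxy, rfl, rfl⟩, ⟨y', x', hyx, e1, e2⟩⟩
      obtain rfl := Subtype.ext e1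
      obtain rfl := Subtype.ext e2
      exact h2 _ _ (fun e => huv (congrArg _ e)) ⟨hxy, hyx⟩
    · exact hab.lift Subtype.val fun x y h => ⟨x, y, h, rfl, rfl⟩
    · exact hba.lift Subtype.val fun x y h => ⟨x, y, h, rfl, rfl⟩
  · rintro ⟨H, h1, h2, hab, hba⟩
    have lift : ∀ c d (hc : c ≠ z) (hd : d ≠ z), Relation.ReflTransGen H c d →
        Relation.ReflTransGen (fun u v : ({z}ᶜ : Set V) => H u v) ⟨c, hc⟩ ⟨d, hd⟩ := by
      intro c d hc hd h
      induction h with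
      | refl => exact .refl
      | tail _ hxy ih => exact (ih (h1 _ _ hxy).2.1).tail hxy
    exact ⟨fun u v => H u v, fun x y h => (h1 _ _ h).1,
      fun u v huv => h2 u v (fun e => huv (Subtype.ext e)), lift _ _ _ _ hab, lift _ _ _ _ hba⟩

end Components

/-! ### Blocks of undirected graphs -/

section Blocks

variable {V : Type*}

/-- The edges of `H` that avoid the vertex `w`. -/
def avoid (H : SimpleGraph V) (w x y : V) : Prop :=
  H.Adj x y ∧ x ≠ w ∧ y ≠ w

/-- `x` and `y` are connected in `H`, and also after the deletion of any other vertex. -/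
def Inseparable (H : SimpleGraph V) (x y : V) : Prop :=
  H.Reachable x y ∧ ∀ w, x ≠ w → y ≠ w → Relation.ReflTransGen (avoid H w) x y

/-- The sets with at least two elements in which any two elements are related by `R`. -/
def IsNontrivialClique (R : V → V → Prop) (U : Set V) : Prop :=
  U.Nontrivial ∧ ∀ x ∈ U, ∀ y ∈ U, x ≠ y → R x y

variable {H : SimpleGraph V}

theorem reach_symm {E : V → V → Prop} (hE : ∀ x y, E x y → E y x) {x y : V}
    (h : Relation.ReflTransGen E x y) : Relation.ReflTransGen E y x := by
  induction h with
  | refl => exact .refl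
  | tail _ hcd ih => exact .head (hE _ _ hcd) ih

theorem reach_avoid_symm {w x y : V} (h : Relation.ReflTransGen (avoid H w) x y) :
    Relation.ReflTransGen (avoid H w) y x :=
  reach_symm (fun _ _ h => ⟨h.1.symm, h.2.2, h.2.1⟩) h

theorem Inseparable.refl (x : V) : Inseparable H x x := ⟨.rfl, fun _ _ _ => .refl⟩

theorem Inseparable.symm {x y : V} (h : Inseparable H x y) : Inseparable H y x :=
  ⟨h.1.symm, fun w hx hy => reach_avoid_symm (h.2 w hy hx)⟩

/-- Two vertices are inseparable if two distinct vertices are inseparable from both. -/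
theorem Inseparable.of_common {x y a b : V} (hxy : x ≠ y) (hax : Inseparable H a x)
    (hay : Inseparable H a y) (hbx : Inseparable H b x) (hby : Inseparable H b y) :
    Inseparable H a b := by
  refine ⟨hax.1.trans hbx.1.symm, fun w ha hb => ?_⟩
  by_cases hx : x = w
  · have hy : y ≠ w := fun h => hxy (hx.trans h.symm)
    exact (hay.2 w ha hy).trans (hby.symm.2 w hy hb)
  · exact (hax.2 w ha hx).trans (hbx.symm.2 w hx hb)

theorem IsNontrivialClique.inseparable {U : Set V} (hU : IsNontrivialClique (Inseparable H) U)
    {a b : V} (ha : a ∈ U) (hb : b ∈ U) : Inseparable H a b := by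
  by_cases h : a = b
  · exact h ▸ .refl _
  · exact hU.2 a ha b hb h

theorem maximal_common {x y : V} (hxy : x ≠ y) (h : Inseparable H x y) :
    Maximal (IsNontrivialClique (Inseparable H)) {u | Inseparable H u x ∧ Inseparable H u y} := by
  refine ⟨⟨⟨x, ⟨.refl x, h⟩, y, ⟨h.symm, .refl y⟩, hxy⟩,
    fun a ha b hb _ => .of_common hxy ha.1 ha.2 hb.1 hb.2⟩, fun W hW hle a ha => ?_⟩
  exact ⟨hW.inseparable ha (hle ⟨.refl x, h⟩), hW.inseparable ha (hle ⟨h.symm, .refl y⟩)⟩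

/-- A maximal clique of the inseparability relation is determined by two of its elements. -/
theorem eq_common_of_maximal {B : Set V} (hB : Maximal (IsNontrivialClique (Inseparable H)) B)
    {x y : V} (hx : x ∈ B) (hy : y ∈ B) (hxy : x ≠ y) :
    B = {u | Inseparable H u x ∧ Inseparable H u y} :=
  hB.eq_of_subset (maximal_common hxy (hB.1.inseparable hx hy)).1
    fun _ ha => ⟨hB.1.inseparable ha hx, hB.1.inseparable ha hy⟩

theorem reach_avoid_of_walk {c a b : V} (p : H.Walk a b) (hc : c ∉ p.support) :
    Relation.ReflTransGen (avoid H c) a b := by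
  induction p with
  | nil => exact .refl
  | @cons a d b h p ih =>
    rw [SimpleGraph.Walk.support_cons, List.mem_cons, not_or] at hc
    exact .head ⟨h, Ne.symm hc.1, fun e => hc.2 (e ▸ p.start_mem_support)⟩ (ih hc.2)

theorem exists_walk_of_reach_avoid {c a b : V} (h : Relation.ReflTransGen (avoid H c) a b)
    (ha : a ≠ c) : ∃ p : H.Walk a b, c ∉ p.support := by
  induction h with
  | refl => exact ⟨.nil, by simpa using ha.symm⟩
  | tail _ hxy ih =>
    obtain ⟨p, hp⟩ := ih
    refine ⟨p.concat hxy.1, ?_⟩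
    rw [SimpleGraph.Walk.support_concat]
    simpa [hp] using hxy.2.2.symm

/-- Any two vertices of a connected subgraph without a cut vertex are inseparable. -/
theorem inseparable_of_mem {U : Set V} (hU : (H.induce U).Connected)
    (hU' : ∀ v ∈ U, (H.induce (U \ {v})).Preconnected) {x y : V} (hx : x ∈ U) (hy : y ∈ U) :
    Inseparable H x y := by
  refine ⟨(hU.1 ⟨x, hx⟩ ⟨y, hy⟩).map (SimpleGraph.Embedding.induce U).toHom, fun w hxw hyw => ?_⟩
  have hpre : (H.induce (U \ {w})).Preconnected := by
    by_cases hw : w ∈ U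
    · exact hU' w hw
    · rw [Set.sdiff_singleton_eq_self hw]
      exact hU.1
  have := (SimpleGraph.reachable_iff_reflTransGen _ _).1 (hpre ⟨x, hx, hxw⟩ ⟨y, hy, hyw⟩)
  exact this.lift Subtype.val fun a b h => ⟨h, a.2.2, b.2.2⟩

/-- A path between two vertices of a maximal clique `B` of the inseparability relation stays in `B`:
a vertex `q` of the path outside of `B` would be separated from `B` by a single vertex, but the
path leads from `q` to `B` in two ways that share only `q`. -/
theorem support_subset_of_maximal {B : Set V} (hB : Maximal (IsNontrivialClique (Inseparable H)) B)
    {u x : V} (hu : u ∈ B) (hx : x ∈ B) (p : H.Walk u x) (hp : p.IsPath) :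
    ∀ q ∈ p.support, q ∈ B := by
  classical
  intro q hq
  by_contra hqB
  have hex : ∃ b ∈ B, ¬ Inseparable H q b := by
    by_contra! hall
    refine hqB (hB.2 (y := insert q B) ⟨hB.1.1.mono (Set.subset_insert _ _), ?_⟩
      (Set.subset_insert _ _) (Set.mem_insert _ _))
    rintro a (rfl | ha) b (rfl | hb) hab
    · exact absurd rfl hab
    · exact hall b hb
    · exact (hall a ha).symm
    · exact hB.1.2 a ha b hb hab
  obtain ⟨b, hb, hqb⟩ := hex
  have hBB : ∀ b' ∈ B, Inseparable H b' b := fun b' hb' => hB.1.inseparable hb' hb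
  have hreach : H.Reachable q b := (p.dropUntil q hq).reachable.trans (hBB x hx).1
  have hsep : ∃ c, q ≠ c ∧ b ≠ c ∧ ¬ Relation.ReflTransGen (avoid H c) q b := by
    by_contra! hall
    exact hqb ⟨hreach, hall⟩
  obtain ⟨c, hqc, hbc, hc⟩ := hsep
  have hno : ∀ b' ∈ B, b' ≠ c → ¬ Relation.ReflTransGen (avoid H c) q b' := fun b' hb' hne h =>
    hc (h.trans ((hBB b' hb').2 c hne hbc))
  by_cases h1 : c ∈ (p.takeUntil q hq).support
  · have h2 : c ∉ (p.dropUntil q hq).support := by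
      intro h2
      have hnd := hp.support_nodup
      rw [← p.take_spec hq, SimpleGraph.Walk.support_append, List.nodup_append] at hnd
      rw [← SimpleGraph.Walk.cons_tail_support, List.mem_cons] at h2
      rcases h2 with h2 | h2
      · exact hqc h2.symm
      · exact hnd.2.2 c h1 c h2 rfl
    exact hno x hx (fun e => h2 (e ▸ SimpleGraph.Walk.end_mem_support _))
      (reach_avoid_of_walk _ h2)
  · exact hno u hu (fun e => h1 (e ▸ SimpleGraph.Walk.start_mem_support _))
      (reach_avoid_symm (reach_avoid_of_walk _ h1))

/-- The blocks with at least two vertices are the maximal cliques of the inseparability relation. -/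
theorem isBlock_and_nontrivial_iff {B : Set V} :
    IsBlock H B ∧ B.Nontrivial ↔ Maximal (IsNontrivialClique (Inseparable H)) B := by
  have hblock : ∀ {B : Set V}, Maximal (IsNontrivialClique (Inseparable H)) B →
      (H.induce B).Connected ∧ ∀ v ∈ B, (H.induce (B \ {v})).Preconnected := by
    classical
    intro B hB
    refine ⟨?_, fun w _ => ?_⟩
    · refine @SimpleGraph.Connected.mk _ _ ?_ hB.1.1.nonempty.to_subtype
      rintro ⟨x, hx⟩ ⟨y, hy⟩
      obtain ⟨p⟩ := (hB.1.inseparable hx hy).1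
      exact (p.bypass.induce B
        (support_subset_of_maximal hB hx hy _ p.bypass_isPath)).reachable
    · rintro ⟨x, hx, hxw⟩ ⟨y, hy, hyw⟩
      obtain ⟨p, hp⟩ := exists_walk_of_reach_avoid ((hB.1.inseparable hx hy).2 w hxw hyw) hxw
      refine (p.bypass.induce (B \ {w}) fun q hq => ⟨?_, ?_⟩).reachable
      · exact support_subset_of_maximal hB hx hy _ p.bypass_isPath q hq
      · rintro rfl
        exact hp (p.support_bypass_subset_support hq)
  constructor
  · rintro ⟨hB, hnt⟩
    refine ⟨⟨hnt, fun x hx y hy _ => inseparable_of_mem hB.1.1 hB.1.2 hx hy⟩, fun U hU hle => ?_⟩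
    -- every nontrivial clique lies in a maximal one
    obtain ⟨x, hx, y, hy, hxy⟩ := hnt
    have hM := maximal_common hxy (hU.inseparable (hle hx) (hle hy))
    intro a ha
    exact hB.2 (hblock hM)
      (fun a ha => ⟨inseparable_of_mem hB.1.1 hB.1.2 ha hx, inseparable_of_mem hB.1.1 hB.1.2 ha hy⟩)
      ⟨hU.inseparable ha (hle hx), hU.inseparable ha (hle hy)⟩
  · intro hB
    refine ⟨⟨hblock hB, fun U hU hle => ?_⟩, hB.1.1⟩
    exact hB.2 ⟨hB.1.1.mono hle, fun x hx y hy _ => inseparable_of_mem hU.1 hU.2 hx hy⟩ hle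

/-- If adjacency in `H` means to be related by each of a family of equivalence relations `E w`, with
the exception of those where `w` is one of the two vertices, then distinct inseparable vertices are
adjacent. -/
theorem inseparable_iff_of_adj {E : V → V → V → Prop} (hE : ∀ w, Equivalence (E w))
    (hH : ∀ x y, H.Adj x y ↔ x ≠ y ∧ ∀ w, x ≠ w → y ≠ w → E w x y) {x y : V} (hxy : x ≠ y) :
    Inseparable H x y ↔ ∀ w, x ≠ w → y ≠ w → E w x y := by
  constructor
  · intro h w hx hy
    have hr := h.2 w hx hy
    clear hy hxy h
    induction hr with
    | refl => exact (hE w).refl _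
    | tail _ hcd ih => exact (hE w).trans ih (((hH _ _).1 hcd.1).2 w hcd.2.1 hcd.2.2)
  · intro h
    have hadj : H.Adj x y := (hH x y).2 ⟨hxy, h⟩
    exact ⟨hadj.reachable, fun w hx hy => .single ⟨hadj, hx, hy⟩⟩

end Blocks

/-! ### Loop programs -/

section Programs

/-- Programs without unbounded loops: the only loops run over all vertices. -/
inductive LoopProgram where
  | skip
  | set (x : Reg) (i j e : Expr)
  | seq (c d : LoopProgram)
  | ite (b : Expr) (c d : LoopProgram)
  | loop (x : Reg) (c : LoopProgram)

namespace LoopProgram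

/-- The program as a while-program. -/
def toCmd : LoopProgram → Cmd
  | skip => .skip
  | set x i j e => .set x i j e
  | seq c d => .seq c.toCmd d.toCmd
  | ite b c d => .ite b c.toCmd d.toCmd
  | loop x c => forEach x c.toCmd

/-- The state of the loop `for x do f` before round `m`. -/
noncomputable def iterate (x : Reg) (f : Store → Store) (σ : Store) : ℕ → Store
  | 0 => σ.write x 0 0 0
  | m + 1 => (f (iterate x f σ m)).write x 0 0 (m + 1)

/-- The effect of the program on the memory. -/
noncomputable def sem : LoopProgram → Store → Store
  | skip, σ => σ
  | set x i j e, σ => σ.write x (i.eval σ) (j.eval σ) (e.eval σ)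
  | seq c d, σ => d.sem (c.sem σ)
  | ite b c d, σ => if b.eval σ ≠ 0 then c.sem σ else d.sem σ
  | loop x c, σ => iterate x c.sem σ (σ .size 0 0)

/-- The program contains an assignment to the register `y`. -/
def Writes (y : Reg) : LoopProgram → Prop
  | skip => False
  | set x _ _ _ => y = x
  | seq c d => c.Writes y ∨ d.Writes y
  | ite _ c d => c.Writes y ∨ d.Writes y
  | loop x c => y = x ∨ c.Writes y

/-- Loop variables are not modified by the bodies of their loops, and the number of vertices is not
modified at all. -/
def WellFormed : LoopProgram → Prop
  | skip => True
  | set x _ _ _ => x ≠ .size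
  | seq c d => c.WellFormed ∧ d.WellFormed
  | ite _ c d => c.WellFormed ∧ d.WellFormed
  | loop x c => x ≠ .size ∧ ¬ c.Writes x ∧ c.WellFormed

/-- Nesting depth of the loops. -/
def depth : LoopProgram → ℕ
  | skip => 0
  | set _ _ _ _ => 0
  | seq c d => max c.depth d.depth
  | ite _ c d => max c.depth d.depth
  | loop _ c => c.depth + 1

/-- A constant factor for the running time. In `loop`, it accounts for the initialization (4 steps),
the last test (8 steps), and the test and the increment in each round (15 steps). -/
def coeff : LoopProgram → ℕ
  | skip => 1
  | set _ i j e => i.cost + j.cost + e.cost + 1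
  | seq c d => c.coeff + d.coeff
  | ite b c d => b.cost + 1 + c.coeff + d.coeff
  | loop _ c => c.coeff + 27

end LoopProgram

open Classical in
theorem Store.write_apply (σ : Store) (x y : Reg) (i j a k l : ℕ) :
    σ.write x i j a y k l = if y = x ∧ k = i ∧ l = j then a else σ y k l := by
  unfold Store.write
  congr

theorem Store.write_of_ne (σ : Store) {x y : Reg} (h : y ≠ x) (i j a : ℕ) :
    σ.write x i j a y = σ y := by
  funext k l
  rw [Store.write_apply, if_neg fun h' => h h'.1]

namespace LoopProgram

theorem iterate_of_not_writes {x y : Reg} {c : LoopProgram}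
    (hc : ∀ σ, c.sem σ y = σ y) (hx : y ≠ x) (σ : Store) (m : ℕ) :
    iterate x c.sem σ m y = σ y := by
  induction m with
  | zero => exact Store.write_of_ne _ hx _ _ _
  | succ m ih => rw [iterate, Store.write_of_ne _ hx, hc, ih]

theorem sem_of_not_writes {y : Reg} {c : LoopProgram} (h : ¬ c.Writes y) (σ : Store) :
    c.sem σ y = σ y := by
  induction c generalizing σ with
  | skip => rfl
  | set x i j e => exact Store.write_of_ne _ h _ _ _
  | seq c d ihc ihd =>
    rw [Writes, not_or] at h
    rw [sem, ihd h.2, ihc h.1]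
  | ite b c d ihc ihd =>
    rw [Writes, not_or] at h
    rw [sem]
    split_ifs
    exacts [ihc h.1 σ, ihd h.2 σ]
  | loop x c ih =>
    rw [Writes, not_or] at h
    exact iterate_of_not_writes (ih h.2) h.1 σ _

theorem WellFormed.not_writes_size {c : LoopProgram} (h : c.WellFormed) : ¬ c.Writes .size := by
  induction c with
  | skip => exact id
  | set x i j e => exact Ne.symm h
  | seq c d ihc ihd => exact not_or.2 ⟨ihc h.1, ihd h.2⟩
  | ite b c d ihc ihd => exact not_or.2 ⟨ihc h.1, ihd h.2⟩
  | loop x c ih => exact not_or.2 ⟨h.1.symm, ih h.2.2⟩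

theorem iterate_var (x : Reg) (f : Store → Store) (σ : Store) (m : ℕ) :
    iterate x f σ m x 0 0 = m := by
  cases m <;> simp [iterate, Store.write_apply]

end LoopProgram

@[simp] theorem eval_lit (σ : Store) (k : ℕ) : (Expr.lit k).eval σ = k := rfl

@[simp] theorem eval_get (σ : Store) (x : Reg) (i j : Expr) :
    (Expr.get x i j).eval σ = σ x (i.eval σ) (j.eval σ) := rfl

@[simp] theorem eval_scalar (σ : Store) (x : Reg) : (scalar x).eval σ = σ x 0 0 := rfl

@[simp] theorem eval_succ (σ : Store) (e : Expr) : e.succ.eval σ = e.eval σ + 1 := rfl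

@[simp] theorem eval_pred (σ : Store) (e : Expr) : e.pred.eval σ = e.eval σ - 1 := rfl

@[simp] theorem eval_eq_eq_zero (σ : Store) (e f : Expr) :
    (e.eq f).eval σ = 0 ↔ e.eval σ ≠ f.eval σ := by
  simp [Expr.eval]

@[simp] theorem eval_lt_eq_zero (σ : Store) (e f : Expr) :
    (e.lt f).eval σ = 0 ↔ f.eval σ ≤ e.eval σ := by
  simp [Expr.eval]

@[simp] theorem eval_and_eq_zero (σ : Store) (e f : Expr) :
    (e.and f).eval σ = 0 ↔ (e.eval σ = 0 ∨ f.eval σ = 0) := by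
  simp [Expr.eval]
  tauto

@[simp] theorem eval_not_eq_zero (σ : Store) (e : Expr) :
    e.not.eval σ = 0 ↔ e.eval σ ≠ 0 := by
  simp [Expr.eval]

open LoopProgram

/-- The rule for loops whose body is an arbitrary program with a bounded running time. -/
theorem exec_forEach {x : Reg} {c : Cmd} {n T : ℕ} (P : ℕ → Store → Prop)
    (hsize : ∀ m ρ, P m ρ → ρ .size 0 0 = n)
    (hstep : ∀ m ρ, m < n → P m ρ → ρ x 0 0 = m → ∃ t τ, Exec c ρ t τ ∧ t ≤ T ∧
      τ x 0 0 = m ∧ P (m + 1) (τ.write x 0 0 (m + 1))) {σ : Store} (h0 : P 0 (σ.write x 0 0 0)) :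
    ∃ t τ, Exec (forEach x c) σ t τ ∧ t ≤ n * (T + 15) + 12 ∧ P n τ := by
  have key : ∀ k m ρ, m + k = n → P m ρ → ρ x 0 0 = m → ∃ t τ,
      Exec (.while (.lt (scalar x) (scalar .size))
        (.seq c (assign x (.succ (scalar x))))) ρ t τ ∧ t ≤ k * (T + 15) + 8 ∧ P n τ := by
    intro k
    induction k with
    | zero =>
      intro m ρ hm hP hxm
      obtain rfl : m = n := hm
      refine ⟨_, ρ, .while_false ?_, ?_, hP⟩
      · simp [Expr.eval, scalar, hxm, hsize m ρ hP]
      · simp [Expr.cost, scalar]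
    | succ k ih =>
      intro m ρ hm hP hxm
      obtain ⟨t, τ, he, ht, hτ, hP'⟩ := hstep m ρ (by omega) hP hxm
      obtain ⟨t', τ', he', ht', hP''⟩ := ih (m + 1) (τ.write x 0 0 (m + 1)) (by omega) hP'
        (by simp [Store.write_apply])
      have hs : Exec (assign x (.succ (scalar x))) τ 7 (τ.write x 0 0 (m + 1)) := by
        have := Exec.set τ x (.lit 0) (.lit 0) (.succ (scalar x))
        simpa [assign, Expr.eval, scalar, Expr.cost, hτ] using this
      refine ⟨_, τ', .while_true ?_ (.seq he hs) he', ?_, hP''⟩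
      · simp [Expr.eval, scalar, hxm, hsize m ρ hP]
        omega
      · simp only [Expr.cost, scalar]
        have : (k + 1) * (T + 15) = k * (T + 15) + (T + 15) := by ring
        omega
  obtain ⟨t, τ, he, ht, hP⟩ := key n 0 _ (by omega) h0 (by simp [Store.write_apply])
  refine ⟨_, τ, .seq (.set σ x (.lit 0) (.lit 0) (.lit 0)) he, ?_, hP⟩
  simp only [Expr.cost]
  omega

namespace LoopProgram

/-- A loop program computes its effect in time `O(n ^ d)`, where `d` is the nesting depth. -/
theorem exec_toCmd {c : LoopProgram} (hc : c.WellFormed) {d : ℕ} (hd : c.depth ≤ d) (σ : Store)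
    (hn : 0 < σ .size 0 0) :
    ∃ t, Exec c.toCmd σ t (c.sem σ) ∧ t ≤ c.coeff * σ .size 0 0 ^ d := by
  induction c generalizing σ d with
  | skip =>
    exact ⟨1, .skip σ, by simpa [coeff] using Nat.one_le_pow _ _ hn⟩
  | set x i j e =>
    exact ⟨_, .set σ x i j e, Nat.le_mul_of_pos_right _ (Nat.pow_pos hn)⟩
  | seq c c' ih ih' =>
    simp only [depth, max_le_iff] at hd
    have hs : c.sem σ .size = σ .size := sem_of_not_writes hc.1.not_writes_size σ
    obtain ⟨t, he, ht⟩ := ih hc.1 hd.1 σ hn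
    obtain ⟨t', he', ht'⟩ := ih' hc.2 hd.2 (c.sem σ) (hs ▸ hn)
    rw [hs] at ht'
    exact ⟨_, .seq he he', by simp only [coeff]; rw [add_mul]; omega⟩
  | ite b c c' ih ih' =>
    simp only [depth, max_le_iff] at hd
    have h1 := Nat.one_le_pow d _ hn
    have h2 : (b.cost + 1) ≤ (b.cost + 1) * σ .size 0 0 ^ d :=
      Nat.le_mul_of_pos_right _ h1
    by_cases hb : b.eval σ = 0
    · obtain ⟨t, he, ht⟩ := ih' hc.2 hd.2 σ hn
      refine ⟨_, .ite_false hb (by simpa [sem, hb] using he), ?_⟩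
      simp only [coeff, add_mul] at h2 ⊢
      omega
    · obtain ⟨t, he, ht⟩ := ih hc.1 hd.1 σ hn
      refine ⟨_, .ite_true hb (by simpa [sem, hb] using he), ?_⟩
      simp only [coeff, add_mul] at h2 ⊢
      omega
  | loop x c ih =>
    obtain ⟨d, rfl⟩ : ∃ d', d = d' + 1 := ⟨d - 1, by simp only [depth] at hd; omega⟩
    have hsz : ∀ m, iterate x c.sem σ m .size = σ .size := fun m =>
      iterate_of_not_writes (sem_of_not_writes hc.2.2.not_writes_size) hc.1.symm σ m
    obtain ⟨t, τ, he, ht, hτ⟩ := exec_forEach (x := x) (c := c.toCmd) (n := σ .size 0 0)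
      (T := c.coeff * σ .size 0 0 ^ d) (fun m ρ => ρ = iterate x c.sem σ m)
      (by rintro m _ rfl; rw [hsz])
      (by
        rintro m _ - rfl hxm
        obtain ⟨t, he, ht⟩ := ih hc.2.2 (by simpa [depth] using hd) (iterate x c.sem σ m)
          (by rw [hsz]; exact hn)
        rw [hsz] at ht
        exact ⟨t, _, he, ht, by rw [sem_of_not_writes hc.2.1, hxm], rfl⟩)
      (σ := σ) rfl
    subst hτ
    refine ⟨t, he, ht.trans ?_⟩
    have h1 := Nat.one_le_pow d _ hn
    simp only [coeff]
    generalize σ .size 0 0 = n at *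
    have e1 : n ≤ n ^ (d + 1) := by rw [pow_succ]; exact Nat.le_mul_of_pos_left _ h1
    have e2 : n * (c.coeff * n ^ d + 15) = c.coeff * n ^ (d + 1) + 15 * n := by ring
    rw [e2, add_mul]
    omega

/-! ### Loops with simple effects -/

/-- Induction over the rounds of a loop. -/
theorem sem_loop_induction {x : Reg} {c : LoopProgram} {σ : Store} {n : ℕ} (hn : σ .size 0 0 = n)
    (P : ℕ → Store → Prop) (h0 : P 0 (σ.write x 0 0 0))
    (hstep : ∀ m ρ, m < n → P m ρ → ρ x 0 0 = m →
      (∀ y, y ≠ x → ¬ c.Writes y → ρ y = σ y) → P (m + 1) ((c.sem ρ).write x 0 0 (m + 1))) :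
    P n ((loop x c).sem σ) := by
  have : ∀ m, m ≤ n → P m (iterate x c.sem σ m) := by
    intro m
    induction m with
    | zero => exact fun _ => h0
    | succ m ih =>
      intro hm
      exact hstep m _ hm (ih (by omega)) (iterate_var _ _ _ _)
        fun y hy hc => iterate_of_not_writes (sem_of_not_writes hc) hy σ m
  rw [sem, hn]
  exact this n le_rfl

@[simp] theorem sem_skip (σ : Store) : skip.sem σ = σ := rfl

@[simp] theorem sem_set (x : Reg) (i j e : Expr) (σ : Store) :
    (set x i j e).sem σ = σ.write x (i.eval σ) (j.eval σ) (e.eval σ) := rfl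

@[simp] theorem sem_seq (c d : LoopProgram) (σ : Store) : (seq c d).sem σ = d.sem (c.sem σ) := rfl

@[simp] theorem sem_ite (b : Expr) (c d : LoopProgram) (σ : Store) :
    (ite b c d).sem σ = if b.eval σ ≠ 0 then c.sem σ else d.sem σ := rfl

/-- A loop in which round `a` writes the value `v a` into the entry `(r a, q a)` of the register `x` if
`p a` holds, and changes nothing else. -/
theorem sem_loop_cells {i x : Reg} (hix : x ≠ i) {c : LoopProgram} {σ : Store} {n : ℕ}
    (hn : σ .size 0 0 = n) (hc : ∀ y, c.Writes y → y = x)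
    (p : ℕ → Prop) (r q v : ℕ → ℕ) (hinj : ∀ a b, r a = r b → q a = q b → a = b)
    (h : ∀ ρ a, a < n → ρ i 0 0 = a → (∀ y, y ≠ i → y ≠ x → ρ y = σ y) →
      (∀ k l, (∀ a' < a, k = r a' → l ≠ q a') → ρ x k l = σ x k l) →
      (p a → c.sem ρ x = ρ.write x (r a) (q a) (v a) x) ∧ (¬ p a → c.sem ρ x = ρ x)) :
    (∀ a < n, p a → (loop i c).sem σ x (r a) (q a) = v a) ∧
      ∀ k l, (∀ a < n, p a → k = r a → l ≠ q a) → (loop i c).sem σ x k l = σ x k l := by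
  refine sem_loop_induction (x := i) (c := c) hn (fun m ρ =>
      (∀ a < m, p a → ρ x (r a) (q a) = v a) ∧
      ∀ k l, (∀ a < m, p a → k = r a → l ≠ q a) → ρ x k l = σ x k l)
    ⟨by simp, fun k l _ => by rw [Store.write_of_ne _ hix]⟩ ?_
  rintro m ρ hm ⟨h1, h2⟩ hi hρ
  rw [Store.write_of_ne _ hix]
  obtain ⟨hp, hp'⟩ := h ρ m hm hi (fun y hy hyx => hρ y hy fun hw => hyx (hc y hw))
    fun k l hkl => h2 k l fun a ha _ => hkl a ha
  by_cases hpm : p m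
  · rw [hp hpm]
    refine ⟨fun a ha hpa => ?_, fun k l hkl => ?_⟩
    · rw [Store.write_apply]
      split_ifs with hcell
      · rw [hinj a m hcell.2.1 hcell.2.2]
      · rcases Nat.lt_succ_iff_lt_or_eq.1 ha with h' | rfl
        exacts [h1 a h' hpa, absurd ⟨rfl, rfl, rfl⟩ hcell]
    · rw [Store.write_apply, if_neg fun hcell => hkl m (by omega) hpm hcell.2.1 hcell.2.2]
      exact h2 k l fun a ha => hkl a (by omega)
  · rw [hp' hpm]
    refine ⟨fun a ha hpa => ?_, fun k l hkl => h2 k l fun a ha => hkl a (by omega)⟩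
    rcases Nat.lt_succ_iff_lt_or_eq.1 ha with h' | rfl
    exacts [h1 a h' hpa, absurd hpa hpm]

/-- Two nested loops in which the round for `(a, b)` writes the value `v a b` into the entry `(a, b)` of
the register `x` if `p a b` holds, and changes nothing else. -/
theorem sem_loop_loop_cells {i j x : Reg} (hi : x ≠ i) (hj : x ≠ j) (hij : i ≠ j)
    (his : i ≠ .size) (hjs : j ≠ .size) (hxs : x ≠ .size) {c : LoopProgram}
    {σ : Store} {n : ℕ} (hn : σ .size 0 0 = n) (hc : ∀ y, c.Writes y → y = x)
    (p : ℕ → ℕ → Prop) (v : ℕ → ℕ → ℕ)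
    (h : ∀ ρ a b, a < n → b < n → ρ i 0 0 = a → ρ j 0 0 = b →
      (∀ y, y ≠ i → y ≠ j → y ≠ x → ρ y = σ y) →
      (p a b → c.sem ρ x = ρ.write x a b (v a b) x) ∧ (¬ p a b → c.sem ρ x = ρ x)) :
    (∀ a < n, ∀ b < n, p a b → (loop i (loop j c)).sem σ x a b = v a b) ∧
      ∀ k l, (k < n → l < n → ¬ p k l) → (loop i (loop j c)).sem σ x k l = σ x k l := by
  have hwr : ∀ y, (loop j c).Writes y → y = j ∨ y = x := fun y hy => hy.imp_right (hc y)
  refine sem_loop_induction (x := i) (c := loop j c) hn (fun m ρ =>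
      (∀ a < m, ∀ b < n, p a b → ρ x a b = v a b) ∧
      ∀ k l, (k < m → l < n → ¬ p k l) → ρ x k l = σ x k l)
    ⟨by simp, fun k l _ => by rw [Store.write_of_ne _ hi]⟩ ?_
  rintro m ρ hm ⟨h1, h2⟩ hi' hρ
  rw [Store.write_of_ne _ hi]
  have hρ' : ∀ y, y ≠ i → y ≠ j → y ≠ x → ρ y = σ y := fun y h1 h2 h3 =>
    hρ y h1 fun hw => (hwr y hw).elim h2 h3
  obtain ⟨g1, g2⟩ := sem_loop_cells hj (σ := ρ) (n := n)
    (by rw [hρ' _ his.symm hjs.symm hxs.symm, hn]) hc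
    (p m) (fun _ => m) (fun b => b) (v m) (fun a b _ h => h) (fun τ b hb hτ hτρ _ =>
      h τ m b hm hb (by rw [hτρ i hij hi.symm, hi']) hτ
        fun y h1 h2 h3 => by rw [hτρ y h2 h3, hρ' y h1 h2 h3])
  refine ⟨fun a ha b hb hp => ?_, fun k l hkl => ?_⟩
  · by_cases ham : a = m
    · subst ham
      exact g1 b hb hp
    · rw [g2 a b fun _ _ _ h => absurd h ham]
      exact h1 a (by omega) b hb hp
  · rw [g2 k l fun b hb hp hk hl => hkl (by omega) (by omega) (by rwa [hk, hl])]
    exact h2 k l fun hk => hkl (by omega)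

/-- `r ← n`, and then `r ← i` for all `i` with the property `b`. -/
def search (r i : Reg) (b : Expr) : LoopProgram :=
  seq (set r (.lit 0) (.lit 0) (scalar .size))
    (loop i (ite b (set r (.lit 0) (.lit 0) (scalar i)) skip))

/-- A search finds some vertex with the desired property, or returns `n` if there is none. -/
theorem sem_search {r i : Reg} (hri : r ≠ i) (hr : r ≠ .size) (b : Expr) {σ : Store} {n : ℕ}
    (hn : σ .size 0 0 = n) (p : ℕ → Prop)
    (hb : ∀ ρ a, a < n → ρ i 0 0 = a → (∀ y, y ≠ r → y ≠ i → ρ y = σ y) →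
      (b.eval ρ ≠ 0 ↔ p a)) :
    ((search r i b).sem σ r 0 0 < n ∧ p ((search r i b).sem σ r 0 0)) ∨
      ((search r i b).sem σ r 0 0 = n ∧ ∀ a < n, ¬ p a) := by
  have hσ : ∀ y, y ≠ r → (σ.write r 0 0 n) y = σ y := fun y hy => Store.write_of_ne _ hy _ _ _
  have := sem_loop_induction (x := i) (σ := σ.write r 0 0 n) (n := n)
    (c := ite b (set r (.lit 0) (.lit 0) (scalar i)) skip) (by rw [hσ _ hr.symm, hn])
    (fun m ρ => (ρ r 0 0 < m ∧ p (ρ r 0 0)) ∨ (ρ r 0 0 = n ∧ ∀ a < m, ¬ p a))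
    (Or.inr ⟨by rw [Store.write_of_ne _ hri, Store.write_apply]; simp, by simp⟩)
    (fun m ρ hm hP hi hρ => by
      have hb' := hb ρ m hm hi fun y h1 h2 => by
        rw [hρ y h2 (by simpa [Writes] using h1), hσ y h1]
      rw [Store.write_of_ne _ hri]
      simp only [sem, Expr.eval]
      by_cases h : p m
      · rw [if_pos (hb'.2 h)]
        left
        simp [scalar, Expr.eval, Store.write_apply, hi, h]
      · rw [if_neg (fun h' => h (hb'.1 h'))]
        rcases hP with ⟨h1, h2⟩ | ⟨h1, h2⟩
        · exact Or.inl ⟨by omega, h2⟩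
        · refine Or.inr ⟨h1, fun a ha => ?_⟩
          rcases Nat.lt_succ_iff_lt_or_eq.1 ha with h' | rfl
          exacts [h2 a h', h])
  have he : (search r i b).sem σ = (loop i (ite b (set r (.lit 0) (.lit 0) (scalar i)) skip)).sem
      (σ.write r 0 0 n) := by
    simp [search, sem, Expr.eval, scalar, hn]
  rw [he]
  exact this

end LoopProgram

end Programs

/-! ### Path contraction -/

/-- The state of the path-based search for components. The search maintains a path of segments, which
are contracted sets of vertices, and repeatedly looks for an edge that leaves the last segment.
Segment `1` is a virtual starting point with edges to all vertices; the segments `2, …, top` consist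
of vertices. -/
structure PathState (V : Type*) where
  /-- the index of the last segment -/
  top : ℕ
  /-- the next unused label -/
  cnt : ℕ
  /-- the index of the segment of a vertex, and `0` for vertices not yet visited -/
  pos : V → ℕ
  /-- the label of the component of a finished vertex, and `0` for all others -/
  lab : V → ℕ
  /-- the heads of the edges that leave a segment -/
  row : ℕ → V → Prop
  /-- the edges of the digraph -/
  arc : V → V → Prop

namespace PathState

variable {V : Type*}

/-- `v` belongs to the last segment. -/
def OnTop (s : PathState V) (v : V) : Prop :=
  s.lab v = 0 ∧ s.pos v = s.top

/-- Some edge leads from the last segment to the unfinished vertex `v` outside of it. -/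
def Exits (s : PathState V) (v : V) : Prop :=
  s.row s.top v ∧ s.lab v = 0 ∧ s.pos v ≠ s.top

/-- A step of the search: the last segment is finished as a component if no edge leaves it;
it is extended by a new vertex `w`, at the end of an edge from a vertex `p` (`none` if the last
segment is the virtual one); or it is merged with its predecessor, if an edge leads back to the path.
If `del` is true, then the antiparallel edge `(w, p)` is deleted in an extension. -/
inductive Step (del : Bool) (s t : PathState V) : Prop
  | finish (hex : ∀ v, ¬ s.Exits v) (htop : t.top = s.top - 1) (hcnt : t.cnt = s.cnt + 1)
      (hpos : t.pos = s.pos) (hlab : ∀ v, s.OnTop v → t.lab v = s.cnt)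
      (hlab' : ∀ v, ¬ s.OnTop v → t.lab v = s.lab v) (hrow : t.row = s.row) (harc : t.arc = s.arc)
  | push (w : V) (p : Option V) (hex : s.Exits w) (hw : s.pos w = 0)
      (hp : ∀ u, p = some u → s.OnTop u ∧ s.arc u w)
      (hp' : ∀ u, s.OnTop u → s.arc u w → p ≠ none)
      (htop : t.top = s.top + 1) (hcnt : t.cnt = s.cnt) (hpos : t.pos w = s.top + 1)
      (hpos' : ∀ v, v ≠ w → t.pos v = s.pos v) (hlab : t.lab = s.lab)
      (hrow : ∀ v, t.row (s.top + 1) v ↔ t.arc w v)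
      (hrow' : ∀ i, i ≠ s.top + 1 → t.row i = s.row i)
      (harc : ∀ x y, t.arc x y ↔ s.arc x y ∧ ¬ (del = true ∧ x = w ∧ p = some y))
  | merge (w : V) (hex : s.Exits w) (hw : s.pos w ≠ 0)
      (htop : t.top = s.top - 1) (hcnt : t.cnt = s.cnt)
      (hpos : ∀ v, s.OnTop v → t.pos v = s.top - 1) (hpos' : ∀ v, ¬ s.OnTop v → t.pos v = s.pos v)
      (hlab : t.lab = s.lab) (hrow : ∀ v, t.row (s.top - 1) v ↔ s.row (s.top - 1) v ∨ s.row s.top v)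
      (hrow' : ∀ i, i ≠ s.top - 1 → t.row i = s.row i) (harc : t.arc = s.arc)

/-- The initial states. -/
structure IsInitial (D : V → V → Prop) (s : PathState V) : Prop where
  top : s.top = 1
  cnt : s.cnt = 1
  pos : ∀ v, s.pos v = 0
  lab : ∀ v, s.lab v = 0
  row : ∀ v, s.row 1 v
  arc : s.arc = D

/-- The states after `m` steps. -/
inductive Reached (del : Bool) (D : V → V → Prop) : ℕ → PathState V → Prop
  | init {s : PathState V} : s.IsInitial D → Reached del D 0 s
  | step {m : ℕ} {s t : PathState V} : Reached del D m s → Step del s t → Reached del D (m + 1) t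

/-- Properties of the states after `m` steps that do not depend on `del`. -/
structure Invariant (D : V → V → Prop) (m : ℕ) (s : PathState V) : Prop where
  pos_le : ∀ v, s.lab v = 0 → s.pos v ≤ s.top
  pos_ne_one : ∀ v, s.pos v ≠ 1
  lab_eq_zero : ∀ v, s.pos v = 0 → s.lab v = 0
  row_one : ∀ v, s.row 1 v
  row_iff : ∀ i, 2 ≤ i → i ≤ s.top →
    ∀ v, s.row i v ↔ ∃ u, s.lab u = 0 ∧ s.pos u = i ∧ s.arc u v
  lab_lt : ∀ v, s.lab v < s.cnt
  top_ne : ∀ v, s.lab v = 0 → s.top ≠ 0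
  arc_le : ∀ x y, s.arc x y → D x y
  arc_iff : ∀ x y, s.pos x = 0 → (s.arc x y ↔ D x y)
  -- every step decreases the potential `2 * #unvisited + top`
  potential : s.top ≠ 0 → 2 * {v | s.pos v = 0}.ncard + s.top + m ≤ 2 * Nat.card V + 1

theorem IsInitial.invariant {D : V → V → Prop} {s : PathState V} (h : s.IsInitial D) :
    Invariant D 0 s := by
  refine ⟨fun v _ => by simp [h.pos], fun v => by simp [h.pos], fun v _ => h.lab v, h.row,
    fun i hi hi' => ?_, fun v => by simp [h.lab, h.cnt], fun v _ => by simp [h.top],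
    fun x y hxy => h.arc ▸ hxy, fun x y _ => by rw [h.arc], fun _ => ?_⟩
  · have := h.top
    omega
  · simp [h.pos, h.top, Set.ncard_univ]

variable {D : V → V → Prop} {m : ℕ} {s t : PathState V}

/-- An edge that leads back to the path ends in a proper segment before the last one. -/
theorem Invariant.exits_pos (hs : Invariant D m s) {w : V} (hex : s.Exits w) (hw : s.pos w ≠ 0) :
    2 ≤ s.pos w ∧ s.pos w < s.top := by
  have h1 := hs.pos_le w hex.2.1
  have h2 := hs.pos_ne_one w
  have h3 := hex.2.2
  omega

theorem Invariant.step [Finite V] {del : Bool} (hs : Invariant D m s) (h : Step del s t) :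
    Invariant D (m + 1) t := by
  obtain ⟨i1, i2, i3, i4, i5, i6, i7, i8, i9, i10⟩ := hs
  cases h with
  | finish hex htop hcnt hpos hlab hlab' hrow harc =>
    have hl0 : ∀ v, t.lab v = 0 → s.lab v = 0 ∧ s.pos v ≠ s.top := by
      intro v hv
      by_cases ho : s.OnTop v
      · have h1 := hlab v ho
        have h2 := i6 v
        omega
      · rw [hlab' v ho] at hv
        exact ⟨hv, fun e => ho ⟨hv, e⟩⟩
    refine ⟨fun v hv => ?_, fun v => by rw [hpos]; exact i2 v, fun v hv => ?_,
      fun v => by rw [hrow]; exact i4 v, fun i hi hi' v => ?_, fun v => ?_, fun v hv => ?_,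
      fun x y h => by rw [harc] at h; exact i8 x y h, fun x y hx => by
        rw [hpos] at hx; rw [harc]; exact i9 x y hx, fun ht => ?_⟩
    · have := i1 v (hl0 v hv).1
      have := (hl0 v hv).2
      rw [hpos]
      omega
    · rw [hpos] at hv
      have hlv := i3 v hv
      have := i7 v hlv
      rw [hlab' v fun ho => this (ho.2 ▸ hv), hlv]
    · rw [hrow, harc, hpos, i5 i hi (by omega)]
      constructor
      · rintro ⟨u, h1, h2, h3⟩
        refine ⟨u, ?_, h2, h3⟩
        rw [hlab' u fun ho => by have := ho.2; omega, h1]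
      · rintro ⟨u, h1, h2, h3⟩
        exact ⟨u, (hl0 u h1).1, h2, h3⟩
    · by_cases ho : s.OnTop v
      · rw [hlab v ho]; omega
      · rw [hlab' v ho]; have := i6 v; omega
    · intro h0
      obtain ⟨h1, h2⟩ := hl0 v hv
      have h3 := i7 v h1
      have h4 : s.top = 1 := by omega
      exact hex v ⟨by rw [h4]; exact i4 v, h1, h2⟩
    · have := i10 (by omega)
      rw [hpos]
      omega
  | push w p hex hw hp hp' htop hcnt hpos hpos' hlab hrow hrow' harc =>
    have ht0 := i7 w hex.2.1
    refine ⟨fun v hv => ?_, fun v => ?_, fun v hv => ?_, fun v => ?_, fun i hi hi' v => ?_,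
      fun v => by rw [hlab, hcnt]; exact i6 v, fun v _ => by omega,
      fun x y h => i8 x y ((harc x y).1 h).1, fun x y hx => ?_, fun _ => ?_⟩
    · by_cases h : v = w
      · subst h; omega
      · rw [hpos' v h]; rw [hlab] at hv; have := i1 v hv; omega
    · by_cases h : v = w
      · subst h; omega
      · rw [hpos' v h]; exact i2 v
    · by_cases h : v = w
      · subst h; omega
      · rw [hpos' v h] at hv; rw [hlab]; exact i3 v hv
    · rw [hrow' 1 (by omega)]; exact i4 v
    · by_cases h : i = s.top + 1
      · subst h
        rw [hrow]
        constructor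
        · intro h
          exact ⟨w, by rw [hlab]; exact hex.2.1, hpos, h⟩
        · rintro ⟨u, h1, h2, h3⟩
          have : u = w := by
            by_contra hu
            rw [hpos' u hu] at h2
            rw [hlab] at h1
            have := i1 u h1
            omega
          exact this ▸ h3
      · rw [hrow' i h, i5 i hi (by omega)]
        constructor
        · rintro ⟨u, h1, h2, h3⟩
          have hu : u ≠ w := by rintro rfl; omega
          exact ⟨u, by rw [hlab]; exact h1, by rw [hpos' u hu]; exact h2,
            (harc u v).2 ⟨h3, fun h => hu h.2.1⟩⟩
        · rintro ⟨u, h1, h2, h3⟩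
          have hu : u ≠ w := by rintro rfl; omega
          rw [hpos' u hu] at h2
          rw [hlab] at h1
          exact ⟨u, h1, h2, ((harc u v).1 h3).1⟩
    · have hxw : x ≠ w := by rintro rfl; omega
      rw [hpos' x hxw] at hx
      rw [harc, ← i9 x y hx]
      simp [hxw]
    · have := i10 ht0
      have hlt : {v | t.pos v = 0}.ncard < {v | s.pos v = 0}.ncard := by
        refine Set.ncard_lt_ncard ⟨fun v (hv : t.pos v = 0) => ?_, fun h => ?_⟩ (Set.toFinite _)
        · have hvw : v ≠ w := by rintro rfl; omega
          rw [hpos' v hvw] at hv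
          exact hv
        · have : t.pos w = 0 := h hw
          omega
      omega
  | merge w hex hw htop hcnt hpos hpos' hlab hrow hrow' harc =>
    obtain ⟨h2w, hwt⟩ :=
      Invariant.exits_pos ⟨i1, i2, i3, i4, i5, i6, i7, i8, i9, i10⟩ hex hw
    have hzero : ∀ v, t.pos v = 0 ↔ s.pos v = 0 := by
      intro v
      by_cases h : s.OnTop v
      · have := h.2; rw [hpos v h]; omega
      · rw [hpos' v h]
    refine ⟨fun v hv => ?_, fun v => ?_, fun v hv => ?_, fun v => ?_, fun i hi hi' v => ?_,
      fun v => by rw [hlab, hcnt]; exact i6 v, fun v _ => by omega,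
      fun x y h => by rw [harc] at h; exact i8 x y h, fun x y hx => by
        rw [harc]; exact i9 x y ((hzero x).1 hx), fun _ => ?_⟩
    · rw [hlab] at hv
      by_cases h : s.OnTop v
      · rw [hpos v h]; omega
      · have h1 := i1 v hv
        have h2 : s.pos v ≠ s.top := fun e => h ⟨hv, e⟩
        rw [hpos' v h]
        omega
    · by_cases h : s.OnTop v
      · rw [hpos v h]; omega
      · rw [hpos' v h]; exact i2 v
    · rw [hlab]; exact i3 v ((hzero v).1 hv)
    · rw [hrow' 1 (by omega)]; exact i4 v
    · rw [harc, hlab]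
      by_cases h : i = s.top - 1
      · subst h
        rw [hrow, i5 _ hi (by omega), i5 s.top (by omega) le_rfl]
        constructor
        · rintro (⟨u, h1, h2, h3⟩ | ⟨u, h1, h2, h3⟩)
          · exact ⟨u, h1, by rw [hpos' u fun h => by have := h.2; omega, h2], h3⟩
          · exact ⟨u, h1, hpos u ⟨h1, h2⟩, h3⟩
        · rintro ⟨u, h1, h2, h3⟩
          by_cases h : s.OnTop u
          · exact Or.inr ⟨u, h1, h.2, h3⟩
          · rw [hpos' u h] at h2
            exact Or.inl ⟨u, h1, h2, h3⟩
      · rw [hrow' i h, i5 i hi (by omega)]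
        constructor
        · rintro ⟨u, h1, h2, h3⟩
          exact ⟨u, h1, by rw [hpos' u fun h => by have := h.2; omega, h2], h3⟩
        · rintro ⟨u, h1, h2, h3⟩
          have h4 : ¬ s.OnTop u := fun ho => h (by rw [← h2, hpos u ho])
          rw [hpos' u h4] at h2
          exact ⟨u, h1, h2, h3⟩
    · have := i10 (by omega)
      simp only [hzero]
      omega

theorem Reached.invariant [Finite V] {del : Bool} (h : Reached del D m s) : Invariant D m s := by
  induction h with
  | init h => exact h.invariant
  | step _ h ih => exact ih.step h

/-- After `2 n + 1` steps, all vertices are finished. -/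
theorem Reached.lab_ne_zero [Finite V] {del : Bool} (h : Reached del D m s)
    (hm : 2 * Nat.card V + 1 ≤ m) (v : V) : s.lab v ≠ 0 := by
  intro hv
  have h1 := h.invariant.top_ne v hv
  have h2 := h.invariant.potential h1
  omega

/-! ### Strongly connected components -/

/-- Properties of the states if no edges are deleted: vertices of the path reach all later ones, and
the labels mark strongly connected components of the set of finished vertices, which no edge
leaves. -/
structure StrongInvariant (D : V → V → Prop) (s : PathState V) : Prop where
  arc_eq : s.arc = D
  reach : ∀ x y, s.lab x = 0 → s.lab y = 0 → s.pos x ≠ 0 → s.pos x ≤ s.pos y →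
    Relation.ReflTransGen D x y
  reach_lab : ∀ x y, s.lab x ≠ 0 → s.lab x = s.lab y → Relation.ReflTransGen D x y
  closed : ∀ x y, D x y → s.lab x ≠ 0 → s.lab y ≠ 0
  lab_eq : ∀ x y, s.lab x ≠ 0 → Relation.ReflTransGen D x y → Relation.ReflTransGen D y x →
    s.lab x = s.lab y

theorem StrongInvariant.step (hi : Invariant D m s)
    (hs : StrongInvariant D s) (h : Step false s t) : StrongInvariant D t := by
  obtain ⟨j1, j2, j3, j4, j5⟩ := hs
  cases h with
  | finish hex htop hcnt hpos hlab hlab' hrow harc =>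
    have hne : ∀ v, s.lab v ≠ 0 → t.lab v = s.lab v := fun v hv => hlab' v fun h => hv h.1
    have hl0 : ∀ v, t.lab v = 0 → s.lab v = 0 := fun v hv => by
      by_contra h
      exact h (hne v h ▸ hv)
    have htop0 : ∀ v, s.OnTop v → t.lab v ≠ 0 := fun v hv => by
      rw [hlab v hv]; have := hi.lab_lt v; omega
    have hpos0 : ∀ v, s.OnTop v → 2 ≤ s.top := fun v hv => by
      have h1 := hi.top_ne v hv.1
      have h2 := hi.pos_ne_one v
      have h3 := hv.2
      omega
    have hcl : ∀ x y, D x y → t.lab x ≠ 0 → t.lab y ≠ 0 := by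
      intro x y hxy hx
      by_cases h : s.OnTop x
      · have h1 : s.row s.top y :=
          (hi.row_iff _ (hpos0 x h) le_rfl y).2 ⟨x, h.1, h.2, j1 ▸ hxy⟩
        by_cases h2 : s.lab y = 0
        · by_cases h3 : s.pos y = s.top
          · exact htop0 y ⟨h2, h3⟩
          · exact absurd ⟨h1, h2, h3⟩ (hex y)
        · rw [hne y h2]; exact h2
      · rw [hlab' x h] at hx
        have := j4 x y hxy hx
        rw [hne y this]; exact this
    refine ⟨harc.trans j1, fun x y hx hy hx0 hxy => ?_, fun x y hx hxy => ?_, hcl,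
      fun x y hx hxy hyx => ?_⟩
    · rw [hpos] at hx0 hxy
      exact j2 x y (hl0 x hx) (hl0 y hy) hx0 hxy
    · by_cases h1 : s.OnTop x <;> by_cases h2 : s.OnTop y
      · exact j2 x y h1.1 h2.1 (by have := hpos0 x h1; have := h1.2; omega)
          (h1.2.trans h2.2.symm).le
      · rw [hlab x h1, hlab' y h2] at hxy
        exact absurd hxy (hi.lab_lt y).ne'
      · rw [hlab y h2, hlab' x h1] at hxy
        exact absurd hxy (hi.lab_lt x).ne
      · rw [hlab' x h1, hlab' y h2] at hxy
        rw [hlab' x h1] at hx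
        exact j3 x y hx hxy
    · have hcl' : ∀ {a b}, Relation.ReflTransGen D a b → s.lab a ≠ 0 → s.lab b ≠ 0 :=
        fun h ha => reach_closed (A := {v | s.lab v ≠ 0}) j4 h ha
      have hy : t.lab y ≠ 0 := reach_closed (A := {v | t.lab v ≠ 0}) hcl hxy hx
      by_cases h1 : s.OnTop x <;> by_cases h2 : s.OnTop y
      · rw [hlab x h1, hlab y h2]
      · rw [hlab' y h2] at hy
        exact absurd h1.1 (hcl' hyx hy)
      · rw [hlab' x h1] at hx
        exact absurd h2.1 (hcl' hxy hx)
      · rw [hlab' x h1, hlab' y h2]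
        rw [hlab' x h1] at hx
        exact j5 x y hx hxy hyx
  | push w p hex hw hp hp' htop hcnt hpos hpos' hlab hrow hrow' harc =>
    refine ⟨?_, fun x y hx hy hx0 hxy => ?_, by rwa [hlab], by rwa [hlab], by rwa [hlab]⟩
    · rw [← j1]
      funext x y
      exact propext (by simp [harc])
    · rw [hlab] at hx hy
      by_cases hyw : y = w
      · subst hyw
        by_cases hxw : x = y
        · exact hxw ▸ .refl
        · rw [hpos' x hxw] at hx0
          have h1 := hi.pos_le x hx
          have h2 := hi.pos_ne_one x
          obtain ⟨u, hu, hut, huw⟩ := (hi.row_iff s.top (by omega) le_rfl y).1 hex.1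
          exact (j2 x u hx hu hx0 (by omega)).tail (j1 ▸ huw)
      · by_cases hxw : x = w
        · subst hxw
          rw [hpos' y hyw] at hxy
          have := hi.pos_le y hy
          omega
        · rw [hpos' x hxw] at hx0 hxy
          rw [hpos' y hyw] at hxy
          exact j2 x y hx hy hx0 hxy
  | merge w hex hw htop hcnt hpos hpos' hlab hrow hrow' harc =>
    obtain ⟨h2w, hwt⟩ := hi.exits_pos hex hw
    refine ⟨harc.trans j1, fun x y hx hy hx0 hxy => ?_, by rwa [hlab], by rwa [hlab], by rwa [hlab]⟩
    rw [hlab] at hx hy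
    obtain ⟨u, hu, hut, huw⟩ := (hi.row_iff s.top (by omega) le_rfl w).1 hex.1
    have hple : ∀ v, t.pos v ≤ s.pos v := fun v => by
      by_cases h : s.OnTop v
      · have := h.2; rw [hpos v h]; omega
      · rw [hpos' v h]
    by_cases h : s.OnTop x
    · have h1 := h.2
      rw [hpos x h] at hxy
      -- from `x` to the tail of the edge, to the earlier segment, and up the path to `y`
      exact ((j2 x u hx hu (by omega) (by omega)).tail (j1 ▸ huw)).trans
        (j2 w y hex.2.1 hy hw (by have := hple y; omega))
    · rw [hpos' x h] at hx0 hxy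
      exact j2 x y hx hy hx0 (hxy.trans (hple y))

/-- Without deletions, the search labels the strongly connected components. -/
theorem Reached.lab_eq_iff_reach [Finite V] (h : Reached false D m s)
    (hm : 2 * Nat.card V + 1 ≤ m) (x y : V) :
    s.lab x = s.lab y ↔ Relation.ReflTransGen D x y ∧ Relation.ReflTransGen D y x := by
  have hs : StrongInvariant D s := by
    clear hm
    induction h with
    | init h =>
      exact ⟨h.arc, fun x _ _ _ hx => absurd (h.pos x) hx, fun x _ hx => absurd (h.lab x) hx,
        fun x _ _ hx => absurd (h.lab x) hx, fun x _ hx => absurd (h.lab x) hx⟩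
    | step hr h ih => exact ih.step hr.invariant h
  have h0 := h.lab_ne_zero hm
  exact ⟨fun e => ⟨hs.reach_lab x y (h0 x) e, hs.reach_lab y x (h0 y) e.symm⟩,
    fun ⟨h1, h2⟩ => hs.lab_eq x y (h0 x) h1 h2⟩

end PathState

/-! ### Components without bridges -/

namespace PathState

variable {V : Type*} {D : V → V → Prop} {m : ℕ} {s t : PathState V}

/-- The edge `(x, y)` from a vertex `x` of the path to a vertex outside of its segment has been
deleted. -/
def Deleted (D : V → V → Prop) (s : PathState V) (x y : V) : Prop :=
  s.lab x = 0 ∧ s.pos x ≠ 0 ∧ D x y ∧ ¬ s.arc x y ∧ (s.lab y = 0 → s.pos y ≠ s.pos x)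

/-- Properties of the states if `D` is symmetric and antiparallel edges of the path are deleted:
consecutive segments are joined by an edge whose reverse is deleted, this is the only edge deleted
between a segment and other vertices, segments and labelled sets are linked, and labels separate
vertices that are not related. -/
structure BridgeInvariant (D : V → V → Prop) (s : PathState V) : Prop where
  linked : ∀ x y, s.lab x = 0 → s.lab y = 0 → s.pos x ≠ 0 → s.pos x = s.pos y → Linked D x y
  linked_lab : ∀ x y, s.lab x ≠ 0 → s.lab x = s.lab y → Linked D x y
  link : ∀ i, 3 ≤ i → i ≤ s.top → ∃ r q, s.lab r = 0 ∧ s.lab q = 0 ∧ s.pos r = i ∧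
    s.pos q + 1 = i ∧ D q r ∧ ¬ s.arc r q
  deleted : ∀ x y, Deleted D s x y → s.lab y = 0 ∧ s.pos y + 1 = s.pos x
  unique : ∀ x y x' y', Deleted D s x y → Deleted D s x' y' → s.pos x = s.pos x' →
    x = x' ∧ y = y'
  lab_eq : ∀ x y, s.lab x ≠ 0 → TwinlessRelated D x y → s.lab x = s.lab y

/-- If no edge leaves the last segment, then its vertices are not related to any others: by the
uniqueness of the deleted edge, a closed walk that leaves the segment uses an edge in both
directions. -/
theorem BridgeInvariant.onTop_of_related (hD : ∀ x y, D x y → D y x) (hi : Invariant D m s)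
    (hs : BridgeInvariant D s) (hex : ∀ v, ¬ s.Exits v) {x y : V} (hx : s.OnTop x)
    (hxy : TwinlessRelated D x y) : s.OnTop y := by
  by_contra hy
  obtain ⟨H, hHD, hH, h1, h2⟩ := hxy
  obtain ⟨a, b, hab, ha, hb, hxa, hby⟩ := exists_edge_of_reach (A := {v | s.OnTop v}) h1 hx hy
  obtain ⟨b', a', hba, hb', ha', hyb, hax⟩ :=
    exists_edge_of_reach (A := {v | s.OnTop v}ᶜ) h2 hy (not_not.2 hx)
  have ha' : s.OnTop a' := not_not.1 ha'
  have htop : 2 ≤ s.top := by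
    have h1 := hi.top_ne x hx.1
    have h2 := hi.pos_ne_one x
    have h3 := hx.2
    omega
  have key : ∀ a b, s.OnTop a → ¬ s.OnTop b → D a b → Relation.ReflTransGen H x b →
      Relation.ReflTransGen H b x → Deleted D s a b := by
    intro a b ha hb hab hxb hbx
    have hlb : s.lab b = 0 := by
      by_contra hlb
      exact hlb ((hs.lab_eq b x hlb ⟨H, hHD, hH, hbx, hxb⟩).trans hx.1)
    have hpb : s.pos b ≠ s.top := fun e => hb ⟨hlb, e⟩
    refine ⟨ha.1, by have := ha.2; omega, hab, fun harc => hex b ⟨?_, hlb, hpb⟩,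
      fun _ => ha.2 ▸ hpb⟩
    exact (hi.row_iff _ htop le_rfl b).2 ⟨a, ha.1, ha.2, harc⟩
  have d1 := key a b ha hb (hHD _ _ hab) (hxa.tail hab) (hby.trans h2)
  have d2 := key a' b' ha' hb' (hD _ _ (hHD _ _ hba)) (h1.trans hyb) (.head hba hax)
  obtain ⟨rfl, rfl⟩ := hs.unique _ _ _ _ d1 d2 (ha.2.trans ha'.2.symm)
  exact hH a b (fun e => hb (e ▸ ha)) ⟨hab, hba⟩

/-- An edge from the last segment back to the path links the last two segments: together with the
edges between consecutive segments it forms a closed walk in which no edge is used twice. -/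
theorem BridgeInvariant.linked_of_exits (hi : Invariant D m s)
    (hs : BridgeInvariant D s) {w : V} (hex : s.Exits w) (hw : s.pos w ≠ 0) {x y : V}
    (hx : s.OnTop x) (hly : s.lab y = 0) (hy : s.pos y + 1 = s.top) : Linked D x y := by
  obtain ⟨h2w, hwt⟩ := hi.exits_pos hex hw
  obtain ⟨u, hlu, hut, huw⟩ := (hi.row_iff s.top (by omega) le_rfl w).1 hex.1
  obtain ⟨r, q, hlr, hlq, hr, hq, hqr, hrq⟩ := hs.link s.top (by omega) le_rfl
  have hyq : Linked D y q := hs.linked y q hly hlq (by omega) (by omega)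
  have hxr : Linked D x r := hs.linked x r hx.1 hlr (by have := hx.2; omega) (by rw [hx.2, hr])
  have hur : Linked D u r := hs.linked u r hlu hlr (by omega) (by omega)
  refine (hxr.trans ?_).trans hyq.symm
  rintro A ⟨p, p', hA⟩
  by_contra hne
  have hrq' := hA q r hqr (by tauto)
  -- the cut contains the edge `(q, r)`, hence none of the other edges of the closed walk
  have side : ∀ k, s.pos w + k < s.top → ∀ a, s.lab a = 0 → s.pos a = s.pos w + k →
      (w ∈ A ↔ a ∈ A) := by
    intro k
    induction k with
    | zero =>
      intro _ a hla ha
      exact hs.linked w a hex.2.1 hla hw ha.symm A ⟨p, p', hA⟩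
    | succ k ih =>
      intro hk a hla ha
      obtain ⟨r', q', hlr', hlq', hr', hq', hqr', -⟩ :=
        hs.link (s.pos w + (k + 1)) (by omega) (by omega)
      have h1 := ih (by omega) q' hlq' (by omega)
      have h2 := hs.linked r' a hlr' hla (by omega) (by omega) A ⟨p, p', hA⟩
      rw [h1, ← h2]
      by_contra hc
      have := hA q' r' hqr' (by tauto)
      have e : r' = r ∨ q' = r := by
        rcases this with ⟨rfl, rfl⟩ | ⟨rfl, rfl⟩ <;> rcases hrq' with ⟨rfl, rfl⟩ | ⟨rfl, rfl⟩ <;>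
          simp
      rcases e with rfl | rfl <;> omega
  have hwq : w ∈ A ↔ q ∈ A := side (s.top - 1 - s.pos w) (by omega) q hlq (by omega)
  have hur' := hur A ⟨p, p', hA⟩
  have := hA u w (hi.arc_le _ _ huw) (by tauto)
  have hwr : w ≠ r := by rintro rfl; omega
  have huq : u ≠ q := by rintro rfl; omega
  have e : u = r ∧ w = q := by
    rcases this with ⟨rfl, rfl⟩ | ⟨rfl, rfl⟩ <;> rcases hrq' with ⟨rfl, rfl⟩ | ⟨rfl, rfl⟩ <;>
      first | exact ⟨rfl, rfl⟩ | exact absurd rfl hwr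
  obtain ⟨rfl, rfl⟩ := e
  exact hrq huw

theorem BridgeInvariant.step (hD : ∀ x y, D x y → D y x) (hi : Invariant D m s)
    (hs : BridgeInvariant D s) (h : Step true s t) : BridgeInvariant D t := by
  cases h with
  | finish hex htop hcnt hpos hlab hlab' hrow harc =>
    have hrel := fun x y => BridgeInvariant.onTop_of_related hD hi hs hex (x := x) (y := y)
    obtain ⟨j1, j2, j3, j4, j5, j6⟩ := hs
    have hne : ∀ v, s.lab v ≠ 0 → t.lab v = s.lab v := fun v hv => hlab' v fun h => hv h.1
    have hl0 : ∀ v, t.lab v = 0 ↔ s.lab v = 0 ∧ s.pos v ≠ s.top := by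
      intro v
      by_cases ho : s.OnTop v
      · have h1 := hlab v ho
        have h2 := hi.lab_lt v
        have h3 := ho.2
        omega
      · rw [hlab' v ho]
        exact ⟨fun hv => ⟨hv, fun e => ho ⟨hv, e⟩⟩, fun h => h.1⟩
    have hdel : ∀ x y, Deleted D t x y → Deleted D s x y ∧ s.pos x ≠ s.top := by
      rintro x y ⟨h1, h2, h3, h4, h5⟩
      rw [hpos] at h2 h5
      rw [harc] at h4
      rw [hl0] at h1
      refine ⟨⟨h1.1, h2, h3, h4, fun h6 e => h5 ((hl0 y).2 ⟨h6, e ▸ h1.2⟩) e⟩, h1.2⟩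
    refine ⟨fun x y hx hy hx0 hxy => ?_, fun x y hx hxy => ?_, fun i hi1 hi2 => ?_,
      fun x y hxy => ?_, fun x y x' y' h h' e => ?_, fun x y hx hxy => ?_⟩
    · rw [hpos] at hx0 hxy
      exact j1 x y ((hl0 x).1 hx).1 ((hl0 y).1 hy).1 hx0 hxy
    · by_cases h1 : s.OnTop x <;> by_cases h2 : s.OnTop y
      · refine j1 x y h1.1 h2.1 ?_ (h1.2.trans h2.2.symm)
        have := hi.top_ne x h1.1
        have := h1.2
        omega
      · rw [hlab x h1, hlab' y h2] at hxy
        exact absurd hxy (hi.lab_lt y).ne'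
      · rw [hlab y h2, hlab' x h1] at hxy
        exact absurd hxy (hi.lab_lt x).ne
      · rw [hlab' x h1, hlab' y h2] at hxy
        rw [hlab' x h1] at hx
        exact j2 x y hx hxy
    · obtain ⟨r, q, h1, h2, h3, h4, h5, h6⟩ := j3 i hi1 (by omega)
      exact ⟨r, q, (hl0 r).2 ⟨h1, by omega⟩, (hl0 q).2 ⟨h2, by omega⟩, by rw [hpos, h3],
        by rw [hpos, h4], h5, by rwa [harc]⟩
    · obtain ⟨hd, hxt⟩ := hdel x y hxy
      obtain ⟨h1, h2⟩ := j4 x y hd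
      have := hi.pos_le x hd.1
      exact ⟨(hl0 y).2 ⟨h1, by omega⟩, by rwa [hpos]⟩
    · rw [hpos] at e
      exact j5 x y x' y' (hdel x y h).1 (hdel x' y' h').1 e
    · by_cases h1 : s.OnTop x
      · rw [hlab x h1, hlab y (hrel x y h1 hxy)]
      · rw [hlab' x h1] at hx ⊢
        have h2 := j6 x y hx hxy
        rw [h2, hne y (h2 ▸ hx)]
  | push w p hex hw hp hp' htop hcnt hpos hpos' hlab hrow hrow' harc =>
    obtain ⟨j1, j2, j3, j4, j5, j6⟩ := hs
    have ht0 := hi.top_ne w hex.2.1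
    have htw : ∀ v, s.lab v = 0 → t.pos v = s.top + 1 → v = w := by
      intro v hlv hv
      by_contra h
      rw [hpos' v h] at hv
      have := hi.pos_le v hlv
      omega
    have hdel : ∀ x y, x ≠ w → Deleted D t x y → Deleted D s x y ∧ y ≠ w := by
      rintro x y hxw ⟨h1, h2, h3, h4, h5⟩
      rw [hpos' x hxw] at h2 h5
      rw [hlab] at h1 h5
      rw [harc] at h4
      have hd : Deleted D s x y := by
        refine ⟨h1, h2, h3, fun h => h4 ⟨h, fun h => hxw h.2.1⟩, fun h6 => ?_⟩
        by_cases hyw : y = w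
        · subst hyw; omega
        · rw [hpos' y hyw] at h5
          exact h5 h6
      refine ⟨hd, ?_⟩
      rintro rfl
      have := (j4 x y hd).2
      have := hi.pos_ne_one x
      omega
    have hdelw : ∀ y, Deleted D t w y → p = some y := by
      rintro y ⟨-, -, h3, h4, -⟩
      by_contra hc
      exact h4 ((harc w y).2 ⟨(hi.arc_iff w y hw).2 h3, fun h => hc h.2.2⟩)
    refine ⟨fun x y hx hy hx0 hxy => ?_, by rwa [hlab], fun i hi1 hi2 => ?_,
      fun x y hxy => ?_, fun x y x' y' h h' e => ?_, by rwa [hlab]⟩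
    · rw [hlab] at hx hy
      by_cases hxw : x = w
      · subst hxw
        rw [htw y hy (by omega)]
        exact .refl _ _
      · by_cases hyw : y = w
        · subst hyw
          exact absurd (htw x hx (by omega)) hxw
        · rw [hpos' x hxw] at hx0 hxy
          rw [hpos' y hyw] at hxy
          exact j1 x y hx hy hx0 hxy
    · rw [hlab]
      by_cases hit : i = s.top + 1
      · subst hit
        obtain ⟨u, hu1, hu2, hu3⟩ := (hi.row_iff s.top (by omega) le_rfl w).1 hex.1
        obtain ⟨q, hq⟩ := Option.ne_none_iff_exists'.1 (hp' u ⟨hu1, hu2⟩ hu3)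
        obtain ⟨⟨h1, h2⟩, h3⟩ := hp q hq
        have hqw : q ≠ w := by rintro rfl; omega
        exact ⟨w, q, hex.2.1, h1, hpos, by rw [hpos' q hqw, h2], hi.arc_le _ _ h3,
          fun h => ((harc w q).1 h).2 ⟨rfl, rfl, hq⟩⟩
      · obtain ⟨r, q, h1, h2, h3, h4, h5, h6⟩ := j3 i hi1 (by omega)
        refine ⟨r, q, h1, h2, ?_, ?_, h5, fun h => h6 ((harc r q).1 h).1⟩
        · rw [hpos' r (by rintro rfl; omega), h3]
        · rw [hpos' q (by rintro rfl; omega), h4]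
    · by_cases hxw : x = w
      · subst hxw
        obtain ⟨⟨h1, h2⟩, -⟩ := hp y (hdelw y hxy)
        rw [hlab, hpos, hpos' y (by rintro rfl; omega)]
        exact ⟨h1, by rw [h2]⟩
      · obtain ⟨hd, hyw⟩ := hdel x y hxw hxy
        rw [hlab, hpos' x hxw, hpos' y hyw]
        exact j4 x y hd
    · have hlx := h.1
      have hlx' := h'.1
      rw [hlab] at hlx hlx'
      by_cases hxw : x = w
      · subst hxw
        obtain rfl := htw x' hlx' (by omega)
        exact ⟨rfl, Option.some.inj ((hdelw y h).symm.trans (hdelw y' h'))⟩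
      · have hxw' : x' ≠ w := by
          rintro rfl
          exact hxw (htw x hlx (by omega))
        rw [hpos' x hxw, hpos' x' hxw'] at e
        exact j5 x y x' y' (hdel x y hxw h).1 (hdel x' y' hxw' h').1 e
  | merge w hex hw htop hcnt hpos hpos' hlab hrow hrow' harc =>
    have hlink := fun x y => BridgeInvariant.linked_of_exits hi hs hex hw (x := x) (y := y)
    obtain ⟨j1, j2, j3, j4, j5, j6⟩ := hs
    obtain ⟨h2w, hwt⟩ := hi.exits_pos hex hw
    have hdel : ∀ x y, Deleted D t x y → Deleted D s x y ∧ ¬ s.OnTop x := by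
      rintro x y ⟨h1, h2, h3, h4, h5⟩
      rw [hlab] at h1 h5
      rw [harc] at h4
      by_cases hx : s.OnTop x
      · -- the edge to the preceding segment is now inside of a segment
        exfalso
        have hx2 := hx.2
        have hd : Deleted D s x y := by
          refine ⟨h1, by omega, h3, h4, fun h6 e => ?_⟩
          have := h5 h6
          rw [hpos x hx, hpos y ⟨h6, by omega⟩] at this
          exact this rfl
        obtain ⟨h6, h7⟩ := j4 x y hd
        have := h5 h6
        rw [hpos x hx, hpos' y fun h => by have := h.2; omega] at this
        omega
      · refine ⟨⟨h1, by rwa [hpos' x hx] at h2, h3, h4, fun h6 e => ?_⟩, hx⟩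
        have := h5 h6
        rw [hpos' x hx, hpos' y fun h => hx ⟨h1, e ▸ h.2⟩] at this
        exact this e
    refine ⟨fun x y hx hy hx0 hxy => ?_, by rwa [hlab], fun i hi1 hi2 => ?_,
      fun x y hxy => ?_, fun x y x' y' h h' e => ?_, by rwa [hlab]⟩
    · rw [hlab] at hx hy
      by_cases h1 : s.OnTop x <;> by_cases h2 : s.OnTop y
      · exact j1 x y hx hy (by have := h1.2; omega) (h1.2.trans h2.2.symm)
      · rw [hpos x h1, hpos' y h2] at hxy
        exact hlink x y h1 hy (by omega)
      · rw [hpos y h2, hpos' x h1] at hxy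
        exact (hlink y x h2 hx (by omega)).symm
      · rw [hpos' x h1] at hx0 hxy
        rw [hpos' y h2] at hxy
        exact j1 x y hx hy hx0 hxy
    · obtain ⟨r, q, h1, h2, h3, h4, h5, h6⟩ := j3 i hi1 (by omega)
      refine ⟨r, q, by rwa [hlab], by rwa [hlab], ?_, ?_, h5, by rwa [harc]⟩
      · rw [hpos' r fun h => by have := h.2; omega, h3]
      · rw [hpos' q fun h => by have := h.2; omega, h4]
    · obtain ⟨hd, hx⟩ := hdel x y hxy
      obtain ⟨h1, h2⟩ := j4 x y hd
      have := hi.pos_le x hd.1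
      rw [hlab, hpos' x hx, hpos' y fun h => by have := h.2; omega]
      exact ⟨h1, h2⟩
    · obtain ⟨hd, hx⟩ := hdel x y h
      obtain ⟨hd', hx'⟩ := hdel x' y' h'
      rw [hpos' x hx, hpos' x' hx'] at e
      exact j5 x y x' y' hd hd' e

/-- With deletions, the search labels the components of a symmetric graph that are not separated by
bridges. -/
theorem Reached.linked_and_related [Finite V] (hD : ∀ x y, D x y → D y x)
    (h : Reached true D m s) (hm : 2 * Nat.card V + 1 ≤ m) (x y : V) :
    (s.lab x = s.lab y → Linked D x y) ∧ (TwinlessRelated D x y → s.lab x = s.lab y) := by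
  have hs : BridgeInvariant D s := by
    clear hm
    induction h with
    | init h =>
      exact ⟨fun x _ _ _ hx => absurd (h.pos x) hx, fun x _ hx => absurd (h.lab x) hx,
        fun i h1 h2 => absurd (h1.trans h2) (by simp [h.top]),
        fun x _ hx => absurd (h.pos x) hx.2.1, fun x _ _ _ hx => absurd (h.pos x) hx.2.1,
        fun x _ hx => absurd (h.lab x) hx⟩
    | step hr h ih => exact ih.step hD hr.invariant h
  have h0 := h.lab_ne_zero hm x
  exact ⟨hs.linked_lab x y h0, hs.lab_eq x y h0⟩

end PathState

/-! ### The search as a program -/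

namespace Var

/-- The adjacency matrix of the graph that is searched. -/
abbrev arc : Reg := .tmp 0

/-- The segments of the vertices. -/
abbrev pos : Reg := .tmp 1

/-- The labels of the finished vertices. -/
abbrev lab : Reg := .tmp 2

/-- The heads of the edges that leave the segments, one row for each segment. -/
abbrev row : Reg := .tmp 3

/-- The index of the last segment. -/
abbrev top : Reg := .tmp 4

/-- The next unused label. -/
abbrev cnt : Reg := .tmp 5

/-- The head of an edge that leaves the last segment. -/
abbrev exit : Reg := .tmp 6

/-- The tail of an edge from the last segment to a new vertex. -/
abbrev parent : Reg := .tmp 7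

/-- The loop variable of the search. -/
abbrev round : Reg := .tmp 8

/-- A loop variable. -/
abbrev i : Reg := .tmp 9

/-- A loop variable. -/
abbrev j : Reg := .tmp 10

/-- The vertex that is deleted. -/
abbrev z : Reg := .tmp 11

/-- The result of a search for a vertex. -/
abbrev first : Reg := .tmp 12

/-- The result of a search for a vertex. -/
abbrev second : Reg := .tmp 13

/-- Marks of the twinless articulation points. -/
abbrev ap : Reg := .tmp 14

/-- Marks of the pairs of vertices that are not inseparable. -/
abbrev sep : Reg := .tmp 15

/-- A loop variable for the least vertex of a block. -/
abbrev x : Reg := .tmp 16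

/-- A loop variable for the second least vertex of a block. -/
abbrev y : Reg := .tmp 17

end Var

namespace LoopProgram

open PathState

/-- The vertex `v` belongs to the last segment. -/
def onTopExpr (v : Expr) : Expr :=
  .and (.eq (.get Var.lab v (.lit 0)) (.lit 0)) (.eq (.get Var.pos v (.lit 0)) (scalar Var.top))

/-- Look for an edge that leaves the last segment. -/
def findExit : LoopProgram :=
  search Var.exit Var.i (.and (.eq (.get Var.row (scalar Var.top) (scalar Var.i)) (.lit 1))
    (.and (.eq (.get Var.lab (scalar Var.i) (.lit 0)) (.lit 0))
      (.not (.eq (.get Var.pos (scalar Var.i) (.lit 0)) (scalar Var.top)))))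

/-- Look for the tail of an edge from the last segment to the new vertex. -/
def findParent : LoopProgram :=
  search Var.parent Var.i (.and (onTopExpr (scalar Var.i))
    (.eq (.get Var.arc (scalar Var.i) (scalar Var.exit)) (.lit 1)))

/-- Finish the last segment. -/
def finish : LoopProgram :=
  seq (loop Var.i (ite (onTopExpr (scalar Var.i))
      (set Var.lab (scalar Var.i) (.lit 0) (scalar Var.cnt)) skip))
    (seq (set Var.cnt (.lit 0) (.lit 0) (.succ (scalar Var.cnt)))
      (set Var.top (.lit 0) (.lit 0) (.pred (scalar Var.top))))

/-- Delete the edge from the new vertex to its parent. If there is no parent, then the search for it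
has returned `n`, and the assignment does not affect the adjacency matrix. -/
def deleteArc (del : Bool) : LoopProgram :=
  if del then set Var.arc (scalar Var.exit) (scalar Var.parent) (.lit 0) else skip

/-- Extend the path by a new vertex. -/
def push (del : Bool) : LoopProgram :=
  seq findParent (seq (deleteArc del)
    (seq (set Var.top (.lit 0) (.lit 0) (.succ (scalar Var.top)))
      (seq (set Var.pos (scalar Var.exit) (.lit 0) (scalar Var.top))
        (loop Var.i (set Var.row (scalar Var.top) (scalar Var.i)
          (.get Var.arc (scalar Var.exit) (scalar Var.i)))))))

/-- Merge the last two segments. -/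
def merge : LoopProgram :=
  seq (loop Var.i (ite (.eq (.get Var.row (scalar Var.top) (scalar Var.i)) (.lit 1))
      (set Var.row (.pred (scalar Var.top)) (scalar Var.i) (.lit 1)) skip))
    (seq (loop Var.i (ite (onTopExpr (scalar Var.i))
        (set Var.pos (scalar Var.i) (.lit 0) (.pred (scalar Var.top))) skip))
      (set Var.top (.lit 0) (.lit 0) (.pred (scalar Var.top))))

/-- One step of the search. -/
def pathStep (del : Bool) : LoopProgram :=
  seq findExit (ite (.lt (scalar Var.exit) (scalar .size))
    (ite (.eq (.get Var.pos (scalar Var.exit) (.lit 0)) (.lit 0)) (push del) merge) finish)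

/-- Initialize the search. -/
def pathInit : LoopProgram :=
  seq (loop Var.i (set Var.pos (scalar Var.i) (.lit 0) (.lit 0)))
    (seq (loop Var.i (set Var.lab (scalar Var.i) (.lit 0) (.lit 0)))
      (seq (loop Var.i (set Var.row (.lit 1) (scalar Var.i) (.lit 1)))
        (seq (set Var.top (.lit 0) (.lit 0) (.lit 1)) (set Var.cnt (.lit 0) (.lit 0) (.lit 1)))))

/-- The search in the digraph with adjacency matrix `arc`, with `3 n` steps. -/
def pathSearch (del : Bool) : LoopProgram :=
  seq pathInit (loop Var.round (seq (pathStep del) (seq (pathStep del) (pathStep del))))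

/-- The state of the search that is stored in the memory. -/
def view (n : ℕ) (σ : Store) : PathState (Fin n) where
  top := σ Var.top 0 0
  cnt := σ Var.cnt 0 0
  pos v := σ Var.pos v 0
  lab v := σ Var.lab v 0
  row i v := σ Var.row i v = 1
  arc x y := σ Var.arc x y = 1

variable {n : ℕ} {σ : Store}

theorem writes_deleteArc {del : Bool} {y : Reg} (h : (deleteArc del).Writes y) : y = Var.arc := by
  cases del
  · exact h.elim
  · exact h

theorem writes_pathStep {del : Bool} {y : Reg} (h : (pathStep del).Writes y) :
    ∃ k ≤ 9, y = .tmp k := by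
  have := @writes_deleteArc del y
  simp only [pathStep, findExit, findParent, finish, push, merge, search, Writes] at h
  by_cases hd : Writes y (deleteArc del)
  · exact ⟨0, by omega, this hd⟩
  · simp only [hd] at h
    have : y = Var.exit ∨ y = Var.i ∨ y = Var.parent ∨ y = Var.top ∨ y = Var.pos ∨ y = Var.row ∨
      y = Var.lab ∨ y = Var.cnt := by tauto
    rcases this with rfl | rfl | rfl | rfl | rfl | rfl | rfl | rfl <;>
      exact ⟨_, by omega, rfl⟩

theorem eval_onTopExpr_eq_zero {ρ : Store} {v : Expr} : (onTopExpr v).eval ρ = 0 ↔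
    ¬ (ρ Var.lab (v.eval ρ) 0 = 0 ∧ ρ Var.pos (v.eval ρ) 0 = ρ Var.top 0 0) := by
  simp [onTopExpr]
  tauto

/-- Registers that are not written keep their contents. -/
theorem sem_eq (c : LoopProgram) (y : Reg) (h : ¬ c.Writes y) (σ : Store) (k l : ℕ) :
    c.sem σ y k l = σ y k l := by
  rw [sem_of_not_writes h]

theorem view_finish (hn : σ .size 0 0 = n) (hex : ∀ v, ¬ (view n σ).Exits v) (del : Bool) :
    Step del (view n σ) (view n (finish.sem σ)) := by
  obtain ⟨h1, h2⟩ := sem_loop_cells (i := Var.i) (x := Var.lab) (by simp)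
    (c := ite (onTopExpr (scalar Var.i)) (set Var.lab (scalar Var.i) (.lit 0) (scalar Var.cnt)) skip)
    hn (by simp [Writes]) (fun a => σ Var.lab a 0 = 0 ∧ σ Var.pos a 0 = σ Var.top 0 0)
    (fun a => a) (fun _ => 0) (fun _ => σ Var.cnt 0 0) (fun _ _ h _ => h) (fun ρ a ha hi hρ hx => by
      have h1 := hρ Var.pos (by simp) (by simp)
      have h2 := hρ Var.top (by simp) (by simp)
      have h3 := hρ Var.cnt (by simp) (by simp)
      have h4 : ρ Var.lab a 0 = σ Var.lab a 0 := hx a 0 (by rintro a' ha' h; omega)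
      constructor <;> intro hp <;> simp [eval_onTopExpr_eq_zero, hi, h1, h2, h3, h4, hp])
  refine .finish hex ?_ ?_ ?_ ?_ ?_ ?_ ?_
  · simp [view, finish, Store.write_apply, sem_eq, Writes]
  · simp [view, finish, Store.write_apply, sem_eq, Writes]
  · simp [view, finish, Store.write_apply, sem_eq, Writes]
  · intro v hv
    simp only [view, finish, sem_seq, sem_set]
    rw [Store.write_of_ne _ (by simp), Store.write_of_ne _ (by simp)]
    exact h1 v v.2 hv
  · intro v hv
    simp only [view, finish, sem_seq, sem_set]
    rw [Store.write_of_ne _ (by simp), Store.write_of_ne _ (by simp)]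
    exact h2 v 0 fun a _ hp e _ => hv (by subst e; exact hp)
  · simp [view, finish, Store.write_apply, sem_eq, Writes]
  · simp [view, finish, Store.write_apply, sem_eq, Writes]

theorem view_merge (hn : σ .size 0 0 = n) {w : Fin n} (hex : (view n σ).Exits w)
    (hw : (view n σ).pos w ≠ 0) (del : Bool) : Step del (view n σ) (view n (merge.sem σ)) := by
  obtain ⟨h1, h2⟩ := sem_loop_cells (i := Var.i) (x := Var.row) (by simp)
    (c := ite (.eq (.get Var.row (scalar Var.top) (scalar Var.i)) (.lit 1))
      (set Var.row (.pred (scalar Var.top)) (scalar Var.i) (.lit 1)) skip)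
    hn (by simp [Writes]) (fun a => σ Var.row (σ Var.top 0 0) a = 1)
    (fun _ => σ Var.top 0 0 - 1) (fun a => a) (fun _ => 1) (fun _ _ _ h => h)
    (fun ρ a ha hi hρ hx => by
      have h2 := hρ Var.top (by simp) (by simp)
      have h4 : ρ Var.row (σ Var.top 0 0) a = σ Var.row (σ Var.top 0 0) a :=
        hx _ a (by rintro a' ha' h; omega)
      constructor <;> intro hp <;> simp [hi, h2, h4, hp])
  obtain ⟨g1, g2⟩ := sem_loop_cells (i := Var.i) (x := Var.pos) (by simp)
    (c := ite (onTopExpr (scalar Var.i))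
      (set Var.pos (scalar Var.i) (.lit 0) (.pred (scalar Var.top))) skip)
    (σ := (loop Var.i (ite (.eq (.get Var.row (scalar Var.top) (scalar Var.i)) (.lit 1))
      (set Var.row (.pred (scalar Var.top)) (scalar Var.i) (.lit 1)) skip)).sem σ)
    (n := n) (by rw [sem_eq _ _ (by simp [Writes]), hn])
    (by simp [Writes]) (fun a => σ Var.lab a 0 = 0 ∧ σ Var.pos a 0 = σ Var.top 0 0)
    (fun a => a) (fun _ => 0) (fun _ => σ Var.top 0 0 - 1) (fun _ _ h _ => h)
    (fun ρ a ha hi hρ hx => by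
      have h1 := hρ Var.lab (by simp) (by simp)
      have h2 := hρ Var.top (by simp) (by simp)
      have h4 := hx a 0 (by rintro a' ha' h; omega)
      rw [sem_of_not_writes (by simp [Writes])] at h1 h2 h4
      constructor <;> intro hp <;> simp [eval_onTopExpr_eq_zero, hi, h1, h2, h4, hp])
  refine .merge w hex hw ?_ ?_ ?_ ?_ ?_ ?_ ?_ ?_
  · simp [view, merge, Store.write_apply, sem_eq, Writes]
  · simp [view, merge, Store.write_apply, sem_eq, Writes]
  · intro v hv
    simp only [view, merge, sem_seq, sem_set]
    rw [Store.write_of_ne _ (by simp)]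
    exact g1 v v.2 hv
  · intro v hv
    simp only [view, merge, sem_seq, sem_set]
    rw [Store.write_of_ne _ (by simp), g2 v 0 fun a _ hp e _ => hv (by subst e; exact hp)]
    rw [sem_eq _ _ (by simp [Writes])]
  · simp [view, merge, Store.write_apply, sem_eq, Writes]
  · intro v
    simp only [view, merge, sem_seq, sem_set]
    rw [Store.write_of_ne _ (by simp), sem_of_not_writes (y := Var.row) (by simp [Writes])]
    by_cases hv : σ Var.row (σ Var.top 0 0) v = 1
    · simp [h1 v v.2 hv, hv]
    · rw [h2 _ _ fun a _ hp _ e => hv (by subst e; exact hp)]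
      simp [hv]
  · intro i hi
    funext v
    simp only [view, merge, sem_seq, sem_set]
    rw [Store.write_of_ne _ (by simp), sem_of_not_writes (y := Var.row) (by simp [Writes])]
    rw [h2 _ _ fun a _ _ e _ => hi e]
  · simp [view, merge, Store.write_apply, sem_eq, Writes]

theorem view_push (hn : σ .size 0 0 = n) {w : Fin n} (hw : σ Var.exit 0 0 = w)
    (hex : (view n σ).Exits w) (hw0 : (view n σ).pos w = 0) (del : Bool) :
    Step del (view n σ) (view n ((push del).sem σ)) := by
  set ρ := findParent.sem σ with hρ
  have hfp : ∀ y, y ≠ Var.parent → y ≠ Var.i → ρ y = σ y := fun y h1 h2 =>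
    sem_of_not_writes (by simp [findParent, search, Writes, h1, h2]) σ
  have hpar : (ρ Var.parent 0 0 < n ∧ ∀ u : Fin n, u = ρ Var.parent 0 0 →
      (view n σ).OnTop u ∧ (view n σ).arc u w) ∨ (ρ Var.parent 0 0 = n ∧
      ∀ u : Fin n, ¬ ((view n σ).OnTop u ∧ (view n σ).arc u w)) := by
    have := sem_search (r := Var.parent) (i := Var.i) (by simp) (by simp)
      (.and (onTopExpr (scalar Var.i)) (.eq (.get Var.arc (scalar Var.i) (scalar Var.exit)) (.lit 1)))
      hn (fun a => (σ Var.lab a 0 = 0 ∧ σ Var.pos a 0 = σ Var.top 0 0) ∧ σ Var.arc a w = 1)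
      (fun τ a _ hi hτ => by
        have h1 := hτ Var.pos (by simp) (by simp)
        have h2 := hτ Var.top (by simp) (by simp)
        have h3 := hτ Var.lab (by simp) (by simp)
        have h4 := hτ Var.arc (by simp) (by simp)
        have h5 := hτ Var.exit (by simp) (by simp)
        simp [eval_onTopExpr_eq_zero, hi, h1, h2, h3, h4, h5, hw])
    rcases this with ⟨h1, h2⟩ | ⟨h1, h2⟩
    · refine Or.inl ⟨h1, fun u hu => ?_⟩
      change (σ Var.lab (ρ Var.parent 0 0) 0 = 0 ∧ σ Var.pos (ρ Var.parent 0 0) 0 = σ Var.top 0 0) ∧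
        σ Var.arc (ρ Var.parent 0 0) w = 1 at h2
      rw [← hu] at h2
      exact h2
    · exact Or.inr ⟨h1, fun u => h2 u u.2⟩
  set τ := (deleteArc del).sem ρ with hτ
  have hda : ∀ y, y ≠ Var.arc → τ y = ρ y := fun y h =>
    sem_of_not_writes (fun h' => h (writes_deleteArc h')) ρ
  have harc : ∀ x y : Fin n, τ Var.arc x y = 1 ↔
      σ Var.arc x y = 1 ∧ ¬ (del = true ∧ x = w ∧ (y : ℕ) = ρ Var.parent 0 0) := by
    intro x y
    have h1 := hfp Var.arc (by simp) (by simp)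
    have h2 := hfp Var.exit (by simp) (by simp)
    cases del
    · simp [hτ, deleteArc, h1]
    · simp only [hτ, deleteArc, if_true, sem_set, Store.write_apply, eval_scalar, h2, hw, h1,
        eval_lit]
      by_cases hc : x = w ∧ (y : ℕ) = ρ Var.parent 0 0
      · simp [hc]
      · have : ¬ ((x : ℕ) = w ∧ (y : ℕ) = ρ Var.parent 0 0) := by rwa [Fin.val_inj]
        simp [hc, this]
  have hτσ : ∀ y, y ≠ Var.parent → y ≠ Var.i → y ≠ Var.arc → τ y = σ y := fun y h1 h2 h3 =>
    (hda y h3).trans (hfp y h1 h2)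
  have e1 := hτσ Var.top (by simp) (by simp) (by simp)
  have e2 := hτσ Var.exit (by simp) (by simp) (by simp)
  have e3 := hτσ Var.pos (by simp) (by simp) (by simp)
  have e4 := hτσ Var.cnt (by simp) (by simp) (by simp)
  have e5 := hτσ Var.lab (by simp) (by simp) (by simp)
  have e6 := hτσ Var.row (by simp) (by simp) (by simp)
  have e7 := hτσ Reg.size (by simp) (by simp) (by simp)
  set ω := ((τ.write Var.top 0 0 (σ Var.top 0 0 + 1)).write Var.pos w 0 (σ Var.top 0 0 + 1)) with hω
  have hsem : (push del).sem σ = (loop Var.i (set Var.row (scalar Var.top) (scalar Var.i)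
      (.get Var.arc (scalar Var.exit) (scalar Var.i)))).sem ω := by
    simp [push, ← hρ, ← hτ, hω, e1, e2, Store.write_apply, hw]
  obtain ⟨h1, h2⟩ := sem_loop_cells (i := Var.i) (x := Var.row) (by simp)
    (c := set Var.row (scalar Var.top) (scalar Var.i)
      (.get Var.arc (scalar Var.exit) (scalar Var.i)))
    (σ := ω) (n := n) (by simp [hω, Store.write_apply, e7, hn])
    (by simp [Writes]) (fun _ => True) (fun _ => σ Var.top 0 0 + 1) (fun a => a)
    (fun a => τ Var.arc w a) (fun _ _ _ h => h)
    (fun ρ' a ha hi hρ' hx => by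
      have h1 := hρ' Var.top (by simp) (by simp)
      have h2 := hρ' Var.arc (by simp) (by simp)
      have h3 := hρ' Var.exit (by simp) (by simp)
      simp [hi, h1, h2, h3, hω, Store.write_apply, e2, hw])
  rw [hsem]
  have hfr : ∀ y, y ≠ Var.row → y ≠ Var.i → y ≠ Var.top → y ≠ Var.pos → ∀ k l,
      (loop Var.i (set Var.row (scalar Var.top) (scalar Var.i)
      (.get Var.arc (scalar Var.exit) (scalar Var.i)))).sem ω y k l = τ y k l := by
    intro y h1 h2 h3 h4 k l
    rw [sem_eq _ _ (by simp [Writes, h1, h2]), hω, Store.write_of_ne _ h4, Store.write_of_ne _ h3]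
  refine .push w (if h : ρ Var.parent 0 0 < n then some ⟨_, h⟩ else none) hex hw0 ?_ ?_ ?_ ?_ ?_ ?_ ?_
    ?_ ?_ ?_
  · intro u hu
    rcases hpar with ⟨h3, h4⟩ | ⟨h3, h4⟩
    · rw [dif_pos h3, Option.some_inj] at hu
      exact h4 u (by rw [← hu])
    · simp [h3] at hu
  · intro u hu1 hu2
    rcases hpar with ⟨h3, h4⟩ | ⟨h3, h4⟩
    · simp [h3]
    · exact absurd ⟨hu1, hu2⟩ (h4 u)
  · simp [view, sem_eq, Writes, hω, Store.write_apply]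
  · simp [view, hfr, e4]
  · simp [view, sem_eq, Writes, hω, Store.write_apply]
  · intro v hv
    simp [view, sem_eq, Writes, hω, Store.write_apply, e3, Fin.val_inj, hv]
  · simp [view, hfr, e5]
  · intro v
    simp only [view]
    rw [h1 v v.2 trivial, hfr _ (by simp) (by simp) (by simp) (by simp)]
  · intro i hi
    funext v
    simp only [view]
    rw [h2 i v fun a _ _ e _ => hi e]
    simp [hω, Store.write_apply, e6]
  · intro x y
    simp only [view]
    rw [hfr _ (by simp) (by simp) (by simp) (by simp), harc]
    have : (y : ℕ) = ρ Var.parent 0 0 ↔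
        (if h : ρ Var.parent 0 0 < n then some (⟨_, h⟩ : Fin n) else none) = some y := by
      split_ifs with h
      · rw [Option.some_inj, Fin.ext_iff, eq_comm]
      · simp only [iff_false]
        have := y.2
        omega
    rw [this]

theorem view_pathStep (hn : σ .size 0 0 = n) (del : Bool) :
    Step del (view n σ) (view n ((pathStep del).sem σ)) := by
  set ρ := findExit.sem σ with hρ
  have hf : ∀ y, y ≠ Var.exit → y ≠ Var.i → ρ y = σ y := fun y h1 h2 =>
    sem_of_not_writes (by simp [findExit, search, Writes, h1, h2]) σ
  have hview : view n ρ = view n σ := by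
    simp only [view]
    rw [hf Var.top (by simp) (by simp), hf Var.cnt (by simp) (by simp), hf Var.pos (by simp) (by simp),
      hf Var.lab (by simp) (by simp), hf Var.row (by simp) (by simp), hf Var.arc (by simp) (by simp)]
  have hsize : ρ .size 0 0 = n := by rw [hf _ (by simp) (by simp), hn]
  have hspec := sem_search (r := Var.exit) (i := Var.i) (by simp) (by simp)
      (.and (.eq (.get Var.row (scalar Var.top) (scalar Var.i)) (.lit 1))
        (.and (.eq (.get Var.lab (scalar Var.i) (.lit 0)) (.lit 0))
        (.not (.eq (.get Var.pos (scalar Var.i) (.lit 0)) (scalar Var.top)))))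
      hn (fun a => σ Var.row (σ Var.top 0 0) a = 1 ∧ σ Var.lab a 0 = 0 ∧
        σ Var.pos a 0 ≠ σ Var.top 0 0)
      (fun τ a _ hi hτ => by
        have h1 := hτ Var.pos (by simp) (by simp)
        have h2 := hτ Var.top (by simp) (by simp)
        have h3 := hτ Var.lab (by simp) (by simp)
        have h4 := hτ Var.row (by simp) (by simp)
        simp [hi, h1, h2, h3, h4])
  change (ρ Var.exit 0 0 < n ∧ σ Var.row (σ Var.top 0 0) (ρ Var.exit 0 0) = 1 ∧
    σ Var.lab (ρ Var.exit 0 0) 0 = 0 ∧ σ Var.pos (ρ Var.exit 0 0) 0 ≠ σ Var.top 0 0) ∨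
    (ρ Var.exit 0 0 = n ∧ _) at hspec
  have hsem : (pathStep del).sem σ = if ρ Var.exit 0 0 < n then
      (if ρ Var.pos (ρ Var.exit 0 0) 0 = 0 then (push del).sem ρ else merge.sem ρ)
      else finish.sem ρ := by
    simp only [pathStep, sem_seq, ← hρ, sem_ite, ne_eq, eval_lt_eq_zero, eval_scalar, eval_eq_eq_zero,
      eval_get, eval_lit, hsize, not_not, not_le]
  rw [hsem, ← hview]
  rcases hspec with ⟨h1, h2⟩ | ⟨h1, h2⟩
  · rw [if_pos h1]
    have hex : (view n ρ).Exits ⟨_, h1⟩ := by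
      rw [hview]
      exact h2
    by_cases h3 : ρ Var.pos (ρ Var.exit 0 0) 0 = 0
    · rw [if_pos h3]
      exact view_push hsize (w := ⟨_, h1⟩) rfl hex h3 del
    · rw [if_neg h3]
      exact view_merge hsize hex h3 del
  · rw [if_neg (by omega)]
    refine view_finish hsize (fun v hv => ?_) del
    rw [hview] at hv
    exact h2 v v.2 hv

theorem isInitial_view_pathInit (hn : σ .size 0 0 = n) :
    (view n (pathInit.sem σ)).IsInitial fun x y : Fin n => σ Var.arc x y = 1 := by
  have h1 := fun τ : Store => fun hτ : τ .size 0 0 = n =>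
    (sem_loop_cells (i := Var.i) (x := Var.pos) (by simp)
      (c := set Var.pos (scalar Var.i) (.lit 0) (.lit 0)) hτ (by simp [Writes]) (fun _ => True)
      (fun a => a) (fun _ => 0) (fun _ => 0) (fun _ _ h _ => h)
      (fun ρ a ha hi hρ hx => by simp [hi])).1
  have h2 := fun τ : Store => fun hτ : τ .size 0 0 = n =>
    (sem_loop_cells (i := Var.i) (x := Var.lab) (by simp)
      (c := set Var.lab (scalar Var.i) (.lit 0) (.lit 0)) hτ (by simp [Writes]) (fun _ => True)
      (fun a => a) (fun _ => 0) (fun _ => 0) (fun _ _ h _ => h)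
      (fun ρ a ha hi hρ hx => by simp [hi])).1
  have h3 := fun τ : Store => fun hτ : τ .size 0 0 = n =>
    (sem_loop_cells (i := Var.i) (x := Var.row) (by simp)
      (c := set Var.row (.lit 1) (scalar Var.i) (.lit 1)) hτ (by simp [Writes]) (fun _ => True)
      (fun _ => 1) (fun a => a) (fun _ => 1) (fun _ _ _ h => h)
      (fun ρ a ha hi hρ hx => by simp [hi])).1
  refine ⟨?_, ?_, fun v => ?_, fun v => ?_, fun v => ?_, ?_⟩
  · simp [view, pathInit, Store.write_apply]
  · simp [view, pathInit, Store.write_apply]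
  · simp only [view, pathInit, sem_seq, sem_set]
    rw [Store.write_of_ne _ (by simp), Store.write_of_ne _ (by simp), sem_eq _ _ (by simp [Writes]),
      sem_eq _ _ (by simp [Writes])]
    exact h1 _ hn v v.2 trivial
  · simp only [view, pathInit, sem_seq, sem_set]
    rw [Store.write_of_ne _ (by simp), Store.write_of_ne _ (by simp), sem_eq _ _ (by simp [Writes])]
    exact h2 _ (by rw [sem_eq _ _ (by simp [Writes]), hn]) v v.2 trivial
  · simp only [view, pathInit, sem_seq, sem_set]
    rw [Store.write_of_ne _ (by simp), Store.write_of_ne _ (by simp)]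
    exact h3 _ (by simp [sem_eq, Writes, hn]) v v.2 trivial
  · simp [view, pathInit, Store.write_apply, sem_eq, Writes]

theorem writes_pathSearch {del : Bool} {y : Reg} (h : (pathSearch del).Writes y) :
    ∃ k ≤ 9, y = .tmp k := by
  rw [pathSearch, Writes] at h
  rcases h with h | h
  · simp only [pathInit, Writes] at h
    have : y = Var.i ∨ y = Var.top ∨ y = Var.pos ∨ y = Var.row ∨ y = Var.lab ∨ y = Var.cnt := by
      tauto
    rcases this with rfl | rfl | rfl | rfl | rfl | rfl <;> exact ⟨_, by omega, rfl⟩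
  · rcases h with rfl | h | h | h
    exacts [⟨_, by omega, rfl⟩, writes_pathStep h, writes_pathStep h, writes_pathStep h]

theorem not_writes_pathSearch {del : Bool} {y : Reg} (h : ∀ k ≤ 9, y ≠ .tmp k) :
    ¬ (pathSearch del).Writes y := fun h' =>
  let ⟨k, hk, e⟩ := writes_pathSearch h'
  h k hk e

/-- The program carries out enough steps of the search. -/
theorem reached_pathSearch (hn : σ .size 0 0 = n) (h0 : 0 < n) (del : Bool) :
    ∃ m, 2 * Nat.card (Fin n) + 1 ≤ m ∧ Reached del (fun x y : Fin n => σ Var.arc x y = 1) m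
      (view n ((pathSearch del).sem σ)) := by
  have hst : ∀ ρ : Store, ρ .size 0 0 = n → (pathStep del).sem ρ .size 0 0 = n := fun ρ h => by
    rw [sem_eq _ _ fun h' => ?_, h]
    obtain ⟨k, -, h⟩ := writes_pathStep h'
    cases h
  have hi : pathInit.sem σ .size 0 0 = n := by simp [pathInit, sem_eq, Writes, hn]
  have hround : ∀ (ρ : Store) k, view n (ρ.write Var.round 0 0 k) = view n ρ := fun ρ k => by
    simp [view, Store.write_apply]
  have := sem_loop_induction (x := Var.round) (σ := pathInit.sem σ)
    (c := seq (pathStep del) (seq (pathStep del) (pathStep del))) hi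
    (fun m ρ => ρ .size 0 0 = n ∧ Reached del (fun x y : Fin n => σ Var.arc x y = 1) (3 * m)
      (view n ρ)) ⟨by rw [Store.write_of_ne _ (by simp), hi], by
        rw [hround]
        exact .init (isInitial_view_pathInit hn)⟩
    (fun m ρ hm hP _ _ => by
      obtain ⟨h1, h2⟩ := hP
      rw [Store.write_of_ne _ (by simp), hround]
      simp only [sem_seq]
      have h3 := hst _ h1
      have h4 := hst _ h3
      exact ⟨hst _ h4, ((h2.step (view_pathStep h1 del)).step (view_pathStep h3 del)).step
        (view_pathStep h4 del)⟩)
  exact ⟨3 * n, by simp; omega, this.2⟩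

/-- Without deletions, the program labels the strongly connected components. -/
theorem lab_pathSearch_false (hn : σ .size 0 0 = n) (h0 : 0 < n) (x y : Fin n) :
    (pathSearch false).sem σ Var.lab x 0 = (pathSearch false).sem σ Var.lab y 0 ↔
      Relation.ReflTransGen (fun x y : Fin n => σ Var.arc x y = 1) x y ∧
        Relation.ReflTransGen (fun x y : Fin n => σ Var.arc x y = 1) y x := by
  obtain ⟨m, hm, h⟩ := reached_pathSearch hn h0 false
  exact h.lab_eq_iff_reach hm x y

/-- With deletions, the program labels the components of a symmetric graph that are not separated by
bridges. -/
theorem lab_pathSearch_true (hn : σ .size 0 0 = n) (h0 : 0 < n)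
    (hD : ∀ x y : Fin n, σ Var.arc x y = 1 → σ Var.arc y x = 1) (x y : Fin n) :
    ((pathSearch true).sem σ Var.lab x 0 = (pathSearch true).sem σ Var.lab y 0 →
      Linked (fun x y : Fin n => σ Var.arc x y = 1) x y) ∧
    (TwinlessRelated (fun x y : Fin n => σ Var.arc x y = 1) x y →
      (pathSearch true).sem σ Var.lab x 0 = (pathSearch true).sem σ Var.lab y 0) := by
  obtain ⟨m, hm, h⟩ := reached_pathSearch hn h0 true
  exact h.linked_and_related hD hm x y

theorem wellFormed_pathSearch (del : Bool) : (pathSearch del).WellFormed := by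
  cases del <;>
  simp [pathSearch, pathInit, pathStep, findExit, search, push, findParent, deleteArc, merge, finish,
    WellFormed, Writes]

theorem depth_pathSearch (del : Bool) : (pathSearch del).depth = 2 := by
  cases del <;> rfl

end LoopProgram

/-! ### Twinless strongly connected components and articulation points as programs -/

namespace LoopProgram

/-- Set up the adjacency matrix of the search; the expression `e` decides whether `(i, j)` is an
edge. -/
def fillArc (e : Expr) : LoopProgram :=
  loop Var.i (loop Var.j (ite e (set Var.arc (scalar Var.i) (scalar Var.j) (.lit 1))
    (set Var.arc (scalar Var.i) (scalar Var.j) (.lit 0))))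

/-- `i` and `j` differ from `z`. -/
def avoidExpr : Expr :=
  .and (.not (.eq (scalar Var.i) (scalar Var.z))) (.not (.eq (scalar Var.j) (scalar Var.z)))

/-- The edges of `G \ {z}`. -/
def deleteVertexExpr : Expr :=
  .and (.eq (.get .adj (scalar Var.i) (scalar Var.j)) (.lit 1)) avoidExpr

/-- The edges of `G \ {z}` between vertices with the same label, without directions. -/
def symmetrizeExpr : Expr :=
  .and (.not (.and (.not (.eq (.get .adj (scalar Var.i) (scalar Var.j)) (.lit 1)))
      (.not (.eq (.get .adj (scalar Var.j) (scalar Var.i)) (.lit 1)))))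
    (.and avoidExpr
      (.eq (.get Var.lab (scalar Var.i) (.lit 0)) (.get Var.lab (scalar Var.j) (.lit 0))))

/-- Label the twinless strongly connected components of `G \ {z}`: find the strongly connected
components, and then the bridges inside of them. -/
def components : LoopProgram :=
  seq (fillArc deleteVertexExpr) (seq (pathSearch false)
    (seq (fillArc symmetrizeExpr) (pathSearch true)))

/-- Label the components for the vertex in the register `z` of the algorithm. -/
def componentsTask : LoopProgram :=
  seq (set Var.z (.lit 0) (.lit 0) (scalar .z)) (seq components
    (loop Var.i (set .comp (scalar Var.i) (.lit 0) (.get Var.lab (scalar Var.i) (.lit 0)))))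

/-- For each vertex `z`, compare the labels of the vertices other than `z`; the marks are written to
the register `x`. -/
def articulationPoints (x : Reg) : LoopProgram :=
  loop Var.z (seq components
    (seq (search Var.first Var.i (.not (.eq (scalar Var.i) (scalar Var.z))))
      (seq (search Var.second Var.i (.and (.not (.eq (scalar Var.i) (scalar Var.z)))
          (.not (.eq (.get Var.lab (scalar Var.i) (.lit 0))
            (.get Var.lab (scalar Var.first) (.lit 0))))))
        (set x (scalar Var.z) (.lit 0) (.lt (scalar Var.second) (scalar .size))))))

/-- Test for 2-vertex-twinless-connectivity. -/
def testTask : LoopProgram :=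
  seq (articulationPoints Var.ap)
    (seq (search Var.first Var.i (.eq (.get Var.ap (scalar Var.i) (.lit 0)) (.lit 1)))
      (set .flag (.lit 0) (.lit 0)
        (.and (.lt (.lit 2) (scalar .size)) (.not (.lt (scalar Var.first) (scalar .size))))))

variable {n : ℕ} {σ : Store}

theorem sem_fillArc (hn : σ .size 0 0 = n) {e : Expr} (p : ℕ → ℕ → Prop)
    (he : ∀ ρ a b, a < n → b < n → ρ Var.i 0 0 = a → ρ Var.j 0 0 = b →
      (∀ y, y ≠ Var.i → y ≠ Var.j → y ≠ Var.arc → ρ y = σ y) → (¬ e.eval ρ = 0 ↔ p a b))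
    {a b : ℕ} (ha : a < n) (hb : b < n) : (fillArc e).sem σ Var.arc a b = 1 ↔ p a b := by
  classical
  have := (sem_loop_loop_cells (i := Var.i) (j := Var.j) (x := Var.arc) (by simp) (by simp)
    (by simp) (by simp) (by simp) (by simp)
    (c := ite e (set Var.arc (scalar Var.i) (scalar Var.j) (.lit 1))
      (set Var.arc (scalar Var.i) (scalar Var.j) (.lit 0))) hn (by simp [Writes])
    (fun _ _ => True) (fun a b => if p a b then 1 else 0) (fun ρ a b ha hb hi hj hρ => by
      have := he ρ a b ha hb hi hj hρ
      by_cases hp : p a b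
      · simp [this.2 hp, hp, hi, hj]
      · simp [not_not.1 (mt this.1 hp), hp, hi, hj])).1 a ha b hb trivial
  rw [fillArc, this]
  simp

theorem writes_fillArc {e : Expr} {y : Reg} (h : (fillArc e).Writes y) :
    ∃ k ≤ 10, y = .tmp k := by
  simp only [fillArc, Writes, or_self] at h
  rcases h with rfl | rfl | rfl <;> exact ⟨_, by omega, rfl⟩

theorem writes_components {y : Reg} (h : components.Writes y) : ∃ k ≤ 10, y = .tmp k := by
  rcases h with h | h | h | h
  · exact writes_fillArc h
  · obtain ⟨k, hk, h⟩ := writes_pathSearch h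
    exact ⟨k, by omega, h⟩
  · exact writes_fillArc h
  · obtain ⟨k, hk, h⟩ := writes_pathSearch h
    exact ⟨k, by omega, h⟩

theorem not_writes_components {y : Reg} (h : ∀ k ≤ 10, y ≠ .tmp k) : ¬ components.Writes y :=
  fun h' => let ⟨k, hk, e⟩ := writes_components h'
  h k hk e

theorem wellFormed_fillArc (e : Expr) : (fillArc e).WellFormed := by
  simp [fillArc, WellFormed, Writes]

theorem wellFormed_components : components.WellFormed :=
  ⟨wellFormed_fillArc _, wellFormed_pathSearch _, wellFormed_fillArc _, wellFormed_pathSearch _⟩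

theorem not_writes_fillArc {e : Expr} {y : Reg} (h : ∀ k ≤ 10, y ≠ .tmp k) :
    ¬ (fillArc e).Writes y :=
  fun h' => let ⟨k, hk, e⟩ := writes_fillArc h'
  h k hk e

/-- The first search finds the strongly connected components, so that the edges between vertices with the
same label are those that lie on closed walks; the second search finds the linked vertices. -/
theorem lab_components {G : Digraph (Fin n)} (hσ : HoldsDigraph σ G) {z : Fin n}
    (hz : σ Var.z 0 0 = z) {a b : Fin n} (ha : a ≠ z) (hb : b ≠ z) :
    components.sem σ Var.lab a 0 = components.sem σ Var.lab b 0 ↔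
      SameTSCC (deleteVertex G z) ⟨a, ha⟩ ⟨b, hb⟩ := by
  obtain ⟨hn, hadj⟩ := hσ
  have h0 : 0 < n := z.pos
  rw [sameTSCC_deleteVertex_iff]
  set E : Fin n → Fin n → Prop := fun x y => G.Adj x y ∧ x ≠ z ∧ y ≠ z with hE
  set σ₁ := (fillArc deleteVertexExpr).sem σ with hσ₁
  set σ₂ := (pathSearch false).sem σ₁ with hσ₂
  set σ₃ := (fillArc symmetrizeExpr).sem σ₂ with hσ₃
  have f1 : ∀ y, (∀ k ≤ 10, y ≠ .tmp k) → σ₁ y = σ y := fun y hy =>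
    sem_of_not_writes (not_writes_fillArc hy) σ
  have f2 : ∀ y, (∀ k ≤ 10, y ≠ .tmp k) → σ₂ y = σ y := fun y hy => by
    rw [← f1 y hy]
    exact sem_of_not_writes (not_writes_pathSearch fun k hk => hy k (by omega)) σ₁
  have f3 : ∀ y, (∀ k ≤ 10, y ≠ .tmp k) → σ₃ y = σ y := fun y hy => by
    rw [← f2 y hy]
    exact sem_of_not_writes (not_writes_fillArc hy) σ₂
  have e1 : (fun x y : Fin n => σ₁ Var.arc x y = 1) = E := by
    funext x y
    refine propext ?_
    rw [sem_fillArc hn (fun a b => σ .adj a b = 1 ∧ a ≠ z ∧ b ≠ z) (fun ρ a b _ _ hi hj hρ => by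
      have h1 := hρ .adj (by simp) (by simp) (by simp)
      have h2 := hρ Var.z (by simp) (by simp) (by simp)
      simp [deleteVertexExpr, avoidExpr, hi, hj, h1, h2, hz]) x.2 y.2, hadj]
    simp [hE, Fin.val_inj]
  have hlab := lab_pathSearch_false (σ := σ₁) (n := n) (by rw [f1 _ (by simp), hn]) h0
  rw [e1, ← hσ₂] at hlab
  have e3 : (fun x y : Fin n => σ₃ Var.arc x y = 1) = fun x y => core E x y ∨ core E y x := by
    funext x y
    refine propext ?_
    rw [sem_fillArc (by rw [f2 _ (by simp), hn]) (fun a b => (σ .adj a b = 1 ∨ σ .adj b a = 1) ∧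
        (a ≠ z ∧ b ≠ z) ∧ σ₂ Var.lab a 0 = σ₂ Var.lab b 0) (fun ρ a b _ _ hi hj hρ => by
      have h1 := (hρ .adj (by simp) (by simp) (by simp)).trans (f2 _ (by simp))
      have h2 := (hρ Var.z (by simp) (by simp) (by simp)).trans (f2 _ (by simp; omega))
      have h3 := hρ Var.lab (by simp) (by simp) (by simp)
      simp [symmetrizeExpr, avoidExpr, hi, hj, h1, h2, h3, hz]
      tauto) x.2 y.2, hadj, hadj, hlab]
    have hEx : ∀ {x y}, E x y → Relation.ReflTransGen E x y := fun h => .single h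
    simp only [core, ne_eq, Fin.val_inj]
    constructor
    · rintro ⟨h1 | h1, ⟨h2, h3⟩, h4, h5⟩
      exacts [Or.inl ⟨⟨h1, h2, h3⟩, h5⟩, Or.inr ⟨⟨h1, h3, h2⟩, h4⟩]
    · rintro (⟨h1, h2⟩ | ⟨h1, h2⟩)
      exacts [⟨Or.inl h1.1, h1.2, hEx h1, h2⟩, ⟨Or.inr h1.1, h1.2.symm, h2, hEx h1⟩]
  have hfin := lab_pathSearch_true (σ := σ₃) (n := n) (by rw [f3 _ (by simp), hn]) h0
    (fun x y hxy => by
      have h1 := congrFun (congrFun e3 x) y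
      have h2 := congrFun (congrFun e3 y) x
      rw [h1] at hxy
      rw [h2]
      exact hxy.symm) a b
  rw [e3, linked_symmetrize] at hfin
  change (pathSearch true).sem σ₃ Var.lab a 0 = (pathSearch true).sem σ₃ Var.lab b 0 ↔ _
  exact ⟨hfin.1, fun h =>
    hfin.2 ((twinlessRelated_iff_linked.2 h).core.mono fun _ _ => Or.inl)⟩

theorem _root_.TwinlessBlocks.IsTwinlessStronglyConnected.pos {G : Digraph (Fin n)}
    (hG : IsTwinlessStronglyConnected G) : 0 < n :=
  hG.1.some.pos

theorem holdsDigraph_of_eq {G : Digraph (Fin n)} {τ : Store} (hσ : HoldsDigraph σ G)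
    (h1 : τ .size = σ .size) (h2 : τ .adj = σ .adj) : HoldsDigraph τ G := by
  rw [HoldsDigraph, h1, h2]
  exact hσ

/-- A loop program achieves a task if its effect is as desired. -/
theorem achieves_toCmd {c : LoopProgram} (hc : c.WellFormed) {d : ℕ} (hd : c.depth ≤ d)
    {W : Set Reg} (hW : ∀ y, c.Writes y → y ∈ W ∨ ∃ k, y = .tmp k) {Q : Store → Prop}
    (hn : σ .size 0 0 = n) (h0 : 0 < n) (hQ : Q (c.sem σ)) :
    Achieves c.toCmd σ (c.coeff * n ^ d) W Q := by
  obtain ⟨t, he, ht⟩ := exec_toCmd hc hd σ (hn ▸ h0)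
  refine ⟨t, _, he, hn ▸ ht, fun x hx hx' => sem_of_not_writes (fun h => ?_) σ, hQ⟩
  rcases hW x h with h | ⟨k, h⟩
  exacts [hx h, hx' k h]

theorem findsComponents_componentsTask : FindsComponents componentsTask.toCmd := by
  refine ⟨componentsTask.coeff, fun n G hG z σ hσ hz => ?_⟩
  refine achieves_toCmd ?_ (d := 2) ?_ (fun y hy => ?_) hσ.1 hG.pos fun a b ha hb => ?_
  · exact ⟨by simp [WellFormed], wellFormed_components, by simp [WellFormed, Writes]⟩
  · simp [componentsTask, components, fillArc, depth, depth_pathSearch]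
  · rcases hy with rfl | h | rfl | rfl
    · exact Or.inr ⟨_, rfl⟩
    · obtain ⟨k, -, h⟩ := writes_components h
      exact Or.inr ⟨k, h⟩
    · exact Or.inr ⟨_, rfl⟩
    · exact Or.inl rfl
  · set σ₁ := σ.write Var.z 0 0 z with hσ₁
    have hσ' : HoldsDigraph σ₁ G := holdsDigraph_of_eq hσ (Store.write_of_ne _ (by simp) _ _ _)
      (Store.write_of_ne _ (by simp) _ _ _)
    rw [← lab_components hσ' (by simp [hσ₁, Store.write_apply]) ha hb]
    obtain ⟨h1, -⟩ := sem_loop_cells (i := Var.i) (x := .comp) (by simp)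
      (c := set .comp (scalar Var.i) (.lit 0) (.get Var.lab (scalar Var.i) (.lit 0)))
      (σ := components.sem σ₁) (n := n)
      (by rw [sem_of_not_writes (not_writes_components (by simp)), hσ'.1]) (by simp [Writes])
      (fun _ => True) (fun a => a) (fun _ => 0) (fun a => components.sem σ₁ Var.lab a 0)
      (fun _ _ h _ => h) (fun ρ a _ hi hρ _ => by
        have h1 := hρ Var.lab (by simp) (by simp)
        simp [hi, h1])
    simp only [componentsTask, sem_seq, sem_set, eval_lit, eval_scalar, hz]
    rw [h1 a a.2 trivial, h1 b b.2 trivial]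

/-- All vertices other than `z` lie in the same component of `G \ {z}` if none of them has a label different
from the first one. -/
theorem sem_articulationPoints {G : Digraph (Fin n)} (hG : IsTwinlessStronglyConnected G)
    (hσ : HoldsDigraph σ G) {x : Reg} (hx : x ≠ .size) (hx' : x ≠ .adj)
    (hx'' : ∀ k ≤ 13, x ≠ .tmp k) (a : Fin n) :
    (articulationPoints x).sem σ x a 0 = 1 ↔ IsTwinlessArticulationPoint G a := by
  have hxz : x ≠ Var.z := hx'' 11 (by omega)
  have := sem_loop_induction (x := Var.z) hσ.1 (fun m ρ => ∀ a : Fin n, (a : ℕ) < m →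
      (ρ x a 0 = 1 ↔ IsTwinlessArticulationPoint G a)) (by simp) ?_ (c := seq components
    (seq (search Var.first Var.i (.not (.eq (scalar Var.i) (scalar Var.z))))
      (seq (search Var.second Var.i (.and (.not (.eq (scalar Var.i) (scalar Var.z)))
          (.not (.eq (.get Var.lab (scalar Var.i) (.lit 0))
            (.get Var.lab (scalar Var.first) (.lit 0))))))
        (set x (scalar Var.z) (.lit 0) (.lt (scalar Var.second) (scalar .size))))))
  · exact this a a.2
  rintro m ρ hm hP hz hρ a ham
  have hρ' : HoldsDigraph ρ G := by
    refine holdsDigraph_of_eq hσ (hρ _ (by simp) ?_) (hρ _ (by simp) ?_)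
    all_goals
      have h1 : ¬ components.Writes .size := not_writes_components (by simp)
      have h2 : ¬ components.Writes .adj := not_writes_components (by simp)
      simp [Writes, search, h1, h2, hx.symm, hx'.symm]
  rw [Store.write_of_ne _ hxz]
  simp only [sem_seq, sem_set, eval_lit, eval_scalar]
  set ρ₁ := components.sem ρ with hρ₁
  have f1 : ∀ y, (∀ k ≤ 10, y ≠ .tmp k) → ρ₁ y = ρ y := fun y hy =>
    sem_of_not_writes (not_writes_components hy) ρ
  have s1 : ρ₁ .size 0 0 = n := by rw [f1 _ (by simp), hρ'.1]
  have z1 : ρ₁ Var.z 0 0 = m := by rw [f1 _ (by simp; omega), hz]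
  set ρ₂ := (search Var.first Var.i (.not (.eq (scalar Var.i) (scalar Var.z)))).sem ρ₁ with hρ₂
  have f2 : ∀ y, y ≠ Var.first → y ≠ Var.i → ρ₂ y = ρ₁ y := fun y h1 h2 =>
    sem_of_not_writes (by simp [search, Writes, h1, h2]) ρ₁
  have s2 : ρ₂ .size 0 0 = n := by rw [f2 _ (by simp) (by simp), s1]
  have z2 : ρ₂ Var.z 0 0 = m := by rw [f2 _ (by simp) (by simp), z1]
  have l2 : ρ₂ Var.lab = ρ₁ Var.lab := f2 _ (by simp) (by simp)
  have hfirst := sem_search (r := Var.first) (i := Var.i) (by simp) (by simp)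
    (.not (.eq (scalar Var.i) (scalar Var.z))) s1 (fun a => a ≠ m)
    (fun τ a _ hi hτ => by
      have h1 := hτ Var.z (by simp) (by simp)
      simp [hi, h1, z1])
  set c := Expr.and (.not (.eq (scalar Var.i) (scalar Var.z)))
          (.not (.eq (.get Var.lab (scalar Var.i) (.lit 0))
            (.get Var.lab (scalar Var.first) (.lit 0)))) with hc
  have hsecond := sem_search (r := Var.second) (i := Var.i) (by simp) (by simp)
    c s2 (fun a => a ≠ m ∧ ρ₁ Var.lab a 0 ≠ ρ₁ Var.lab (ρ₂ Var.first 0 0) 0)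
    (fun τ a _ hi hτ => by
      have h1 := hτ Var.z (by simp) (by simp)
      have h2 := hτ Var.lab (by simp) (by simp)
      have h3 := hτ Var.first (by simp) (by simp)
      simp [hc, hi, h1, h2, h3, z2, l2])
  set ρ₃ := (search Var.second Var.i c).sem ρ₂ with hρ₃
  have f3 : ∀ y, y ≠ Var.second → y ≠ Var.i → ρ₃ y = ρ₂ y := fun y h1 h2 =>
    sem_of_not_writes (by simp [search, Writes, h1, h2]) ρ₂
  have s3 : ρ₃ .size 0 0 = n := by rw [f3 _ (by simp) (by simp), s2]
  have z3 : ρ₃ Var.z 0 0 = m := by rw [f3 _ (by simp) (by simp), z2]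
  have x3 : ρ₃ x = ρ x := by
    rw [f3 _ (hx'' _ (by omega)) (hx'' _ (by omega)), f2 _ (hx'' _ (by omega)) (hx'' _ (by omega)),
      f1 _ fun k hk => hx'' k (by omega)]
  rw [Store.write_apply, z3, x3]
  by_cases ha : (a : ℕ) = m
  · rw [if_pos ⟨rfl, ha, rfl⟩, isTwinlessArticulationPoint_iff hG]
    simp only [Expr.eval, scalar, s3]
    have hza : ρ Var.z 0 0 = a := by rw [hz, ha]
    have hval : (if ρ₃ Var.second 0 0 < n then 1 else 0) = 1 ↔ ρ₃ Var.second 0 0 < n := by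
      split_ifs with h <;> simp [h]
    rw [hval]
    constructor
    · intro hlt
      rcases hsecond with ⟨-, h2, h3⟩ | ⟨h1, -⟩
      · change ρ₃ Var.second 0 0 ≠ m at h2
        change ρ₁ Var.lab (ρ₃ Var.second 0 0) 0 ≠ _ at h3
        rcases hfirst with ⟨h4, h5⟩ | ⟨-, h5⟩
        · change ρ₂ Var.first 0 0 < n at h4
          change ρ₂ Var.first 0 0 ≠ m at h5
          refine ⟨⟨_, hlt⟩, ⟨_, h4⟩, fun e => h2 ?_, fun e => h5 ?_, fun h => h3 ?_⟩
          · rw [← ha, ← e]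
          · rw [← ha, ← e]
          · exact (lab_components hρ' hza _ _).2 h
        · exact absurd h2 (h5 _ hlt)
      · exact absurd (h1 : ρ₃ Var.second 0 0 = n) hlt.ne
    · rintro ⟨u, v, hu, hv, huv⟩
      have hum : (u : ℕ) ≠ m := fun e => hu (Fin.ext (e.trans ha.symm))
      have hvm : (v : ℕ) ≠ m := fun e => hv (Fin.ext (e.trans ha.symm))
      rcases hsecond with ⟨h1, -⟩ | ⟨-, h2⟩
      · exact h1
      · refine absurd ((lab_components hρ' hza hu hv).1 ?_) huv
        have g1 := h2 u u.2
        have g2 := h2 v v.2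
        simp only [hum, hvm, ne_eq, not_false_eq_true, true_and, not_not] at g1 g2
        exact g1.trans g2.symm
  · rw [if_neg fun h => ha h.2.1]
    exact hP a (by omega)

theorem writes_articulationPoints {x y : Reg} (h : (articulationPoints x).Writes y) :
    y = x ∨ ∃ k ≤ 13, y = .tmp k := by
  simp only [articulationPoints, Writes, search] at h
  by_cases hc : components.Writes y
  · obtain ⟨k, hk, h⟩ := writes_components hc
    exact Or.inr ⟨k, by omega, h⟩
  · simp only [hc] at h
    have : y = x ∨ y = Var.z ∨ y = Var.first ∨ y = Var.second ∨ y = Var.i := by tauto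
    rcases this with rfl | rfl | rfl | rfl | rfl
    · exact Or.inl rfl
    all_goals exact Or.inr ⟨_, by omega, rfl⟩

theorem wellFormed_articulationPoints {x : Reg} (hx : x ≠ .size) (hxz : x ≠ Var.z) :
    (articulationPoints x).WellFormed := by
  have h1 := wellFormed_components
  have h2 : ¬ components.Writes Var.z := not_writes_components (by simp; omega)
  have h3 : Var.z ≠ x := hxz.symm
  simp [articulationPoints, WellFormed, Writes, search, h1, h2, h3, hx]

theorem depth_articulationPoints (x : Reg) : (articulationPoints x).depth ≤ 3 := by
  simp [articulationPoints, components, fillArc, search, depth, depth_pathSearch]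

theorem findsArticulationPoints_articulationPoints :
    FindsArticulationPoints (articulationPoints .ap).toCmd := by
  refine ⟨(articulationPoints .ap).coeff, fun n G hG σ hσ => ?_⟩
  refine achieves_toCmd (wellFormed_articulationPoints (by simp) (by simp))
    (depth_articulationPoints _) (fun y hy => ?_) hσ.1 hG.pos
    fun a => sem_articulationPoints hG hσ (by simp) (by simp) (by simp) a
  rcases writes_articulationPoints hy with rfl | ⟨k, -, rfl⟩
  exacts [Or.inl rfl, Or.inr ⟨k, rfl⟩]

theorem isTest_testTask : IsTest testTask.toCmd := by
  refine ⟨testTask.coeff, fun n G hG σ hσ => ?_⟩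
  refine achieves_toCmd ?_ (d := 3) ?_ (fun y hy => ?_) hσ.1 hG.pos ?_
  · have := wellFormed_articulationPoints (x := Var.ap) (by simp) (by simp)
    simp [testTask, WellFormed, search, Writes, this]
  · simpa [testTask, depth, search] using depth_articulationPoints Var.ap
  · rcases hy with h | h | h
    · rcases writes_articulationPoints h with rfl | ⟨k, -, rfl⟩
      exacts [Or.inr ⟨_, rfl⟩, Or.inr ⟨k, rfl⟩]
    · simp only [search, Writes, or_false] at h
      rcases h with rfl | rfl | rfl <;> exact Or.inr ⟨_, rfl⟩
    · exact Or.inl h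
  · set σ₁ := (articulationPoints Var.ap).sem σ with hσ₁
    have s1 : σ₁ .size 0 0 = n := by
      rw [hσ₁, sem_eq _ _ fun h => ?_, hσ.1]
      rcases writes_articulationPoints h with h | ⟨k, -, h⟩ <;> cases h
    have hap := sem_articulationPoints hG hσ (x := Var.ap) (by simp) (by simp)
      (by rintro k hk h; cases h; omega)
    set σ₂ := (search Var.first Var.i (.eq (.get Var.ap (scalar Var.i) (.lit 0)) (.lit 1))).sem σ₁
      with hσ₂
    have s2 : σ₂ .size 0 0 = n := by rw [hσ₂, sem_eq _ _ (by simp [search, Writes]), s1]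
    have hfirst := sem_search (r := Var.first) (i := Var.i) (by simp) (by simp)
      (.eq (.get Var.ap (scalar Var.i) (.lit 0)) (.lit 1)) s1 (fun a => σ₁ Var.ap a 0 = 1)
      (fun τ a _ hi hτ => by
        have h1 := hτ Var.ap (by simp) (by simp)
        simp [hi, h1])
    have hval : testTask.sem σ .flag 0 0 = 1 ↔ 3 ≤ n ∧ n ≤ σ₂ Var.first 0 0 := by
      simp only [testTask, sem_seq, sem_set, ← hσ₁, ← hσ₂, eval_lit]
      rw [Store.write_apply, if_pos ⟨rfl, rfl, rfl⟩]
      simp [Expr.eval, scalar, s2]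
      omega
    rw [hval, IsTwoVertexTwinlessConnected, Nat.card_eq_fintype_card, Fintype.card_fin]
    constructor
    · rintro ⟨h1, h2⟩
      refine ⟨hG, h1, fun v hv => ?_⟩
      rcases hfirst with ⟨h3, -⟩ | ⟨-, h3⟩
      · exact absurd h3 h2.not_gt
      · exact h3 v v.2 ((hap v).2 hv)
    · rintro ⟨-, h1, h2⟩
      refine ⟨h1, ?_⟩
      rcases hfirst with ⟨h3, h4⟩ | ⟨h3, -⟩
      · exact absurd ((hap ⟨_, h3⟩).1 h4) (h2 _)
      · exact (h3 : σ₂ Var.first 0 0 = n).ge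

end LoopProgram

/-! ### Blocks as a program -/

/-- `x < y` are the two least vertices of a block. -/
def IsBlockStart {n : ℕ} (H : SimpleGraph (Fin n)) (x y : Fin n) : Prop :=
  x < y ∧ Inseparable H x y ∧ ∀ u, Inseparable H u x → Inseparable H u y → u < y → u = x

theorem IsBlockStart.eq {n : ℕ} {H : SimpleGraph (Fin n)} {x y x' y' : Fin n}
    (h : IsBlockStart H x y) (h' : IsBlockStart H x' y')
    (he : {u | Inseparable H u x ∧ Inseparable H u y} =
      {u | Inseparable H u x' ∧ Inseparable H u y'}) : x = x' ∧ y = y' := by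
  obtain ⟨h1, h2, h3⟩ := h
  obtain ⟨h1', h2', h3'⟩ := h'
  have mx : Inseparable H x x' ∧ Inseparable H x y' := he.subset ⟨.refl x, h2⟩
  have my : Inseparable H y x' ∧ Inseparable H y y' := he.subset ⟨h2.symm, .refl y⟩
  have mx' : Inseparable H x' x ∧ Inseparable H x' y := he.superset ⟨.refl x', h2'⟩
  have my' : Inseparable H y' x ∧ Inseparable H y' y := he.superset ⟨h2'.symm, .refl y'⟩
  have e1 := h3 x' mx'.1 mx'.2
  have e2 := h3 y' my'.1 my'.2
  have e3 := h3' x mx.1 mx.2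
  have e4 := h3' y my.1 my.2
  simp only [Fin.ext_iff, Fin.lt_def] at *
  omega

/-- Every block with at least two vertices is determined by its two least vertices. -/
theorem exists_isBlockStart_iff {n : ℕ} (H : SimpleGraph (Fin n)) (B : Set (Fin n)) :
    (∃ x y, IsBlockStart H x y ∧ B = {u | Inseparable H u x ∧ Inseparable H u y}) ↔
      IsBlock H B ∧ B.Nontrivial := by
  rw [isBlock_and_nontrivial_iff]
  constructor
  · rintro ⟨x, y, ⟨h1, h2, -⟩, rfl⟩
    exact maximal_common h1.ne h2
  · intro hB
    obtain ⟨x, hx, hxm⟩ := wellFounded_lt.has_min B hB.1.1.nonempty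
    obtain ⟨y, hy, hym⟩ := wellFounded_lt.has_min (B \ {x})
      (let ⟨y, hy, hne⟩ := hB.1.1.exists_ne x; ⟨y, hy, hne⟩)
    have hxy : x ≠ y := fun e => hy.2 e.symm
    have he := eq_common_of_maximal hB hx hy.1 hxy
    refine ⟨x, y, ⟨lt_of_le_of_ne (not_lt.1 (hxm y hy.1)) hxy, hB.1.inseparable hx hy.1,
      fun u hu hu' huy => ?_⟩, he⟩
    by_contra hux
    have huB : u ∈ B := by
      rw [he]
      exact ⟨hu, hu'⟩
    exact hym u ⟨huB, hux⟩ huy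

namespace LoopProgram

/-- The edges of the undirected graph that avoid `z`. -/
def avoidEdgeExpr : Expr :=
  .and (.eq (.get .Eb (scalar Var.i) (scalar Var.j)) (.lit 1))
    (.and avoidExpr (.not (.eq (scalar Var.i) (scalar Var.j))))

/-- Mark the pairs of vertices that the deletion of `z` separates. Nothing is deleted if `z` is the
number of vertices. -/
def separate : LoopProgram :=
  seq (fillArc avoidEdgeExpr) (seq (pathSearch false)
    (loop Var.i (loop Var.j (ite (.and avoidExpr
        (.not (.eq (.get Var.lab (scalar Var.i) (.lit 0)) (.get Var.lab (scalar Var.j) (.lit 0)))))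
      (set Var.sep (scalar Var.i) (scalar Var.j) (.lit 1)) skip))))

/-- Mark the separable pairs of vertices. -/
def separateAll : LoopProgram :=
  seq (loop Var.i (loop Var.j (set Var.sep (scalar Var.i) (scalar Var.j) (.lit 0))))
    (seq (loop Var.z separate) (seq (set Var.z (.lit 0) (.lit 0) (scalar .size)) separate))

/-- The vertex `i` is inseparable from `x` and `y`. -/
def commonExpr : Expr :=
  .and (.eq (.get Var.sep (scalar Var.i) (scalar Var.x)) (.lit 0))
    (.eq (.get Var.sep (scalar Var.i) (scalar Var.y)) (.lit 0))

/-- Output the set of the vertices that are inseparable from `x` and `y`. -/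
def emit : LoopProgram :=
  seq (loop Var.i (ite commonExpr (set .out (scalar .outCount) (scalar Var.i) (.lit 1))
      (set .out (scalar .outCount) (scalar Var.i) (.lit 0))))
    (set .outCount (.lit 0) (.lit 0) (.succ (scalar .outCount)))

/-- Output the block of `x` and `y` if these are its two least vertices. -/
def emitIfStart : LoopProgram :=
  ite (.and (.lt (scalar Var.x) (scalar Var.y))
      (.eq (.get Var.sep (scalar Var.x) (scalar Var.y)) (.lit 0)))
    (seq (search Var.first Var.i (.and commonExpr
        (.and (.lt (scalar Var.i) (scalar Var.y)) (.not (.eq (scalar Var.i) (scalar Var.x))))))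
      (ite (.lt (scalar Var.first) (scalar .size)) skip emit))
    skip

/-- Output the blocks with at least two vertices. -/
def blocksTask : LoopProgram :=
  seq separateAll (seq (set .outCount (.lit 0) (.lit 0) (.lit 0))
    (loop Var.x (loop Var.y emitIfStart)))

variable {n : ℕ} {σ : Store}

theorem writes_separate {y : Reg} (h : separate.Writes y) :
    y = Var.sep ∨ ∃ k ≤ 10, y = .tmp k := by
  rcases h with h | h | h
  · exact Or.inr (writes_fillArc h)
  · obtain ⟨k, hk, h⟩ := writes_pathSearch h
    exact Or.inr ⟨k, by omega, h⟩
  · simp only [Writes, or_false] at h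
    rcases h with rfl | rfl | rfl
    exacts [Or.inr ⟨_, by omega, rfl⟩, Or.inr ⟨_, by omega, rfl⟩, Or.inl rfl]

theorem not_writes_separate {y : Reg} (h : y ≠ Var.sep) (h' : ∀ k ≤ 10, y ≠ .tmp k) :
    ¬ separate.Writes y := fun hw => by
  rcases writes_separate hw with e | ⟨k, hk, e⟩
  exacts [h e, h' k hk e]

theorem wellFormed_separate : separate.WellFormed := by
  refine ⟨wellFormed_fillArc _, wellFormed_pathSearch _, ?_⟩
  simp [WellFormed, Writes]

theorem sem_separate {H : SimpleGraph (Fin n)} (hσ : HoldsGraph σ H) (h0 : 0 < n) {w : ℕ}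
    (hw : σ Var.z 0 0 = w) (a b : Fin n) :
    separate.sem σ Var.sep a b = 0 ↔ σ Var.sep a b = 0 ∧ ((a : ℕ) ≠ w → (b : ℕ) ≠ w →
      Relation.ReflTransGen (fun x y : Fin n => H.Adj x y ∧ (x : ℕ) ≠ w ∧ (y : ℕ) ≠ w) a b) := by
  obtain ⟨hn, hadj⟩ := hσ
  set σ₁ := (fillArc avoidEdgeExpr).sem σ with hσ₁
  set σ₂ := (pathSearch false).sem σ₁ with hσ₂
  have f1 : ∀ y, (∀ k ≤ 10, y ≠ .tmp k) → σ₁ y = σ y := fun y hy =>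
    sem_of_not_writes (not_writes_fillArc hy) σ
  have f2 : ∀ y, (∀ k ≤ 10, y ≠ .tmp k) → σ₂ y = σ y := fun y hy => by
    rw [← f1 y hy]
    exact sem_of_not_writes (not_writes_pathSearch fun k hk => hy k (by omega)) σ₁
  have e1 : (fun x y : Fin n => σ₁ Var.arc x y = 1) =
      fun x y => H.Adj x y ∧ (x : ℕ) ≠ w ∧ (y : ℕ) ≠ w := by
    funext x y
    refine propext ?_
    rw [sem_fillArc hn (fun a b => σ .Eb a b = 1 ∧ (a ≠ w ∧ b ≠ w) ∧ a ≠ b)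
      (fun ρ a b _ _ hi hj hρ => by
        have h1 := hρ .Eb (by simp) (by simp) (by simp)
        have h2 := hρ Var.z (by simp) (by simp) (by simp)
        simp [avoidEdgeExpr, avoidExpr, hi, hj, h1, h2, hw]) x.2 y.2]
    constructor
    · rintro ⟨h1, h2, h3⟩
      exact ⟨(hadj x y fun e => h3 (congrArg _ e)).1 h1, h2⟩
    · rintro ⟨h1, h2⟩
      exact ⟨(hadj x y h1.ne).2 h1, h2, fun e => h1.ne (Fin.ext e)⟩
  have hlab := lab_pathSearch_false (σ := σ₁) (n := n) (by rw [f1 _ (by simp), hn]) h0 a b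
  rw [e1, ← hσ₂] at hlab
  have hsymm : ∀ {x y : Fin n}, Relation.ReflTransGen
      (fun x y : Fin n => H.Adj x y ∧ (x : ℕ) ≠ w ∧ (y : ℕ) ≠ w) x y →
      Relation.ReflTransGen (fun x y : Fin n => H.Adj x y ∧ (x : ℕ) ≠ w ∧ (y : ℕ) ≠ w) y x :=
    fun h => reach_symm (fun _ _ h => ⟨h.1.symm, h.2.2, h.2.1⟩) h
  obtain ⟨h1, h2⟩ := sem_loop_loop_cells (i := Var.i) (j := Var.j) (x := Var.sep) (by simp) (by simp)
    (by simp) (by simp) (by simp) (by simp) (σ := σ₂) (n := n)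
    (c := ite (.and avoidExpr (.not (.eq (.get Var.lab (scalar Var.i) (.lit 0))
      (.get Var.lab (scalar Var.j) (.lit 0)))))
      (set Var.sep (scalar Var.i) (scalar Var.j) (.lit 1)) skip) (by rw [f2 _ (by simp), hn])
    (by simp [Writes]) (fun a b => (a ≠ w ∧ b ≠ w) ∧ σ₂ Var.lab a 0 ≠ σ₂ Var.lab b 0) (fun _ _ => 1)
    (fun ρ a b _ _ hi hj hρ => by
      have h1 := hρ Var.lab (by simp) (by simp) (by simp)
      have h2 := (hρ Var.z (by simp) (by simp) (by simp)).trans (f2 _ (by simp; omega))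
      constructor
      · rintro ⟨⟨g1, g2⟩, g3⟩
        simp [avoidExpr, hi, hj, h1, h2, hw, g1, g2, g3]
      · intro hp
        have : ¬ ((¬ a = w ∧ ¬ b = w) ∧ ¬ σ₂ Var.lab a 0 = σ₂ Var.lab b 0) := hp
        rw [sem_ite, if_neg]
        · simp
        · simp only [avoidExpr, ne_eq, eval_and_eq_zero, eval_not_eq_zero, eval_eq_eq_zero,
            eval_scalar, eval_get, eval_lit, hi, hj, h1, h2, hw]
          tauto)
  change (loop Var.i (loop Var.j _)).sem σ₂ Var.sep a b = 0 ↔ _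
  by_cases hp : ((a : ℕ) ≠ w ∧ (b : ℕ) ≠ w) ∧ σ₂ Var.lab a 0 ≠ σ₂ Var.lab b 0
  · rw [h1 a a.2 b b.2 hp]
    constructor
    · intro h
      cases h
    · rintro ⟨-, h⟩
      have := h hp.1.1 hp.1.2
      exact absurd (hlab.2 ⟨this, hsymm this⟩) hp.2
  · rw [h2 a b fun _ _ => hp, f2 _ (by simp; omega)]
    refine ⟨fun h => ⟨h, fun ha hb => ?_⟩, fun h => h.1⟩
    by_contra hr
    exact hp ⟨⟨ha, hb⟩, fun e => hr (hlab.1 e).1⟩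

theorem writes_separateAll {y : Reg} (h : separateAll.Writes y) : ∃ k ≤ 15, y = .tmp k := by
  have := @writes_separate y
  simp only [separateAll, Writes] at h
  by_cases hs : separate.Writes y
  · rcases this hs with rfl | ⟨k, hk, e⟩
    exacts [⟨_, le_rfl, rfl⟩, ⟨k, by omega, e⟩]
  · simp only [hs, or_false] at h
    have : y = Var.i ∨ y = Var.j ∨ y = Var.sep ∨ y = Var.z := by tauto
    rcases this with rfl | rfl | rfl | rfl <;> exact ⟨_, by omega, rfl⟩

theorem holdsGraph_of_eq {H : SimpleGraph (Fin n)} {τ : Store} (hσ : HoldsGraph σ H)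
    (h1 : τ .size = σ .size) (h2 : τ .Eb = σ .Eb) : HoldsGraph τ H := by
  rw [HoldsGraph, h1, h2]
  exact hσ

/-- The rounds for `z < n` test the deletion of each vertex, and the last one, for `z = n`, tests
connectedness. -/
theorem sem_separateAll {H : SimpleGraph (Fin n)} (hσ : HoldsGraph σ H) (h0 : 0 < n)
    (a b : Fin n) : separateAll.sem σ Var.sep a b = 0 ↔ Inseparable H a b := by
  set σ₁ := (loop Var.i (loop Var.j
    (set Var.sep (scalar Var.i) (scalar Var.j) (.lit 0)))).sem σ with hσ₁
  have hz : ∀ a b : Fin n, σ₁ Var.sep a b = 0 := fun a b =>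
    (sem_loop_loop_cells (i := Var.i) (j := Var.j) (x := Var.sep) (by simp) (by simp)
      (by simp) (by simp) (by simp) (by simp)
      (c := set Var.sep (scalar Var.i) (scalar Var.j) (.lit 0)) hσ.1 (by simp [Writes])
      (fun _ _ => True) (fun _ _ => 0) (fun ρ a b _ _ hi hj _ => by simp [hi, hj])).1
      a a.2 b b.2 trivial
  have hσ₁' : HoldsGraph σ₁ H := holdsGraph_of_eq hσ (sem_of_not_writes (by simp [Writes]) σ)
    (sem_of_not_writes (by simp [Writes]) σ)
  have hP := sem_loop_induction (x := Var.z) (c := separate) hσ₁'.1 (fun m ρ => HoldsGraph ρ H ∧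
      ∀ a b : Fin n, ρ Var.sep a b = 0 ↔ ∀ w < m, (a : ℕ) ≠ w → (b : ℕ) ≠ w →
        Relation.ReflTransGen (fun x y : Fin n => H.Adj x y ∧ (x : ℕ) ≠ w ∧ (y : ℕ) ≠ w) a b)
    ⟨holdsGraph_of_eq hσ₁' (Store.write_of_ne _ (by simp) _ _ _)
      (Store.write_of_ne _ (by simp) _ _ _), fun a b => by simp [Store.write_apply, hz]⟩
    (fun m ρ hm hP hzm _ => by
      obtain ⟨g1, g2⟩ := hP
      refine ⟨holdsGraph_of_eq g1 ?_ ?_, fun a b => ?_⟩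
      · rw [Store.write_of_ne _ (by simp), sem_of_not_writes (not_writes_separate (by simp) (by simp))]
      · rw [Store.write_of_ne _ (by simp), sem_of_not_writes (not_writes_separate (by simp) (by simp))]
      · rw [Store.write_of_ne _ (by simp), sem_separate g1 h0 hzm, g2]
        constructor
        · rintro ⟨k1, k2⟩ w hw
          rcases Nat.lt_succ_iff_lt_or_eq.1 hw with h | rfl
          exacts [k1 w h, k2]
        · exact fun h => ⟨fun w hw => h w (by omega), h m (by omega)⟩)
  set σ₂ := (loop Var.z separate).sem σ₁ with hσ₂
  obtain ⟨hP1, hP2⟩ := hP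
  have hsem : separateAll.sem σ = separate.sem (σ₂.write Var.z 0 0 n) := by
    simp only [separateAll, sem_seq, sem_set, ← hσ₁, ← hσ₂, eval_lit, eval_scalar, hP1.1]
  have hσ₃ : HoldsGraph (σ₂.write Var.z 0 0 n) H := holdsGraph_of_eq hP1
    (Store.write_of_ne _ (by simp) _ _ _) (Store.write_of_ne _ (by simp) _ _ _)
  rw [hsem, sem_separate hσ₃ h0 (w := n) (by simp [Store.write_apply]),
    Store.write_of_ne _ (by simp), hP2]
  have hn : (fun x y : Fin n => H.Adj x y ∧ (x : ℕ) ≠ n ∧ (y : ℕ) ≠ n) = H.Adj := by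
    funext x y
    have h1 := x.2.ne
    have h2 := y.2.ne
    simp [h1, h2]
  rw [hn, ← SimpleGraph.reachable_iff_reflTransGen]
  have hw : ∀ w : Fin n, (fun x y : Fin n => H.Adj x y ∧ (x : ℕ) ≠ w ∧ (y : ℕ) ≠ w) = avoid H w := by
    intro w
    funext x y
    simp [avoid, Fin.val_inj]
  constructor
  · rintro ⟨h1, h2⟩
    refine ⟨h2 a.2.ne b.2.ne, fun w ha hb => ?_⟩
    rw [← hw]
    exact h1 w w.2 (fun e => ha (Fin.ext e)) (fun e => hb (Fin.ext e))
  · rintro ⟨h1, h2⟩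
    refine ⟨fun w hwn ha hb => ?_, fun _ _ => h1⟩
    have := h2 ⟨w, hwn⟩ (fun e => ha (congrArg Fin.val e)) (fun e => hb (congrArg Fin.val e))
    rw [← hw] at this
    exact this

theorem outputs_of_eq {τ : Store} {F : Set (Set (Fin n))} (hσ : Outputs σ F)
    (h1 : τ .out = σ .out) (h2 : τ .outCount = σ .outCount) : Outputs τ F := by
  rw [Outputs, h1, h2]
  exact hσ

/-- Appending one more set to the output. -/
theorem outputs_insert {τ : Store} {F : Set (Set (Fin n))} {B : Set (Fin n)} (hσ : Outputs σ F)
    (hB : B ∉ F) (hcnt : τ .outCount 0 0 = σ .outCount 0 0 + 1)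
    (hold : ∀ i < σ .outCount 0 0, ∀ a : Fin n, τ .out i a = σ .out i a)
    (hnew : ∀ a : Fin n, τ .out (σ .outCount 0 0) a = 1 ↔ a ∈ B) : Outputs τ (insert B F) := by
  have hIio : Set.Iio (τ .outCount 0 0) =
      insert (σ .outCount 0 0) (Set.Iio (σ .outCount 0 0)) := by
    rw [hcnt]
    ext i
    simp only [Set.mem_Iio, Set.mem_insert_iff]
    omega
  have hBe : {a : Fin n | τ .out (σ .outCount 0 0) a = 1} = B := Set.ext hnew
  have hbij : Set.BijOn (fun i : ℕ => {a : Fin n | τ .out i a = 1}) (Set.Iio (σ .outCount 0 0)) F :=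
    hσ.congr fun i hi => by
      ext a
      simp only [Set.mem_ofPred_eq, hold i hi a]
  rw [Outputs, hIio]
  have := hbij.insert (a := σ .outCount 0 0) (by rw [hBe]; exact hB)
  rwa [hBe] at this

theorem writes_emitIfStart {y : Reg} (h : emitIfStart.Writes y) :
    y = .outCount ∨ y = .out ∨ y = Var.first ∨ y = Var.i := by
  simp only [emitIfStart, emit, search, Writes] at h
  tauto

theorem sem_emit {H : SimpleGraph (Fin n)} (hn : σ .size 0 0 = n)
    (hsep : ∀ a b : Fin n, σ Var.sep a b = 0 ↔ Inseparable H a b) {x y : Fin n}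
    (hx : σ Var.x 0 0 = x) (hy : σ Var.y 0 0 = y) {F : Set (Set (Fin n))} (hF : Outputs σ F)
    (hB : {u | Inseparable H u x ∧ Inseparable H u y} ∉ F) :
    Outputs (emit.sem σ) (insert {u | Inseparable H u x ∧ Inseparable H u y} F) := by
  classical
  obtain ⟨h1, h2⟩ := sem_loop_cells (i := Var.i) (x := .out) (by simp)
    (c := ite commonExpr (set .out (scalar .outCount) (scalar Var.i) (.lit 1))
      (set .out (scalar .outCount) (scalar Var.i) (.lit 0))) hn (by simp [Writes])
    (fun _ => True) (fun _ => σ .outCount 0 0) (fun a => a)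
    (fun a => if σ Var.sep a x = 0 ∧ σ Var.sep a y = 0 then 1 else 0) (fun _ _ _ h => h)
    (fun ρ a _ hi hρ _ => by
      have h1 := hρ Var.sep (by simp) (by simp)
      have h2 := hρ Var.x (by simp) (by simp)
      have h3 := hρ Var.y (by simp) (by simp)
      have h4 := hρ .outCount (by simp) (by simp)
      by_cases hp : σ Var.sep a x = 0 ∧ σ Var.sep a y = 0
      · simp [commonExpr, hi, h1, h2, h3, h4, hx, hy, hp]
      · have hne : ¬ commonExpr.eval ρ ≠ 0 := by
          simp only [commonExpr, ne_eq, eval_and_eq_zero, eval_eq_eq_zero, eval_get, eval_scalar,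
            eval_lit, hi, h1, h2, h3, hx, hy]
          tauto
        rw [sem_ite, if_neg hne]
        simp [hi, h4, hp])
  refine outputs_insert hF hB ?_ (fun i hi a => ?_) fun a => ?_
  · simp [emit, Store.write_apply, sem_eq, Writes]
  · simp only [emit, sem_seq, sem_set]
    rw [Store.write_of_ne _ (by simp), h2 i a fun _ _ _ e => absurd e hi.ne]
  · simp only [emit, sem_seq, sem_set]
    rw [Store.write_of_ne _ (by simp), h1 a a.2 trivial]
    simp [hsep]

theorem sem_emitIfStart {H : SimpleGraph (Fin n)} (hn : σ .size 0 0 = n)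
    (hsep : ∀ a b : Fin n, σ Var.sep a b = 0 ↔ Inseparable H a b) {x y : Fin n}
    (hx : σ Var.x 0 0 = x) (hy : σ Var.y 0 0 = y) {F : Set (Set (Fin n))} (hF : Outputs σ F) :
    (¬ IsBlockStart H x y → Outputs (emitIfStart.sem σ) F) ∧
      (IsBlockStart H x y → {u | Inseparable H u x ∧ Inseparable H u y} ∉ F →
        Outputs (emitIfStart.sem σ) (insert {u | Inseparable H u x ∧ Inseparable H u y} F)) := by
  rw [emitIfStart, sem_ite]
  by_cases hc : x < y ∧ Inseparable H x y
  · rw [if_pos (by simpa [hx, hy, hsep] using hc)]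
    set b := Expr.and commonExpr
        (.and (.lt (scalar Var.i) (scalar Var.y)) (.not (.eq (scalar Var.i) (scalar Var.x)))) with hb
    have hspec := sem_search (r := Var.first) (i := Var.i) (by simp) (by simp) b hn
      (fun a => (σ Var.sep a x = 0 ∧ σ Var.sep a y = 0) ∧ a < y ∧ a ≠ x) (fun τ a _ hi hτ => by
        have h1 := hτ Var.sep (by simp) (by simp)
        have h2 := hτ Var.x (by simp) (by simp)
        have h3 := hτ Var.y (by simp) (by simp)
        simp [hb, commonExpr, hi, h1, h2, h3, hx, hy])
    set τ := (search Var.first Var.i b).sem σ with hτ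
    have hf : ∀ y, y ≠ Var.first → y ≠ Var.i → τ y = σ y := fun y h1 h2 =>
      sem_of_not_writes (by simp [search, Writes, h1, h2]) σ
    have hτF : Outputs τ F := outputs_of_eq hF (hf _ (by simp) (by simp)) (hf _ (by simp) (by simp))
    have hτn : τ .size 0 0 = n := by rw [hf _ (by simp) (by simp), hn]
    rw [sem_seq, ← hτ, sem_ite]
    rcases hspec with ⟨h1, h2⟩ | ⟨h1, h2⟩
    · rw [if_pos (by simpa [hτn] using h1)]
      refine ⟨fun _ => hτF, fun hs => absurd hs ?_⟩
      rintro ⟨-, -, hs⟩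
      obtain ⟨⟨h3, h4⟩, h5, h6⟩ := h2
      exact h6 (congrArg Fin.val
        (hs ⟨_, h1⟩ ((hsep ⟨_, h1⟩ x).1 h3) ((hsep ⟨_, h1⟩ y).1 h4) h5))
    · rw [if_neg (by simp [hτn, h1])]
      refine ⟨fun hs => absurd ⟨hc.1, hc.2, fun u hux huy hlt => ?_⟩ hs, fun _ hB =>
        sem_emit hτn (by rwa [hf _ (by simp) (by simp)]) (by rwa [hf _ (by simp) (by simp)])
          (by rwa [hf _ (by simp) (by simp)]) hτF hB⟩
      by_contra hne
      exact h2 u u.2 ⟨⟨(hsep u x).2 hux, (hsep u y).2 huy⟩, hlt, fun e => hne (Fin.ext e)⟩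
  · rw [if_neg fun h => hc (by simpa [hx, hy, hsep] using h)]
    exact ⟨fun _ => hF, fun hs => absurd ⟨hs.1, hs.2.1⟩ hc⟩

/-- The blocks whose two least vertices `(x, y)` precede `(k, l)` in the lexicographic order. -/
def blocksBefore (H : SimpleGraph (Fin n)) (k l : ℕ) : Set (Set (Fin n)) :=
  {B | ∃ x y : Fin n, ((x : ℕ) < k ∨ (x : ℕ) = k ∧ (y : ℕ) < l) ∧ IsBlockStart H x y ∧
    B = {u | Inseparable H u x ∧ Inseparable H u y}}

theorem sem_blocksTask {H : SimpleGraph (Fin n)} (hσ : HoldsGraph σ H) (h0 : 0 < n) :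
    Outputs (blocksTask.sem σ) {B | IsBlock H B ∧ B.Nontrivial} := by
  set σ₁ := separateAll.sem σ with hσ₁
  set σ₂ := σ₁.write .outCount 0 0 0 with hσ₂
  have hn : σ₂ .size 0 0 = n := by
    rw [hσ₂, Store.write_of_ne _ (by simp), hσ₁, sem_eq _ _ fun h => ?_, hσ.1]
    obtain ⟨k, -, h⟩ := writes_separateAll h
    cases h
  have hsep : ∀ a b : Fin n, σ₂ Var.sep a b = 0 ↔ Inseparable H a b := fun a b => by
    rw [hσ₂, Store.write_of_ne _ (by simp)]
    exact sem_separateAll hσ h0 a b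
  have hxy : ∀ {ρ : Store} {F : Set (Set (Fin n))} {r : Reg} {k : ℕ}, Outputs ρ F → r ≠ .out →
      r ≠ .outCount → Outputs (ρ.write r 0 0 k) F := fun h h1 h2 =>
    outputs_of_eq h (Store.write_of_ne _ h1.symm _ _ _) (Store.write_of_ne _ h2.symm _ _ _)
  have houter := sem_loop_induction (x := Var.x) (c := loop Var.y emitIfStart) hn
    (fun m ρ => Outputs ρ (blocksBefore H m 0)) (hxy (by
      have hem : blocksBefore H 0 0 = ∅ := by
        ext B
        simp [blocksBefore]
      rw [hem, Outputs, hσ₂, Store.write_apply, if_pos ⟨rfl, rfl, rfl⟩]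
      have : Set.Iio 0 = (∅ : Set ℕ) := by
        ext
        simp
      rw [this]
      exact Set.bijOn_empty _) (by simp) (by simp)) ?_
  · have hall : blocksBefore H n 0 = {B | IsBlock H B ∧ B.Nontrivial} := by
      ext B
      rw [Set.mem_ofPred_eq, ← exists_isBlockStart_iff]
      simp [blocksBefore]
    rw [hall] at houter
    exact houter
  intro m ρ hm hP hxm hρ
  have hwr : ∀ y, emitIfStart.Writes y → y = .outCount ∨ y = .out ∨ y = Var.first ∨ y = Var.i :=
    fun y => writes_emitIfStart
  have hnw : ∀ y, y ≠ .outCount → y ≠ .out → y ≠ Var.first → y ≠ Var.i → ¬ emitIfStart.Writes y :=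
    fun y h1 h2 h3 h4 h => by
      have := hwr y h
      tauto
  have hn' : ρ .size 0 0 = n := by
    rw [hρ _ (by simp) (not_or.2 ⟨by simp, hnw _ (by simp) (by simp) (by simp) (by simp)⟩), hn]
  have hsep' : ρ Var.sep = σ₂ Var.sep :=
    hρ _ (by simp) (not_or.2 ⟨by simp, hnw _ (by simp) (by simp) (by simp) (by simp)⟩)
  have hinner := sem_loop_induction (x := Var.y) (c := emitIfStart) hn'
    (fun k τ => Outputs τ (blocksBefore H m k)) (hxy hP (by simp) (by simp)) ?_
  · have hnext : blocksBefore H (m + 1) 0 = blocksBefore H m n := by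
      ext B
      simp [blocksBefore, le_iff_lt_or_eq]
    rw [hnext]
    exact hxy hinner (by simp) (by simp)
  intro k τ hk hPk hyk hτ
  have hnk : τ .size 0 0 = n := by
    rw [hτ _ (by simp) (hnw _ (by simp) (by simp) (by simp) (by simp)), hn']
  have hxk : τ Var.x 0 0 = m := by
    rw [hτ _ (by simp) (hnw _ (by simp) (by simp) (by simp) (by simp)), hxm]
  have hsk : ∀ a b : Fin n, τ Var.sep a b = 0 ↔ Inseparable H a b := by
    rwa [hτ _ (by simp) (hnw _ (by simp) (by simp) (by simp) (by simp)), hsep']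
  obtain ⟨h1, h2⟩ := sem_emitIfStart hnk hsk (x := ⟨m, hm⟩) (y := ⟨k, hk⟩) hxk hyk hPk
  refine hxy ?_ (by simp) (by simp)
  by_cases hs : IsBlockStart H ⟨m, hm⟩ ⟨k, hk⟩
  · have hins : blocksBefore H m (k + 1) = insert
        {u | Inseparable H u ⟨m, hm⟩ ∧ Inseparable H u ⟨k, hk⟩} (blocksBefore H m k) := by
      ext B
      constructor
      · rintro ⟨x, y, hlt, hxy, rfl⟩
        by_cases he : (x : ℕ) = m ∧ (y : ℕ) = k
        · obtain rfl : x = ⟨m, hm⟩ := Fin.ext he.1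
          obtain rfl : y = ⟨k, hk⟩ := Fin.ext he.2
          exact Set.mem_insert _ _
        · exact Set.mem_insert_of_mem _ ⟨x, y, by omega, hxy, rfl⟩
      · rintro (rfl | ⟨x, y, hlt, hxy, rfl⟩)
        · exact ⟨⟨m, hm⟩, ⟨k, hk⟩, Or.inr ⟨rfl, by simp⟩, hs, rfl⟩
        · exact ⟨x, y, by omega, hxy, rfl⟩
    rw [hins]
    refine h2 hs ?_
    rintro ⟨x, y, hlt, hxy, he⟩
    obtain ⟨e1, e2⟩ := hs.eq hxy he
    rw [← e1, ← e2] at hlt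
    simp at hlt
  · have hsame : blocksBefore H m (k + 1) = blocksBefore H m k := by
      ext B
      constructor
      · rintro ⟨x, y, hlt, hxy, rfl⟩
        refine ⟨x, y, ?_, hxy, rfl⟩
        by_contra hc
        have ex : x = ⟨m, hm⟩ := Fin.ext (by simp; omega)
        have ey : y = ⟨k, hk⟩ := Fin.ext (by simp; omega)
        rw [ex, ey] at hxy
        exact hs hxy
      · rintro ⟨x, y, hlt, hxy, rfl⟩
        exact ⟨x, y, by omega, hxy, rfl⟩
    rw [hsame]
    exact h1 hs

theorem findsBlocks_blocksTask : FindsBlocks blocksTask.toCmd := by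
  refine ⟨blocksTask.coeff, fun n H h0 σ hσ => ?_⟩
  have hw := wellFormed_separate
  have hz : ¬ separate.Writes Var.z := not_writes_separate (by simp) (by simp; omega)
  refine achieves_toCmd ?_ (d := 3) ?_ (fun y hy => ?_) hσ.1 h0 (sem_blocksTask hσ h0)
  · refine ⟨?_, ?_, ?_⟩
    · simp [separateAll, WellFormed, Writes, hw, hz]
    · simp [WellFormed]
    · simp [WellFormed, Writes, emitIfStart, emit, search]
  · simp [blocksTask, separateAll, separate, emitIfStart, emit, fillArc, search, depth,
      depth_pathSearch]
  · rcases hy with h | h | rfl | rfl | h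
    · obtain ⟨k, -, h⟩ := writes_separateAll h
      exact Or.inr ⟨k, h⟩
    · exact Or.inl (Or.inl h)
    · exact Or.inr ⟨_, rfl⟩
    · exact Or.inr ⟨_, rfl⟩
    · rcases writes_emitIfStart h with rfl | rfl | rfl | rfl
      exacts [Or.inl (Or.inl rfl), Or.inl (Or.inr rfl), Or.inr ⟨_, rfl⟩, Or.inr ⟨_, rfl⟩]

end LoopProgram

/-- There are correct subroutines within the required time bounds. -/
theorem exists_admissible : ∃ P : Subroutines, P.Admissible :=
  ⟨⟨LoopProgram.testTask.toCmd, (LoopProgram.articulationPoints .ap).toCmd,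
    LoopProgram.componentsTask.toCmd, LoopProgram.blocksTask.toCmd⟩,
    LoopProgram.isTest_testTask, LoopProgram.findsArticulationPoints_articulationPoints,
    LoopProgram.findsComponents_componentsTask, LoopProgram.findsBlocks_blocksTask⟩

/-! ### The algorithm -/

section Algorithm

open LoopProgram

variable {n : ℕ} {G : Digraph (Fin n)}

/-- Distinct vertices are adjacent if they lie in the same twinless strongly connected component of
`G \ {w}` for every other vertex `w`. -/
def blockGraph (G : Digraph (Fin n)) : SimpleGraph (Fin n) where
  Adj x y := x ≠ y ∧ ∀ (w : Fin n) (hx : x ≠ w) (hy : y ≠ w),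
    SameTSCC (deleteVertex G w) ⟨x, hx⟩ ⟨y, hy⟩
  symm := ⟨fun _ _ h => ⟨h.1.symm, fun w hy hx =>
    let ⟨C, h1, h2, h3⟩ := h.2 w hx hy
    ⟨C, h1, h3, h2⟩⟩⟩
  loopless := ⟨fun _ h => h.1 rfl⟩

/-- The blocks of the auxiliary graph are the 2-twinless blocks. -/
theorem isBlock_blockGraph_iff {B : Set (Fin n)} :
    IsBlock (blockGraph G) B ∧ B.Nontrivial ↔ IsTwoTwinlessBlock G B := by
  rw [isBlock_and_nontrivial_iff, IsTwoTwinlessBlock]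
  have : IsNontrivialClique (Inseparable (blockGraph G)) = fun U : Set (Fin n) => U.Nontrivial ∧
      ∀ x ∈ U, ∀ y ∈ U, x ≠ y → ∀ (w : Fin n) (hx : x ≠ w) (hy : y ≠ w),
      SameTSCC (deleteVertex G w) ⟨x, hx⟩ ⟨y, hy⟩ := by
    funext U
    refine propext (and_congr_right fun _ => forall₂_congr fun x _ => forall₂_congr fun y _ =>
      forall_congr' fun hxy => ?_)
    rw [inseparable_iff_of_adj (E := fun w => Linked (core fun x y => G.Adj x y ∧ x ≠ w ∧ y ≠ w))
      (fun w => ⟨.refl _, .symm, .trans⟩) (fun x y => ?_) hxy]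
    · exact forall_congr' fun w => forall₂_congr fun hx hy => (sameTSCC_deleteVertex_iff hx hy).symm
    · exact and_congr_right fun _ => forall_congr' fun w => forall₂_congr fun hx hy =>
        sameTSCC_deleteVertex_iff hx hy
  rw [this]

theorem isTwoTwinlessBlock_iff_eq_univ (h : IsTwoVertexTwinlessConnected G) {B : Set (Fin n)} :
    IsTwoTwinlessBlock G B ↔ B = Set.univ := by
  obtain ⟨hG, hn, hap⟩ := h
  have hsame : ∀ (x y w : Fin n) (hx : x ≠ w) (hy : y ≠ w),
      SameTSCC (deleteVertex G w) ⟨x, hx⟩ ⟨y, hy⟩ := by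
    intro x y w hx hy
    by_contra hc
    exact hap w ((isTwinlessArticulationPoint_iff hG w).2 ⟨x, y, hx, hy, hc⟩)
  rw [Nat.card_eq_fintype_card, Fintype.card_fin] at hn
  have huniv : (Set.univ : Set (Fin n)).Nontrivial :=
    ⟨⟨0, by omega⟩, trivial, ⟨1, by omega⟩, trivial, by simp⟩
  constructor
  · exact fun hB => hB.eq_of_subset ⟨huniv, fun x _ y _ _ w => hsame x y w⟩ (Set.subset_univ _)
  · rintro rfl
    exact ⟨⟨huniv, fun x _ y _ _ w => hsame x y w⟩, fun _ _ _ => Set.subset_univ _⟩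

/-- `outputAll` as a loop program. -/
def outputAllProgram : LoopProgram :=
  seq (loop .v (set .out (.lit 0) (scalar .v) (.lit 1))) (set .outCount (.lit 0) (.lit 0) (.lit 1))

/-- `initS` as a loop program. -/
def initSProgram : LoopProgram :=
  loop .v (loop .w (set .S (scalar .v) (scalar .w) (.lit 1)))

/-- `separatePairs` as a loop program. -/
def separatePairsProgram : LoopProgram :=
  loop .v (loop .w
    (ite (.and (.not (.eq (scalar .v) (scalar .z))) (.not (.eq (scalar .w) (scalar .z))))
      (ite (.not (.eq (.get .comp (scalar .v) (.lit 0)) (.get .comp (scalar .w) (.lit 0))))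
        (set .S (scalar .v) (scalar .w) (.lit 0)) skip) skip))

/-- `clearEb` as a loop program. -/
def clearEbProgram : LoopProgram :=
  loop .v (loop .w (set .Eb (scalar .v) (scalar .w) (.lit 0)))

/-- `buildEb` as a loop program. -/
def buildEbProgram : LoopProgram :=
  loop .v (loop .w
    (ite (.and (.eq (.get .S (scalar .v) (scalar .w)) (.lit 1))
        (.eq (.get .S (scalar .w) (scalar .v)) (.lit 1)))
      (set .Eb (scalar .v) (scalar .w) (.lit 1)) skip))

variable {σ : Store}

theorem sem_outputAll (hn : σ .size 0 0 = n) :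
    Outputs (n := n) (outputAllProgram.sem σ) {Set.univ} := by
  obtain ⟨h1, -⟩ := sem_loop_cells (i := .v) (x := .out) (by simp)
    (c := set .out (.lit 0) (scalar .v) (.lit 1)) hn (by simp [Writes]) (fun _ => True)
    (fun _ => 0) (fun a => a) (fun _ => 1) (fun _ _ _ h => h) (fun ρ a _ hi _ _ => by simp [hi])
  have hcnt : outputAllProgram.sem σ .outCount 0 0 = 1 := by
    simp [outputAllProgram, Store.write_apply]
  have hIio : Set.Iio 1 = ({0} : Set ℕ) := by
    ext i
    simp
  rw [Outputs, hcnt, hIio, Set.bijOn_singleton]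
  ext a
  simp only [outputAllProgram, sem_seq, sem_set, Set.mem_ofPred_eq, Set.mem_univ, iff_true]
  rw [Store.write_of_ne _ (by simp)]
  exact h1 a a.2 trivial

theorem sem_initS (hn : σ .size 0 0 = n) (a b : Fin n) : initSProgram.sem σ .S a b = 1 :=
  (sem_loop_loop_cells (i := .v) (j := .w) (x := .S) (by simp) (by simp)
    (by simp) (by simp) (by simp) (by simp) (c := set .S (scalar .v) (scalar .w) (.lit 1)) hn
    (by simp [Writes]) (fun _ _ => True) (fun _ _ => 1)
    (fun ρ a b _ _ hi hj _ => by simp [hi, hj])).1 a a.2 b b.2 trivial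

theorem sem_separatePairs (hn : σ .size 0 0 = n) {w : Fin n} (hw : σ .z 0 0 = w) (a b : Fin n) :
    separatePairsProgram.sem σ .S a b = 1 ↔ σ .S a b = 1 ∧
      (a ≠ w → b ≠ w → σ .comp a 0 = σ .comp b 0) := by
  obtain ⟨h1, h2⟩ := sem_loop_loop_cells (i := .v) (j := .w) (x := .S) (by simp) (by simp)
    (by simp) (by simp) (by simp) (by simp)
    (c := ite (.and (.not (.eq (scalar .v) (scalar .z))) (.not (.eq (scalar .w) (scalar .z))))
      (ite (.not (.eq (.get .comp (scalar .v) (.lit 0)) (.get .comp (scalar .w) (.lit 0))))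
        (set .S (scalar .v) (scalar .w) (.lit 0)) skip) skip) hn (by simp [Writes])
    (fun a b => (a ≠ w ∧ b ≠ w) ∧ σ .comp a 0 ≠ σ .comp b 0) (fun _ _ => 0)
    (fun ρ a b _ _ hi hj hρ => by
      have h1 := hρ .z (by simp) (by simp) (by simp)
      have h2 := hρ .comp (by simp) (by simp) (by simp)
      constructor
      · rintro ⟨⟨g1, g2⟩, g3⟩
        simp [hi, hj, h1, h2, hw, g1, g2, g3]
      · intro hp
        by_cases hab : a ≠ w ∧ b ≠ w
        · have hc : σ .comp a 0 = σ .comp b 0 := by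
            by_contra hc
            exact hp ⟨hab, hc⟩
          simp [hi, hj, h1, h2, hw, hc]
        · rw [sem_ite, if_neg]
          · simp
          · simp only [ne_eq, eval_and_eq_zero, eval_not_eq_zero, eval_eq_eq_zero, eval_scalar, hi, hj,
              h1, hw]
            tauto)
  by_cases hp : ((a : ℕ) ≠ w ∧ (b : ℕ) ≠ w) ∧ σ .comp a 0 ≠ σ .comp b 0
  · rw [separatePairsProgram, h1 a a.2 b b.2 hp]
    refine ⟨fun h => absurd h (by simp), fun h => absurd (h.2 ?_ ?_) hp.2⟩
    exacts [fun e => hp.1.1 (congrArg _ e), fun e => hp.1.2 (congrArg _ e)]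
  · rw [separatePairsProgram, h2 a b fun _ _ => hp]
    refine ⟨fun h => ⟨h, fun ha hb => ?_⟩, fun h => h.1⟩
    by_contra hc
    exact hp ⟨⟨fun e => ha (Fin.ext e), fun e => hb (Fin.ext e)⟩, hc⟩

theorem sem_buildEb (hn : σ .size 0 0 = n) (a b : Fin n) :
    (buildEbProgram.sem (clearEbProgram.sem σ)) .Eb a b = 1 ↔ σ .S a b = 1 ∧ σ .S b a = 1 := by
  have h0 : clearEbProgram.sem σ .Eb a b = 0 :=
    (sem_loop_loop_cells (i := .v) (j := .w) (x := .Eb) (by simp) (by simp)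
      (by simp) (by simp) (by simp) (by simp) (c := set .Eb (scalar .v) (scalar .w) (.lit 0)) hn
      (by simp [Writes]) (fun _ _ => True) (fun _ _ => 0)
      (fun ρ a b _ _ hi hj _ => by simp [hi, hj])).1 a a.2 b b.2 trivial
  have hS : clearEbProgram.sem σ .S = σ .S := sem_of_not_writes (by simp [clearEbProgram, Writes]) σ
  obtain ⟨h1, h2⟩ := sem_loop_loop_cells (i := .v) (j := .w) (x := .Eb) (by simp) (by simp)
    (by simp) (by simp) (by simp) (by simp)
    (c := ite (.and (.eq (.get .S (scalar .v) (scalar .w)) (.lit 1))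
        (.eq (.get .S (scalar .w) (scalar .v)) (.lit 1)))
      (set .Eb (scalar .v) (scalar .w) (.lit 1)) skip) (σ := clearEbProgram.sem σ) (n := n)
    (by rw [sem_eq _ _ (by simp [clearEbProgram, Writes]), hn]) (by simp [Writes])
    (fun a b => σ .S a b = 1 ∧ σ .S b a = 1) (fun _ _ => 1) (fun ρ a b _ _ hi hj hρ => by
      have h1 := (hρ .S (by simp) (by simp) (by simp)).trans hS
      constructor
      · rintro ⟨g1, g2⟩
        simp [hi, hj, h1, g1, g2]
      · intro hp
        rw [sem_ite, if_neg]
        · simp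
        · simp only [ne_eq, eval_and_eq_zero, eval_eq_eq_zero, eval_scalar, eval_get, eval_lit, hi, hj,
            h1]
          tauto)
  by_cases hp : σ .S a b = 1 ∧ σ .S b a = 1
  · rw [buildEbProgram, h1 a a.2 b b.2 hp]
    simp [hp]
  · rw [buildEbProgram, h2 a b fun _ _ => hp, h0]
    simp [hp]

theorem exec_separatePairs (h0 : 0 < n) (hn : σ .size 0 0 = n) : ∃ t,
    Exec separatePairs σ t (separatePairsProgram.sem σ) ∧ t ≤ separatePairsProgram.coeff * n ^ 2 :=
  hn ▸ exec_toCmd (c := separatePairsProgram)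
    (by simp [separatePairsProgram, WellFormed, Writes]) (by simp [separatePairsProgram, depth]) σ
    (hn ▸ h0)

theorem blockGraph_adj_iff (hG : IsTwinlessStronglyConnected G) {a b : Fin n} (hab : a ≠ b) :
    (blockGraph G).Adj a b ↔ ∀ w : Fin n, IsTwinlessArticulationPoint G w →
      ∀ (ha : a ≠ w) (hb : b ≠ w), SameTSCC (deleteVertex G w) ⟨a, ha⟩ ⟨b, hb⟩ := by
  refine ⟨fun h w _ ha hb => h.2 w ha hb, fun h => ⟨hab, fun w ha hb => ?_⟩⟩
  by_contra hc
  exact hc (h w ((isTwinlessArticulationPoint_iff hG w).2 ⟨a, b, ha, hb, hc⟩) ha hb)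

/-- The loop over the twinless articulation points leaves a matrix whose entries for distinct
vertices describe the auxiliary graph. -/
theorem exec_separationLoop {c : Cmd} (hc : FindsComponents c) :
    ∃ K : ℕ, ∀ (n : ℕ) (G : Digraph (Fin n)), IsTwinlessStronglyConnected G → ∀ σ : Store,
      HoldsDigraph σ G → (∀ a : Fin n, σ .ap a 0 = 1 ↔ IsTwinlessArticulationPoint G a) →
      (∀ a b : Fin n, σ .S a b = 1) → ∃ t τ,
        Exec (forEach .z (when (.eq (.get .ap (scalar .z) (.lit 0)) (.lit 1))
          (.seq c separatePairs))) σ t τ ∧ t ≤ K * n ^ 3 ∧ τ .size 0 0 = n ∧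
        ∀ a b : Fin n, a ≠ b → (τ .S a b = 1 ↔ (blockGraph G).Adj a b) := by
  obtain ⟨K, hK⟩ := hc
  obtain ⟨L, hL⟩ : ∃ L, L = separatePairsProgram.coeff := ⟨_, rfl⟩
  refine ⟨K + L + 36, fun n G hG σ hσ hap hS => ?_⟩
  have h0 := hG.pos
  have hloop := exec_forEach (x := .z)
    (c := when (.eq (.get .ap (scalar .z) (.lit 0)) (.lit 1)) (.seq c separatePairs)) (n := n)
    (T := (K + L) * n ^ 2 + 9) (fun m ρ => HoldsDigraph ρ G ∧ ρ .ap = σ .ap ∧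
      ∀ a b : Fin n, ρ .S a b = 1 ↔ ∀ w : Fin n, (w : ℕ) < m → IsTwinlessArticulationPoint G w →
        ∀ (ha : a ≠ w) (hb : b ≠ w), SameTSCC (deleteVertex G w) ⟨a, ha⟩ ⟨b, hb⟩)
    (fun m ρ hρ => hρ.1.1) ?_ (σ := σ) ?_
  · obtain ⟨t, τ, he, ht, hτ, -, hτS⟩ := hloop
    refine ⟨t, τ, he, ht.trans ?_, hτ.1, fun a b hab => ?_⟩
    · have e1 : n ≤ n ^ 3 := Nat.le_self_pow (by simp) n
      have e2 : n * ((K + L) * n ^ 2 + 9 + 15) = (K + L) * n ^ 3 + 24 * n := by ring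
      rw [e2, add_mul (K + L)]
      omega
    · rw [hτS, blockGraph_adj_iff hG hab]
      exact forall_congr' fun w => by simp
  · rintro m ρ hm ⟨hρ, hρap, hρS⟩ hz
    have hlt : ∀ w : Fin n, (w : ℕ) < m + 1 ↔ (w : ℕ) < m ∨ w = ⟨m, hm⟩ := fun w => by
      rw [Fin.ext_iff, Nat.lt_succ_iff_lt_or_eq]
    have hmem : ∀ τ : Store, τ .size = ρ .size → τ .adj = ρ .adj →
        HoldsDigraph (τ.write .z 0 0 (m + 1)) G := fun τ h1 h2 =>
      holdsDigraph_of_eq hρ ((Store.write_of_ne _ (by simp) _ _ _).trans h1)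
        ((Store.write_of_ne _ (by simp) _ _ _).trans h2)
    by_cases hm' : IsTwinlessArticulationPoint G ⟨m, hm⟩
    · obtain ⟨t, τ, he, ht, hτ, hcomp⟩ := hK n G hG ⟨m, hm⟩ ρ hρ hz
      have hfr : ∀ x : Reg, x ≠ .comp → (∀ k, x ≠ .tmp k) → τ x = ρ x := hτ
      have hτn : τ .size 0 0 = n := by rw [hfr _ (by simp) (by simp), hρ.1]
      have hτz : τ .z 0 0 = m := by rw [hfr _ (by simp) (by simp), hz]
      obtain ⟨t', he', ht'⟩ := exec_separatePairs h0 hτn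
      rw [← hL] at ht'
      have hfr' : ∀ x : Reg, x ≠ .comp → (∀ k, x ≠ .tmp k) → x ≠ .v → x ≠ .w → x ≠ .S →
          separatePairsProgram.sem τ x = ρ x := fun x h1 h2 h3 h4 h5 => by
        rw [sem_of_not_writes (by simp [separatePairsProgram, Writes, h3, h4, h5]), hfr x h1 h2]
      refine ⟨_, _, .ite_true ?_ (.seq he he'), ?_, ?_,
        hmem _ (hfr' _ (by simp) (by simp) (by simp) (by simp) (by simp))
          (hfr' _ (by simp) (by simp) (by simp) (by simp) (by simp)), ?_, fun a b => ?_⟩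
      · rw [ne_eq, eval_eq_eq_zero, not_not, eval_get, eval_scalar, hz, hρap]
        exact (hap ⟨m, hm⟩).2 hm'
      · simp only [Expr.cost, scalar, add_mul]
        omega
      · rw [hfr' _ (by simp) (by simp) (by simp) (by simp) (by simp), hz]
      · rw [Store.write_of_ne _ (by simp), hfr' _ (by simp) (by simp) (by simp) (by simp) (by simp),
          hρap]
      · rw [Store.write_of_ne _ (by simp), sem_separatePairs hτn (w := ⟨m, hm⟩) hτz,
          hfr _ (by simp) (by simp), hρS]
        constructor
        · rintro ⟨h1, h2⟩ w hw hwap ha hb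
          rcases (hlt w).1 hw with hw | rfl
          exacts [h1 w hw hwap ha hb, (hcomp a b ha hb).1 (h2 ha hb)]
        · exact fun h => ⟨fun w hw => h w (by omega), fun ha hb =>
            (hcomp a b ha hb).2 (h _ (by simp) hm' ha hb)⟩
    · refine ⟨_, ρ, .ite_false ?_ (.skip ρ), ?_, hz, hmem _ rfl rfl, ?_, fun a b => ?_⟩
      · rw [eval_eq_eq_zero, eval_get, eval_scalar, hz, hρap]
        exact fun h => hm' ((hap ⟨m, hm⟩).1 h)
      · simp only [Expr.cost, scalar]
        omega
      · rw [Store.write_of_ne _ (by simp), hρap]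
      · rw [Store.write_of_ne _ (by simp), hρS]
        refine ⟨fun h w hw hwap => ?_, fun h w hw => h w (by omega)⟩
        rcases (hlt w).1 hw with hw | rfl
        exacts [h w hw hwap, absurd hwap hm']
  · refine ⟨holdsDigraph_of_eq hσ (Store.write_of_ne _ (by simp) _ _ _)
      (Store.write_of_ne _ (by simp) _ _ _), Store.write_of_ne _ (by simp) _ _ _, fun a b => ?_⟩
    rw [Store.write_of_ne _ (by simp)]
    simp [hS]

theorem exec_algorithm {P : Subroutines} (hP : P.Admissible) :
    ∃ K : ℕ, ∀ (n : ℕ) (G : Digraph (Fin n)), IsTwinlessStronglyConnected G →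
      ∀ σ : Store, HoldsDigraph σ G → ∃ (t : ℕ) (τ : Store), Exec (algorithm P) σ t τ ∧
        t ≤ K * n ^ 3 ∧ Outputs τ {B | IsTwoTwinlessBlock G B} := by
  obtain ⟨⟨K₁, h₁⟩, ⟨K₂, h₂⟩, h₃, ⟨K₄, h₄⟩⟩ := hP
  obtain ⟨K₃, h₃⟩ := exec_separationLoop h₃
  refine ⟨K₁ + K₂ + K₃ + K₄ + 6 + outputAllProgram.coeff + initSProgram.coeff +
    clearEbProgram.coeff + buildEbProgram.coeff, fun n G hG σ hσ => ?_⟩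
  have h0 := hG.pos
  have hpow : 1 ≤ n ^ 3 := Nat.one_le_pow _ _ h0
  obtain ⟨t₁, σ₁, e₁, b₁, fr₁, q₁⟩ := h₁ n G hG σ hσ
  have hσ₁ : HoldsDigraph σ₁ G := holdsDigraph_of_eq hσ (fr₁ _ (by simp) (by simp))
    (fr₁ _ (by simp) (by simp))
  by_cases hG2 : IsTwoVertexTwinlessConnected G
  · obtain ⟨t₂, e₂, b₂⟩ := exec_toCmd (c := outputAllProgram) (d := 3)
      (by simp [outputAllProgram, WellFormed, Writes]) (by simp [outputAllProgram, depth]) σ₁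
      (hσ₁.1 ▸ h0)
    rw [hσ₁.1] at b₂
    refine ⟨_, _, .seq e₁ (.ite_true ?_ e₂), ?_, ?_⟩
    · rw [ne_eq, eval_eq_eq_zero, not_not]
      exact q₁.2 hG2
    · simp only [Expr.cost, scalar, add_mul]
      omega
    · have : {B | IsTwoTwinlessBlock G B} = {Set.univ} :=
        Set.ext fun B => isTwoTwinlessBlock_iff_eq_univ hG2
      rw [this]
      exact sem_outputAll hσ₁.1
  have wi : ∀ y, initSProgram.Writes y → y = .v ∨ y = .w ∨ y = .S := fun y h => h
  have wc : ∀ y, clearEbProgram.Writes y → y = .v ∨ y = .w ∨ y = .Eb := fun y h => h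
  have wb : ∀ y, buildEbProgram.Writes y → y = .v ∨ y = .w ∨ y = .Eb := fun y h => by
    simpa [buildEbProgram, Writes] using h
  obtain ⟨t₂, e₂, b₂⟩ := exec_toCmd (c := initSProgram) (d := 3)
    (by simp [initSProgram, WellFormed, Writes]) (by simp [initSProgram, depth]) σ₁ (hσ₁.1 ▸ h0)
  rw [hσ₁.1] at b₂
  set σ₂ := initSProgram.sem σ₁ with hσ₂def
  have hσ₂ : HoldsDigraph σ₂ G := holdsDigraph_of_eq hσ₁
    (sem_of_not_writes (fun h => by simpa using wi _ h) _)
    (sem_of_not_writes (fun h => by simpa using wi _ h) _)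
  obtain ⟨t₃, σ₃, e₃, b₃, fr₃, q₃⟩ := h₂ n G hG σ₂ hσ₂
  have hσ₃ : HoldsDigraph σ₃ G := holdsDigraph_of_eq hσ₂ (fr₃ _ (by simp) (by simp))
    (fr₃ _ (by simp) (by simp))
  obtain ⟨t₄, σ₄, e₄, b₄, n₄, q₄⟩ := h₃ n G hG σ₃ hσ₃ q₃ fun a b => by
    rw [fr₃ _ (by simp) (by simp)]
    exact sem_initS hσ₁.1 a b
  obtain ⟨t₅, e₅, b₅⟩ := exec_toCmd (c := clearEbProgram) (d := 3)
    (by simp [clearEbProgram, WellFormed, Writes]) (by simp [clearEbProgram, depth]) σ₄ (n₄ ▸ h0)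
  have n₅ : clearEbProgram.sem σ₄ .size 0 0 = n := by
    rw [sem_of_not_writes (fun h => by simpa using wc _ h), n₄]
  obtain ⟨t₆, e₆, b₆⟩ := exec_toCmd (c := buildEbProgram) (d := 3)
    (by simp [buildEbProgram, WellFormed, Writes]) (by simp [buildEbProgram, depth])
    (clearEbProgram.sem σ₄) (n₅ ▸ h0)
  rw [n₄] at b₅
  rw [n₅] at b₆
  obtain ⟨t₇, σ₇, e₇, b₇, -, q₇⟩ := h₄ n (blockGraph G) h0
    (buildEbProgram.sem (clearEbProgram.sem σ₄))
    ⟨by rw [sem_of_not_writes (fun h => by simpa using wb _ h), n₅], fun a b hab => by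
      rw [sem_buildEb n₄, q₄ a b hab, q₄ b a hab.symm, (blockGraph G).adj_comm b a, and_self]⟩
  refine ⟨_, σ₇, .seq e₁ (.ite_false ?_ (.seq e₂ (.seq e₃ (.seq e₄ (.seq e₅ (.seq e₆ e₇)))))),
    ?_, ?_⟩
  · rw [eval_eq_eq_zero]
    exact fun h => hG2 (q₁.1 h)
  · simp only [Expr.cost, scalar, add_mul]
    omega
  · have : {B | IsTwoTwinlessBlock G B} = {B | IsBlock (blockGraph G) B ∧ B.Nontrivial} :=
      Set.ext fun B => isBlock_blockGraph_iff.symm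
    rw [this]
    exact q₇

end Algorithm

end TwinlessBlocks

theorem mainTheorem2 :
    (∃ P : TwinlessBlocks.Subroutines, P.Admissible) ∧
    ∀ P : TwinlessBlocks.Subroutines, P.Admissible →
      ∃ K : ℕ, ∀ (n : ℕ) (G : Digraph (Fin n)),
        TwinlessBlocks.IsTwinlessStronglyConnected G →
          ∀ σ : TwinlessBlocks.Store, TwinlessBlocks.HoldsDigraph σ G →
            ∃ (t : ℕ) (τ : TwinlessBlocks.Store),
              TwinlessBlocks.Exec (TwinlessBlocks.algorithm P) σ t τ ∧
              t ≤ K * n ^ 3 ∧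
              TwinlessBlocks.Outputs τ {B | TwinlessBlocks.IsTwoTwinlessBlock G B} :=
  ⟨TwinlessBlocks.exists_admissible, fun _ hP => TwinlessBlocks.exec_algorithm hP⟩
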